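/- **Setting.** Let $G$ be a finite-dimensional real Lie group with Lie algebra $\mathfrak g$, Maurer–Cartan form $\Theta$, and coadjoint actions $\langle \mathrm{Ad}^*(g)\eta;A\rangle=\langle\eta;\mathrm{Ad}(g^{-1})A\rangle$, $\langle \mathrm{ad}^*(A)\eta;B\rangle=-\langle\eta;[A,B]\rangle$ on $\mathfrak g^*$. Let $\mathbb A=P+\mathfrak a\subset\mathfrak g$ be an affine subspace with $P\notin\mathfrak a$, let $\omega\in\mathfrak g^*$ satisfy $\omega(P)=1$, $\omega|_{\mathfrak a}=0$, and let $L:\mathbb A\to\mathbb R$ be smooth (an invariant Lagrangian). Put $\tilde Z=G\times\{(Q,\eta)\in\mathbb A\times\mathfrak g^*:\langle\eta;Q\rangle=L(Q)\}$, $\psi|_{(g,Q,\eta)}=\eta$ (as a left-invariant form pulled back from $G$), and $\Psi=d\psi$. The momentum space is the non-empty immersed submanifold $Y\subset\tilde Z$ such that through every point of $Y$ there is a tangent vector $e$ to $Y$ with $\omega(e)\ne0$ and $\Psi(e,V)=0$ for all $V$ tangent to $\tilde Z$, and which contains every immersed submanifold of $\tilde Z$ with this property; it is $G$-invariant, $Y=G\times\mathcal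 F$, where the phase space $\mathcal F$ is an immersed submanifold of $\mathbb A\times\mathfrak g^*$. On $\mathcal F$ put $\mathcal H(Q,\eta)=Q$ (the Hamiltonian) and $\Lambda(Q,\eta)=\eta$ (the Legendre transform). The Lagrangian is non-degenerate if $\dim Y=2m+1$ and $\omega\wedge(\Psi|_Y)^m$ vanishes nowhere; then the characteristic vector field $\xi$ on $Y$ is defined by $i_\xi\Psi|_Y=0$, $\omega(\xi)=1$. Let $\Phi_\xi$ be the $\mathcal F$-component of $\xi$ (a vector field on $\mathcal F$), $\mathcal F_r=\{\Phi_\xi\neq0\}$ and $Y_r=G\times\mathcal F_r$. The Lagrangian is coisotropic if it is non-degenerate and at every point of $Y_r$ the $\Psi|_Y$-polar space of the tangent space of the $G$-orbit (for left translations on $G$) is contained in the sum of that tangent space and $\ker\Psi|_Y$. It is assumed that $\Lambda$ is one-to-one, so that $\mathcal F$ is regarded as an immersed submanifold of $\mathfrak g^*$. Let $J(g,\eta)=\mathrm{Ad}^*(g)\eta$ be the moment map on $Y$ and fix $\mu\in J(Y_r)$. Write $G_\mu$, $\mathfrak g_\mu$ for the isotropy group and algebra of $\mu$. The phase portrait $\mathcal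 P(\mu)=\mathcal F_r\cap\mathcal O(\mu)$ is the intersection of $\mathcal F_r$ with the coadjoint orbit, with the topology of the fibre product of $\mathcal F_r$ and $\mathcal O(\mu)=G/G_\mu$ over $\mathfrak g^*$. Let $\tilde{\mathcal P}(\mu)$ be a connected component of it (any one; if $\mu\in\mathcal F_r$ one may take the component of $\mu$). Let $P^\mu=\{(g,\eta)\in J^{-1}(\mu):\eta\in\tilde{\mathcal P}(\mu)\}$ be the reduced Marsden–Weinstein fibration over $\tilde{\mathcal P}(\mu)$, $\sigma^\mu$ the one-form on $\tilde{\mathcal P}(\mu)$ with $\sigma^\mu(\Phi_\xi)=1$, and $\theta^\mu|_{(g,\eta)}=\mathrm{Ad}(g)(\Theta-\mathcal H\sigma^\mu)$. A curve in $P^\mu$ is horizontal if it annihilates $\theta^\mu$. Curves are smooth and defined on non-empty open intervals. **Statement.** For a coisotropic invariant Lagrangian with one-to-one Legendre transform, and for $\mu$, $\tilde{\mathcal P}(\mu)$ as above: 1. The vector field $\xi$ exists and is unique, and $J$ is constant along any integral curve of $\xi$ in $Y_r$ that has momentum $\mu$ at one instant. The algebra $\mathfrak g_\mu$ and the identity component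 of $G_\mu$ are Abelian. The base is one-dimensional: its tangent spaces are lines, $\sigma^\mu$ exists and is unique, and every point has an open neighbourhood in $\mathcal P(\mu)$ that is parametrized homeomorphically by an integral curve of $\Phi_\xi$ on some $(-\varepsilon,\varepsilon)$. The form $\theta^\mu$ is a connection on $P^\mu$: it is $\mathfrak g_\mu$-valued, it takes the value $A$ on the fundamental vector field of $A\in\mathfrak g_\mu$, and $G_\mu$ preserves $P^\mu$, with $\theta^\mu|_{(mg,\eta)}\circ (L_m)_*=\mathrm{Ad}(m)\,\theta^\mu|_{(g,\eta)}$ for $m\in G_\mu$. 2. The integral curves of $\xi$ with momentum $\mu$ are the horizontal curves of $\theta^\mu$. Precisely: an integral curve of $\xi$ in $Y_r$ with momentum $\mu$ lies in $P^\mu$, for the component $\tilde{\mathcal P}(\mu)$ that contains any given one of its points $\eta(t_0)$; a curve $\Gamma=(h,\eta)$ in $P^\mu$ is an integral curve of $\xi$ if and only if it is horizontal and $\eta^*\sigma^\mu=dt$; and it is horizontal if and only if $\Gamma'(t)=\sigma^\mu(\eta'(t))\,\xi|_{\Gamma(t)}$ for all $t$. Every horizontal curve with nowhere vanishing velocity is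 an integral curve of $\xi$ in $P^\mu$ up to a smooth change of parameter $\tau$ with $\tau'=\sigma^\mu(\eta')\neq0$, and every smooth reparametrization of an integral curve of $\xi$ in $P^\mu$ is horizontal. 3. (Quadrature.) Let $\eta:(a,b)\to\tilde{\mathcal P}(\mu)$ be a smooth curve, $\eta^*\sigma^\mu=v^\mu\,dt$. There is a smooth $g:(a,b)\to G$ such that $(g^{-1},\eta)$ takes values in $P^\mu$, i.e. $\mathrm{Ad}^*(g^{-1})\eta=\mu$. For every such $g$ the map $v^\mu\,\mathrm{Ad}(g^{-1})\mathcal H(\eta)+g^{-1}g'$ is smooth with values in $\mathfrak g_\mu$, and for every $t_0\in(a,b)$ $$h(t)=\mathrm{Exp}\int_{t_0}^t\Big(v^\mu(u)\,\mathrm{Ad}(g(u)^{-1})\,\mathcal H[\eta(u)]+g(u)^{-1}g'(u)\Big)\,du$$ lies in $G_\mu$; the curve $(h\,g^{-1},\eta)$ is a horizontal curve in $P^\mu$, and the horizontal curves of $P^\mu$ over $\eta$ are exactly the curves $(m\,h\,g^{-1},\eta)$ with $m\in G_\mu$ constant. 4. Every integral curve of $\xi$ with momentum $\mu$ projects to an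 extremal of the variational problem, namely to a curve $(\alpha,\beta)$ in $G\times\mathbb A$ with $\alpha^{-1}\alpha'=\beta$ that is a critical point of $\int L(\beta)\,dt$ under compactly supported variations through such curves. -/

import Mathlib

open scoped Manifold ContDiff Topology
open Set

universe u v w

noncomputable section

namespace CoisotropicProblem

/-! ### Lie groups

`G` is a finite-dimensional real Lie group modelled on the normed space `E`.  In Mathlib the tangent
space of `G` at any point, in particular the Lie algebra `T_1 G` (`GroupLieAlgebra`), is by
definition a copy of `E`; so `E` plays the role of the Lie algebra `𝔤`, and `Dual E` that of `𝔤*`. -/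

/-- The dual `𝔤*`. -/
abbrev Dual (E : Type v) [NormedAddCommGroup E] [NormedSpace ℝ E] : Type v := E →L[ℝ] ℝ

section LieGroup

variable {E : Type v} [NormedAddCommGroup E] [NormedSpace ℝ E]
variable (G : Type u) [TopologicalSpace G] [ChartedSpace E G] [Group G] [LieGroup 𝓘(ℝ, E) ∞ G]

theorem lieGroup_three : LieGroup 𝓘(ℝ, E) (minSmoothness ℝ 3) G :=
  LieGroup.of_le (n := ∞) (by rw [minSmoothness_of_isRCLikeNormedField]; exact ENat.LEInfty.out)

variable [FiniteDimensional ℝ E]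

/-- The Lie bracket of `𝔤 = T_1 G`, as a bilinear map. -/
def bracket : E →ₗ[ℝ] E →ₗ[ℝ] E :=
  haveI := lieGroup_three (E := E) G
  haveI : CompleteSpace E := FiniteDimensional.complete ℝ E
  LinearMap.mk₂ ℝ (M := GroupLieAlgebra 𝓘(ℝ, E) G) (Nₗ := GroupLieAlgebra 𝓘(ℝ, E) G)
    (Pₗ := GroupLieAlgebra 𝓘(ℝ, E) G) (fun A B => ⁅A, B⁆)
    add_lie (fun c A B => smul_lie c A B) lie_add (fun c A B => lie_smul c A B)

theorem bracket_apply (A B : GroupLieAlgebra 𝓘(ℝ, E) G) :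
    bracket (E := E) G A B = (⁅A, B⁆ : GroupLieAlgebra 𝓘(ℝ, E) G) := rfl

/-- `A ↦ ad*(A) η`, where `⟨ad*(A) η; B⟩ = -⟨η; [A, B]⟩`.  Its range is the tangent space
`O(η)` at `η` of the coadjoint orbit of `η`. -/
def adStar (η : Dual E) : E →ₗ[ℝ] Dual E :=
  -((LinearMap.toContinuousLinearMap : (E →ₗ[ℝ] ℝ) ≃ₗ[ℝ] (E →L[ℝ] ℝ)).toLinearMap ∘ₗ
      (LinearMap.compRight ℝ (η : E →ₗ[ℝ] ℝ) ∘ₗ bracket G))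

theorem adStar_apply (η : Dual E) (A B : E) : adStar G η A B = -η (bracket G A B) := rfl

/-- The isotropy algebra `𝔤_μ`. -/
def isotropyAlgebra (μ : Dual E) : Submodule ℝ E := LinearMap.ker (adStar G μ)

variable {G}

/-- The Maurer-Cartan form `Θ_g : T_g G → 𝔤`. -/
def maurerCartan (g : G) : E →L[ℝ] E :=
  mfderiv 𝓘(ℝ, E) 𝓘(ℝ, E) (fun x : G => g⁻¹ * x) g

/-- The adjoint representation. -/
def Ad (g : G) : E →L[ℝ] E :=
  mfderiv 𝓘(ℝ, E) 𝓘(ℝ, E) (fun x : G => g * x * g⁻¹) 1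

/-- The coadjoint representation, `⟨Ad*(g) η; A⟩ = ⟨η; Ad(g⁻¹) A⟩`. -/
def coAd (g : G) (η : Dual E) : Dual E := η.comp (Ad g⁻¹)

/-- The value at `g`, left-trivialized, of the fundamental vector field of `A ∈ 𝔤` for the action of
`G` on itself by left translations. -/
def fundamental (g : G) (A : E) : E :=
  maurerCartan g (mfderiv 𝓘(ℝ, E) 𝓘(ℝ, E) (fun x : G => x * g) 1 A : E)

/-- `h⁻¹ h'` for a curve `h` in `G`. -/
def velG (h : ℝ → G) (t : ℝ) : E :=
  maurerCartan (h t) (mfderiv 𝓘(ℝ, ℝ) 𝓘(ℝ, E) h t (1 : ℝ) : E)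

variable (G) in
/-- The isotropy group `G_μ`, as a set. -/
def isotropyGroup (μ : Dual E) : Set G := {g | coAd g μ = μ}

/-- `γ` is the one-parameter subgroup of `G` with initial velocity `A`. -/
def IsOneParameterSubgroup (A : E) (γ : ℝ → G) : Prop :=
  ContMDiff 𝓘(ℝ, ℝ) 𝓘(ℝ, E) ∞ γ ∧ (∀ s t, γ (s + t) = γ s * γ t) ∧ velG γ 0 = A

variable (G) in
/-- The exponential map `Exp : 𝔤 → G`. -/
def lieExp (A : E) : G := Classical.epsilon (IsOneParameterSubgroup (G := G) A) 1

variable (G) in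
/-- The coadjoint orbit `𝓞(μ)`, with its topology of homogeneous space `G / G_μ`. -/
def CoadjointOrbit (μ : Dual E) : Type v := Set.range fun g : G => coAd g μ

instance (μ : Dual E) : TopologicalSpace (CoadjointOrbit G μ) :=
  TopologicalSpace.coinduced (Set.rangeFactorization fun g : G => coAd g μ) inferInstance

end LieGroup

/-! ### Immersed submanifolds -/

/-- An immersed submanifold (not necessarily embedded) of a manifold `M`: a Hausdorff second
countable smooth manifold with an injective immersion into `M`. -/
structure ImmersedSubmanifold {W : Type*} [NormedAddCommGroup W] [NormedSpace ℝ W] {H : Type*}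
    [TopologicalSpace H] (I : ModelWithCorners ℝ W H) (M : Type*) [TopologicalSpace M]
    [ChartedSpace H M] where
  carrier : Type w
  dim : ℕ
  [top : TopologicalSpace carrier]
  [charted : ChartedSpace (EuclideanSpace ℝ (Fin dim)) carrier]
  [isManifold : IsManifold (𝓡 dim) ∞ carrier]
  [t2 : T2Space carrier]
  [secondCountable : SecondCountableTopology carrier]
  incl : carrier → M
  injective_incl : Function.Injective incl
  contMDiff_incl : ContMDiff (𝓡 dim) I ∞ incl
  immersion : ∀ x, Function.Injective (mfderiv (𝓡 dim) I incl x)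

attribute [instance] ImmersedSubmanifold.top ImmersedSubmanifold.charted
  ImmersedSubmanifold.isManifold ImmersedSubmanifold.t2 ImmersedSubmanifold.secondCountable

/-! ### Invariant Lagrangians -/

/-- An affine subspace `𝔸 = P + 𝔞` of `𝔤` not through the origin, a form `ω ∈ 𝔤*` (the field
`indep`, the independence form) with `ω(P) = 1` and `ω|_𝔞 = 0`, and an invariant Lagrangian `L : 𝔸 → ℝ`.  Points of `𝔸` are written `P + a`, with
`a ∈ 𝔞`, and `L` is given as a function of `a`. -/
structure InvariantLagrangian (E : Type v) [NormedAddCommGroup E] [NormedSpace ℝ E] where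
  P : E
  𝔞 : Submodule ℝ E
  P_notMem : P ∉ 𝔞
  indep : Dual E
  indep_P : indep P = 1
  indep_𝔞 : ∀ a ∈ 𝔞, indep a = 0
  L : 𝔞 → ℝ
  contDiff_L : ContDiff ℝ ∞ L

namespace InvariantLagrangian

variable {E : Type v} [NormedAddCommGroup E] [NormedSpace ℝ E] [FiniteDimensional ℝ E]
variable (G : Type u) [TopologicalSpace G] [ChartedSpace E G] [Group G] [LieGroup 𝓘(ℝ, E) ∞ G]
variable (𝓛 : InvariantLagrangian E)

/-- `𝔸 × 𝔤*`, a point `(P + a, η)` being recorded as `(a, η)`. -/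
abbrev V : Type v := 𝓛.𝔞 × Dual E

variable {𝓛} in
/-- The point `Q = P + a` of `𝔸`. -/
def Q (x : 𝓛.V) : E := 𝓛.P + x.1

/-- The function `(Q, η) ↦ ⟨η; Q⟩ - L(Q)`. -/
def constraint (x : 𝓛.V) : ℝ := x.2 (Q x) - 𝓛.L x.1

/-- `𝒵̃ = {(Q, η) : ⟨η; Q⟩ = L(Q)}`; the affine bundle `Z̃` over `G × 𝔸` is `G × 𝒵̃`. -/
def Ztilde : Set 𝓛.V := {x | 𝓛.constraint x = 0}

/-- The tangent space of `Z̃ = G × 𝒵̃` at `(g, x)`, as a subspace of `𝔤 × (𝔞 × 𝔤*)` by means of the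
left-invariant trivialization of `TG`. -/
def tangentZ (x : 𝓛.V) : Submodule ℝ (E × 𝓛.V) :=
  LinearMap.ker ((fderiv ℝ 𝓛.constraint x).comp (ContinuousLinearMap.snd ℝ E 𝓛.V)).toLinearMap

/-- The Liouville form `ψ = π^*(η)` on `G × 𝔸 × 𝔤*`, left-trivialized. -/
def psi (x : 𝓛.V) : (E × 𝓛.V) →L[ℝ] ℝ := x.2.comp (ContinuousLinearMap.fst ℝ E 𝓛.V)

/-- The exterior derivative of a left-invariant one-form `β` on `G × 𝔸 × 𝔤*`, given in the left
trivialization: `dβ(X, Y) = ½ (X[β(Y)] - Y[β(X)] - β([X, Y]))`, evaluated on the left-invariant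
extensions of `X` and `Y`, whose bracket is the left-invariant field with value
`([X.1, Y.1], 0)`. -/
def extDerivInv (β : 𝓛.V → (E × 𝓛.V) →L[ℝ] ℝ) (x : 𝓛.V) (X Y : E × 𝓛.V) : ℝ :=
  (1 / 2 : ℝ) * (fderiv ℝ (fun y => β y Y) x X.2 - fderiv ℝ (fun y => β y X) x Y.2
    - β x (bracket G X.1 Y.1, 0))

/-- The canonical two-form `Ψ = dψ`. -/
def Psi (x : 𝓛.V) (X Y : E × 𝓛.V) : ℝ := 𝓛.extDerivInv G 𝓛.psi x X Y


theorem Psi_apply (x : 𝓛.V) (X Y : E × 𝓛.V) : 𝓛.Psi G x X Y =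
    (1 / 2 : ℝ) * (X.2.2 Y.1 - Y.2.2 X.1 - x.2 (bracket G X.1 Y.1)) := by
  have h : ∀ Y : E × 𝓛.V, fderiv ℝ (fun y : 𝓛.V => 𝓛.psi y Y) x
      = ((ContinuousLinearMap.apply ℝ ℝ Y.1).comp (ContinuousLinearMap.snd ℝ 𝓛.𝔞 (Dual E))) := by
    intro Y
    exact ((ContinuousLinearMap.apply ℝ ℝ Y.1).comp
      (ContinuousLinearMap.snd ℝ 𝓛.𝔞 (Dual E))).fderiv
  simp only [Psi, extDerivInv, h]
  rfl

/-- `X` spans an integral element at `(g, x)` of the Cartan system `(𝒞(Ψ), ω)` on `Z̃`. -/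
def IsIntegralVector (x : 𝓛.V) (X : E × 𝓛.V) : Prop :=
  X ∈ 𝓛.tangentZ x ∧ 𝓛.indep X.1 ≠ 0 ∧ ∀ Y ∈ 𝓛.tangentZ x, 𝓛.Psi G x X Y = 0

variable {G 𝓛} in
/-- The velocity, left-trivialized, of a tangent vector `u` of an immersed submanifold of
`G × 𝔸 × 𝔤*`. -/
def trivialized (N : ImmersedSubmanifold.{w} (𝓘(ℝ, E).prod 𝓘(ℝ, 𝓛.V)) (G × 𝓛.V)) (n : N.carrier)
    (u : TangentSpace (𝓡 N.dim) n) : E × 𝓛.V :=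
  (maurerCartan (N.incl n).1 (mfderiv (𝓡 N.dim) 𝓘(ℝ, E) (fun m => (N.incl m).1) n u : E),
    (mfderiv (𝓡 N.dim) 𝓘(ℝ, 𝓛.V) (fun m => (N.incl m).2) n u : 𝓛.V))

/-- An immersed submanifold `𝓕` of `𝔸 × 𝔤*`. -/
abbrev Submfd : Type (max v (w + 1)) := ImmersedSubmanifold.{w} 𝓘(ℝ, 𝓛.V) 𝓛.V

variable {𝓛}
variable (F : Submfd.{v, w} 𝓛)

/-- The tangent space `T_p 𝓕`, as a subspace of `𝔞 × 𝔤*`. -/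
def tangentF (p : F.carrier) : Submodule ℝ 𝓛.V :=
  LinearMap.range (mfderiv (𝓡 F.dim) 𝓘(ℝ, 𝓛.V) F.incl p :
    EuclideanSpace ℝ (Fin F.dim) →L[ℝ] 𝓛.V).toLinearMap

/-- The tangent space of `Y = G × 𝓕` at `(g, p)`, left-trivialized: `𝔤 × T_p 𝓕`. -/
def tangentY (p : F.carrier) : Submodule ℝ (E × 𝓛.V) := Submodule.prod ⊤ (tangentF F p)

/-- `Y = G × 𝓕` is the momentum space, i.e. the reduced space of the Cartan system `(𝒞(Ψ), ω)` on
`Z̃`: the non-empty submanifold of `Z̃` which has a tangent integral element at each of its points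
and which contains every submanifold of `Z̃` with this property.  (`𝓕` is the phase space.) -/
structure IsPhaseSpace : Prop where
  nonempty : Nonempty F.carrier
  subset : ∀ p, F.incl p ∈ 𝓛.Ztilde
  integral : ∀ p, ∃ X ∈ tangentY F p, 𝓛.IsIntegralVector G (F.incl p) X
  maximal : ∀ N : ImmersedSubmanifold.{w} (𝓘(ℝ, E).prod 𝓘(ℝ, 𝓛.V)) (G × 𝓛.V),
    (∀ n, (N.incl n).2 ∈ 𝓛.Ztilde) →
    (∀ n, ∃ u, 𝓛.IsIntegralVector G (N.incl n).2 (trivialized N n u)) →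
    ∀ n, (N.incl n).2 ∈ Set.range F.incl

/-- The kernel of `Ψ_Y`, the restriction of `Ψ` to `Y`. -/
def kerPsiY (p : F.carrier) : Submodule ℝ (E × 𝓛.V) where
  carrier := {X | X ∈ tangentY F p ∧ ∀ Y ∈ tangentY F p, 𝓛.Psi G (F.incl p) X Y = 0}
  zero_mem' := ⟨Submodule.zero_mem _, fun Y _ => by simp [Psi_apply]⟩
  add_mem' := fun {X X'} h h' => ⟨Submodule.add_mem _ h.1 h'.1, fun Y hY => by
    have h1 := h.2 Y hY
    have h2 := h'.2 Y hY
    simp only [Psi_apply] at h1 h2 ⊢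
    simp only [Prod.snd_add, Prod.fst_add, map_add, LinearMap.add_apply,
      add_apply]
    linarith⟩
  smul_mem' := fun c X h => ⟨Submodule.smul_mem _ c h.1, fun Y hY => by
    have h1 := h.2 Y hY
    simp only [Psi_apply] at h1 ⊢
    simp only [Prod.smul_snd, Prod.smul_fst, map_smul, LinearMap.smul_apply,
      smul_apply, smul_eq_mul]
    linear_combination c * h1⟩

/-- `Y` is odd-dimensional, `Ψ_Y` has maximal rank (its kernel is a line), and `ω` does not vanish
on the kernel; for `dim Y = 2m + 1` this says exactly that `ω ∧ (Ψ_Y)^m` vanishes nowhere. -/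
def Nondegenerate : Prop :=
  Odd (Module.finrank ℝ E + F.dim) ∧ ∀ p, Module.finrank ℝ (kerPsiY G F p) = 1 ∧
    ∀ X ∈ kerPsiY G F p, 𝓛.indep X.1 = 0 → X = 0

/-- `i_X Ψ_Y = 0` and `ω(X) = 1`. -/
def IsCharacteristicVector (p : F.carrier) (X : E × 𝓛.V) : Prop :=
  X ∈ kerPsiY G F p ∧ 𝓛.indep X.1 = 1

/-- The characteristic vector field `ξ` of `Y`, left-trivialized: the value at `(g, p)`, which does
not depend on `g`, is the unique `X` with `i_X Ψ_Y = 0` and `ω(X) = 1`. -/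
def xi (p : F.carrier) : E × 𝓛.V := Classical.epsilon (IsCharacteristicVector G F p)

/-- The phase vector field `Φ_ξ` on `𝓕`: the `𝓕`-component of `ξ`. -/
def phaseField (p : F.carrier) : 𝓛.V := (xi G F p).2

/-- The regular part of the phase space: `Φ_ξ(p) ≠ 0`. -/
def IsRegularPoint (p : F.carrier) : Prop := phaseField G F p ≠ 0

variable {F} in
/-- The Legendre transform `𝓕 → 𝔤*`, `(Q, η) ↦ η`. -/
def legendre (p : F.carrier) : Dual E := (F.incl p).2

variable {F} in
/-- The Hamiltonian `𝓗 : 𝓕 → 𝔸 ⊆ 𝔤`, `(Q, η) ↦ Q`. -/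
def ham (p : F.carrier) : E := Q (F.incl p)

/-- The Lagrangian is coisotropic, with momentum space `Y = G × 𝓕`: it is non-degenerate, its
Legendre transform is one-to-one, and the action of `G` on the regular part of `Y` is coisotropic
with respect to `Ψ_Y`, i.e. the polar space of the tangent space of the orbit is contained in the
sum of the tangent space of the orbit and of the kernel of `Ψ_Y`. -/
structure IsCoisotropic : Prop where
  phaseSpace : IsPhaseSpace G F
  nondegenerate : Nondegenerate G F
  legendre_injective : Function.Injective (legendre (F := F))
  coisotropic : ∀ (g : G) (p : F.carrier), IsRegularPoint G F p → ∀ X ∈ tangentY F p,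
    (∀ A : E, 𝓛.Psi G (F.incl p) X (fundamental g A, 0) = 0) →
    ∃ A : E, ∃ K ∈ kerPsiY G F p, X = (fundamental g A, 0) + K

/-! ### Moment map, phase portraits, and the reduced Marsden-Weinstein fibration -/

variable {F G}

/-- The moment map `J(g, p) = Ad*(g) η`. -/
def moment (g : G) (p : F.carrier) : Dual E := coAd g (legendre p)

variable (G F)

/-- The (regular part of the) phase portrait `𝓟(μ)`, the intersection of the regular part of `𝓕` with
the orbit `𝓞(μ)`, with its topology as an intersection of immersed submanifolds, i.e. as the fibre
product of `𝓕` and `𝓞(μ)` over `𝔤*`. -/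
def PhasePortrait (μ : Dual E) : Type _ :=
  {x : F.carrier × CoadjointOrbit G μ // IsRegularPoint G F x.1 ∧ legendre x.1 = x.2.1}

instance (μ : Dual E) : TopologicalSpace (PhasePortrait G F μ) :=
  inferInstanceAs (TopologicalSpace
    {x : F.carrier × CoadjointOrbit G μ // IsRegularPoint G F x.1 ∧ legendre x.1 = x.2.1})

/-- The tangent space `Π(p) = T_p 𝓕 ∩ O(η)` at `p` of the phase portrait, as a subspace of `T_p 𝓕`
(the linearized phase portrait). -/
def tangentPortrait (p : F.carrier) : Submodule ℝ 𝓛.V :=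
  tangentF F p ⊓
    (LinearMap.range (adStar G (legendre p))).comap (LinearMap.snd ℝ 𝓛.𝔞 (Dual E))

/-- `f` is a linear functional on `Π(p)` with `f(Φ_ξ(p)) = 1`. -/
def IsTimeForm (p : F.carrier) (f : tangentPortrait G F p →ₗ[ℝ] ℝ) : Prop :=
  ∃ h : phaseField G F p ∈ tangentPortrait G F p, f ⟨phaseField G F p, h⟩ = 1

open Classical in
/-- The one-form `σ^μ` on the phase portraits, with `σ^μ(Φ_ξ) = 1`, at `p`.  It is a functional on
`Π(p)`, extended by zero to all vectors that are not tangent to the phase portrait. -/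
def sigma (p : F.carrier) (w : 𝓛.V) : ℝ :=
  if h : w ∈ tangentPortrait G F p then Classical.epsilon (IsTimeForm G F p) ⟨w, h⟩ else 0

variable {G F}

/-- The canonical connection `θ^μ = Ad(g) (Θ - 𝓗 σ^μ)` at `(g, p)`, evaluated on a left-trivialized
tangent vector. -/
def theta (g : G) (p : F.carrier) (X : E × 𝓛.V) : E :=
  Ad g (X.1 - sigma G F p X.2 • ham p)

namespace PhasePortrait

/-- The underlying point of the phase space. -/
def pt {μ : Dual E} (x : PhasePortrait G F μ) : F.carrier := x.1.1

end PhasePortrait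

/-- `(g, p)` belongs to the total space `P^μ` of the reduced Marsden-Weinstein fibration over the
connected component of `x₀` in the phase portrait `𝓟(μ)`. -/
def InFibration {μ : Dual E} (x₀ : PhasePortrait G F μ) (g : G) (p : F.carrier) : Prop :=
  moment g p = μ ∧ ∃ x ∈ connectedComponent x₀, x.pt = p

/-! ### Curves -/

/-- `s` is a non-empty open interval of `ℝ`, possibly unbounded. -/
def IsOpenInterval (s : Set ℝ) : Prop := IsOpen s ∧ s.OrdConnected ∧ s.Nonempty

/-- The velocity of a curve in `𝓕`, as a vector of `𝔞 × 𝔤*`. -/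
def velF (p : ℝ → F.carrier) (t : ℝ) : 𝓛.V := deriv (fun r => F.incl (p r)) t

/-- The velocity of a curve `(h, p)` in `Y = G × 𝓕`, left-trivialized. -/
def vel (h : ℝ → G) (p : ℝ → F.carrier) (t : ℝ) : E × 𝓛.V := (velG h t, velF p t)

/-- `(h, p)` is a smooth curve in `Y = G × 𝓕`, defined on `s`. -/
def IsSmoothCurve (s : Set ℝ) (h : ℝ → G) (p : ℝ → F.carrier) : Prop :=
  ContMDiffOn 𝓘(ℝ, ℝ) 𝓘(ℝ, E) ∞ h s ∧ ContMDiffOn 𝓘(ℝ, ℝ) (𝓡 F.dim) ∞ p s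

/-- `(h, p)` is an integral curve of `ξ`, lying in the regular part of `Y`. -/
def IsCharacteristicCurve (s : Set ℝ) (h : ℝ → G) (p : ℝ → F.carrier) : Prop :=
  IsSmoothCurve s h p ∧ ∀ t ∈ s, IsRegularPoint G F (p t) ∧ vel h p t = xi G F (p t)

/-- `(h, p)` is a smooth curve in `P^μ`. -/
def IsFibrationCurve {μ : Dual E} (x₀ : PhasePortrait G F μ) (s : Set ℝ) (h : ℝ → G)
    (p : ℝ → F.carrier) : Prop :=
  IsSmoothCurve s h p ∧ ∀ t ∈ s, InFibration x₀ (h t) (p t)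

/-- `(h, p)` is a horizontal curve of the canonical connection on `P^μ`. -/
def IsHorizontalCurve {μ : Dual E} (x₀ : PhasePortrait G F μ) (s : Set ℝ) (h : ℝ → G)
    (p : ℝ → F.carrier) : Prop :=
  IsFibrationCurve x₀ s h p ∧ ∀ t ∈ s, theta (h t) (p t) (vel h p t) = 0

/-- `p` is a smooth curve in the reduced phase portrait, the connected component of `x₀`: it is
smooth in `𝓕` and continuous for the topology of the phase portrait. -/
def IsPortraitCurve {μ : Dual E} (x₀ : PhasePortrait G F μ) (s : Set ℝ) (p : ℝ → F.carrier) : Prop :=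
  ContMDiffOn 𝓘(ℝ, ℝ) (𝓡 F.dim) ∞ p s ∧
    ∃ x : s → PhasePortrait G F μ, Continuous x ∧
      ∀ t : s, x t ∈ connectedComponent x₀ ∧ (x t).pt = p t

/-- The function `v^μ` with `p^*(σ^μ) = v^μ dt`. -/
def speed (G : Type u) [TopologicalSpace G] [ChartedSpace E G] [Group G] [LieGroup 𝓘(ℝ, E) ∞ G]
    (p : ℝ → F.carrier) (t : ℝ) : ℝ := sigma G F (p t) (velF p t)

/-- The integrand `g⁻¹ 𝓗 g v^μ + g⁻¹ g'` of the gauge transformation. -/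
def gaugeIntegrand (g : ℝ → G) (p : ℝ → F.carrier) (r : ℝ) : E :=
  speed G p r • Ad (g r)⁻¹ (ham (p r)) + velG g r

/-- The gauge transformation
`Exp ∫_{t₀}^t (g⁻¹ 𝓗 g v^μ + g⁻¹ g') dr`. -/
def gaugeTransformation (g : ℝ → G) (p : ℝ → F.carrier) (t₀ t : ℝ) : G :=
  lieExp G (∫ r in t₀..t, gaugeIntegrand g p r)

/-! ### The variational problem -/

variable (𝓛)

/-- `(α, P + b)` is a parametrized integral curve on `s` of the control system on `M = G × 𝔸`:
`α⁻¹ α' = P + b`. -/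
def IsControlCurve (s : Set ℝ) (α : ℝ → G) (b : ℝ → 𝓛.𝔞) : Prop :=
  ContMDiffOn 𝓘(ℝ, ℝ) 𝓘(ℝ, E) ∞ α s ∧ ContDiffOn ℝ ∞ b s ∧ ∀ t ∈ s, velG α t = 𝓛.P + b t

/-- `(α, P + b)` is an extremal: an integral curve of the control system that is a critical point of
the action `∫ L(P + b) dt` under all compactly supported variations through integral curves of the
control system. -/
def IsExtremal (s : Set ℝ) (α : ℝ → G) (b : ℝ → 𝓛.𝔞) : Prop :=
  𝓛.IsControlCurve s α b ∧
  ∀ ε > (0 : ℝ), ∀ (α' : ℝ × ℝ → G) (b' : ℝ × ℝ → 𝓛.𝔞) (c d : ℝ), c ≤ d → Icc c d ⊆ s →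
    ContMDiffOn 𝓘(ℝ, ℝ × ℝ) 𝓘(ℝ, E) ∞ α' (Ioo (-ε) ε ×ˢ s) →
    ContDiffOn ℝ ∞ b' (Ioo (-ε) ε ×ˢ s) →
    (∀ r ∈ Ioo (-ε) ε, 𝓛.IsControlCurve s (fun t => α' (r, t)) (fun t => b' (r, t))) →
    (∀ t ∈ s, α' (0, t) = α t ∧ b' (0, t) = b t) →
    (∀ r ∈ Ioo (-ε) ε, ∀ t ∈ s \ Icc c d, α' (r, t) = α t ∧ b' (r, t) = b t) →
    HasDerivAt (fun r => ∫ t in c..d, 𝓛.L (b' (r, t))) 0 0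

end InvariantLagrangian

end CoisotropicProblem

end

open CoisotropicProblem CoisotropicProblem.InvariantLagrangian

set_option linter.unusedSectionVars false

/-! Everything is computed in the left trivialization. The given integral elements tangent to `Y`
must be multiples of `ξ`, so `Ψ(ξ, ·) = 0` holds on all of `Z̃` and not only on `Y`. Testing this
identity against well-chosen tangent vectors of `Z̃` gives `ξ = (𝓗, Φ)` (`xi_eq`), `η = dL` on `𝔞`
(`legendre_apply`), and the Euler–Poincaré equation `Φ.2 = -ad*(𝓗) η` (`phaseField_snd`). The last
equation is the infinitesimal form of the conservation of `J`.

Coisotropy makes the portraits one-dimensional. If `w` is tangent to `𝓕` with `w.2 = ad*(A) η`, then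
`(-A, w)` is `Ψ`-polar to the orbit directions, hence equals an orbit direction plus a multiple of
`ξ`, and its second component shows that `w` is a multiple of `Φ` (`exists_eq_smul_phaseField`). The
pairing `(w, A) ↦ w.2 A` of `T_p 𝓕` with `𝔤_η` has this line as left kernel, and trivial right
kernel by non-degeneracy, so `dim 𝓕 = dim 𝔤_η + 1` at every regular point
(`finrank_isotropyAlgebra`). Thus `dim 𝔤_η` is constant along `𝓕` near a regular point. A
deformation argument in the spirit of Duflo and Vergne then shows that tangent vectors of `𝓕`
annihilate `[𝔤_η, 𝔤_η]` (`apply_bracket_eq_zero_of_finrank_eq`). The derived algebra lies in the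
right kernel of the pairing, so `𝔤_η` is Abelian, and so is its conjugate `𝔤_μ`.

On the group level, products of one-parameter subgroups give a smooth map `ψ : 𝔤_μ → G_μ`, which is
a homomorphism because `𝔤_μ` is Abelian. A slice transverse to `𝔤_μ` shows that its image is a
neighbourhood of `1` in `G_μ`, so it contains the identity component. The same `ψ` is `Exp` on
`𝔤_μ`, which is why a linear equation on the group is solved by the exponential of an integral
(`velG_lieExp_integral`).

For the base, the flow of `Φ` stays in a coadjoint orbit, and the inverse function theorem shows
that it fills the portrait near each point (`exists_portraitFlow`). A portrait curve therefore has
velocity `σ(η') Φ`. Horizontality means `h⁻¹h' = σ(η') 𝓗`, so a horizontal curve has velocity `σ(η')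
ξ`. Curves in `G` with the same `h⁻¹h'` differ by a constant left factor (`eq_of_velG_eq`), which
gives uniqueness of horizontal lifts up to `G_μ`.

For extremality, let `W` be the left-trivialized variation field. The Maurer–Cartan equation
(`fderiv_logD_sub`), the Euler–Poincaré equation and `η = dL` on `𝔞` make the variation of `L` equal
to `d/dt ⟨η; W⟩`, and `W` vanishes at the endpoints. -/

namespace CoisotropicProblem

open Filter

/-! ### Lie groups in the preferred chart at the identity -/

section LieGroupCalculus

variable {E : Type v} [NormedAddCommGroup E] [NormedSpace ℝ E]
variable {G : Type u} [TopologicalSpace G] [ChartedSpace E G] [Group G] [LieGroup 𝓘(ℝ, E) ∞ G]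
variable {W : Type*} [NormedAddCommGroup W] [NormedSpace ℝ W]

variable (E G) in
/-- The preferred chart at the identity. -/
noncomputable def oneChart : OpenPartialHomeomorph G E := chartAt E (1 : G)

variable (E G) in
/-- The multiplication in the preferred chart at the identity. -/
noncomputable def mulChart (z : E × E) : E :=
  oneChart E G ((oneChart E G).symm z.1 * (oneChart E G).symm z.2)

variable (E G) in
/-- The derivative at the identity of left translations, in the preferred chart. -/
noncomputable def leftTrans (x : E) : E →L[ℝ] E :=
  (fderiv ℝ (mulChart E G) (x, oneChart E G 1)).comp (ContinuousLinearMap.inr ℝ E E)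

/-- The left logarithmic derivative `α⁻¹ dα` of a map into a Lie group. -/
noncomputable def logD (α : W → G) (w : W) : W →L[ℝ] E :=
  mfderiv 𝓘(ℝ, W) 𝓘(ℝ, E) (fun w' => (α w)⁻¹ * α w') w

theorem one_mem_oneChart : (1 : G) ∈ (oneChart E G).source := mem_chart_source E (1 : G)

theorem oneChart_one_mem : oneChart E G 1 ∈ (oneChart E G).target := mem_chart_target E (1 : G)

@[simp] theorem oneChart_symm_one : (oneChart E G).symm (oneChart E G 1) = 1 :=
  (oneChart E G).left_inv one_mem_oneChart

theorem contMDiffAt_oneChart {g : G} (hg : g ∈ (oneChart E G).source) :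
    ContMDiffAt 𝓘(ℝ, E) 𝓘(ℝ, E) ∞ (oneChart E G) g :=
  (contMDiffOn_chart (I := 𝓘(ℝ, E)) (x := (1 : G))).contMDiffAt
    ((oneChart E G).open_source.mem_nhds hg)

theorem contMDiffAt_oneChart_symm {x : E} (hx : x ∈ (oneChart E G).target) :
    ContMDiffAt 𝓘(ℝ, E) 𝓘(ℝ, E) ∞ (oneChart E G).symm x :=
  (contMDiffOn_chart_symm (I := 𝓘(ℝ, E)) (x := (1 : G))).contMDiffAt
    ((oneChart E G).open_target.mem_nhds hx)

/-- The chart at the target point `1` is fixed. This is why derivatives of group-valued maps are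
taken after translating the value back to the identity: the preferred chart at `α w` need not depend
continuously on `w`. -/
theorem hasMFDerivAt_iff_of_eq_one {f : W → G} {w : W} (hf : f w = 1) {f' : W →L[ℝ] E} :
    HasMFDerivAt 𝓘(ℝ, W) 𝓘(ℝ, E) f w f' ↔
      ContinuousAt f w ∧ HasFDerivAt (fun w' => oneChart E G (f w')) f' w := by
  unfold HasMFDerivAt
  simp only [writtenInExtChartAt, hf, mfld_simps]
  exact and_congr_right fun _ => hasFDerivWithinAt_univ

theorem contDiffAt_mulChart {x y : E} (hx : x ∈ (oneChart E G).target)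
    (hy : y ∈ (oneChart E G).target)
    (hxy : (oneChart E G).symm x * (oneChart E G).symm y ∈ (oneChart E G).source) :
    ContDiffAt ℝ ∞ (mulChart E G) (x, y) := by
  rw [← contMDiffAt_iff_contDiffAt]
  have h1 : ContMDiffAt 𝓘(ℝ, E × E) 𝓘(ℝ, E) ∞ (fun z : E × E => (oneChart E G).symm z.1) (x, y) :=
    ContMDiffAt.comp (x, y) (g := (oneChart E G).symm) (contMDiffAt_oneChart_symm hx)
      contDiff_fst.contMDiff.contMDiffAt
  have h2 : ContMDiffAt 𝓘(ℝ, E × E) 𝓘(ℝ, E) ∞ (fun z : E × E => (oneChart E G).symm z.2) (x, y) :=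
    ContMDiffAt.comp (x, y) (g := (oneChart E G).symm) (contMDiffAt_oneChart_symm hy)
      contDiff_snd.contMDiff.contMDiffAt
  exact ContMDiffAt.comp (x, y) (g := oneChart E G) (contMDiffAt_oneChart hxy) (h1.mul h2)

theorem contDiffAt_mulChart_right {x : E} (hx : x ∈ (oneChart E G).target) :
    ContDiffAt ℝ ∞ (mulChart E G) (x, oneChart E G 1) :=
  contDiffAt_mulChart hx oneChart_one_mem (by simpa using (oneChart E G).map_target hx)

theorem contDiffAt_leftTrans {x : E} (hx : x ∈ (oneChart E G).target) :
    ContDiffAt ℝ ∞ (leftTrans E G) x := by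
  have h1 : ContDiffAt ℝ ∞ (fun y : E => fderiv ℝ (mulChart E G) (y, oneChart E G 1)) x :=
    ContDiffAt.comp x (g := fderiv ℝ (mulChart E G)) (f := fun y : E => (y, oneChart E G 1))
      ((contDiffAt_mulChart_right hx).fderiv_right (m := ∞) (by simp))
      (contDiff_id.prodMk contDiff_const).contDiffAt
  exact h1.clm_comp contDiffAt_const

theorem hasMFDerivAt_oneChart : HasMFDerivAt 𝓘(ℝ, E) 𝓘(ℝ, E) (oneChart E G) (1 : G)
    (ContinuousLinearMap.id ℝ E) := by
  have h := (mdifferentiableAt_extChartAt (I := 𝓘(ℝ, E)) (mem_chart_source E (1 : G))).hasMFDerivAt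
  rw [mfderiv_extChartAt_self] at h
  exact h

theorem hasMFDerivAt_leftTrans {g : G} (hg : g ∈ (oneChart E G).source) :
    HasMFDerivAt 𝓘(ℝ, E) 𝓘(ℝ, E) (fun y => oneChart E G (g * y)) (1 : G)
      (leftTrans E G (oneChart E G g)) := by
  have h1 : HasFDerivAt (fun y => mulChart E G (oneChart E G g, y))
      (leftTrans E G (oneChart E G g)) (oneChart E G 1) :=
    HasFDerivAt.comp (oneChart E G 1) (g := mulChart E G) (f := fun y => (oneChart E G g, y))
      ((contDiffAt_mulChart_right ((oneChart E G).map_source hg)).differentiableAt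
        (by simp)).hasFDerivAt (hasFDerivAt_prodMk_right _ _)
  have h2 := HasMFDerivAt.comp (1 : G) h1.hasMFDerivAt hasMFDerivAt_oneChart
  refine HasMFDerivAt.congr_of_eventuallyEq (f' := leftTrans E G (oneChart E G g)) h2 ?_
  filter_upwards [(oneChart E G).open_source.mem_nhds one_mem_oneChart] with y hy
  simp [mulChart, (oneChart E G).left_inv hg, (oneChart E G).left_inv hy]

theorem hasMFDerivAt_logD {α : W → G} {w : W} (hα : MDifferentiableAt 𝓘(ℝ, W) 𝓘(ℝ, E) α w) :
    HasMFDerivAt 𝓘(ℝ, W) 𝓘(ℝ, E) (fun w' => (α w)⁻¹ * α w') w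
      (logD α w : W →L[ℝ] E) := by
  have h : MDifferentiableAt 𝓘(ℝ, E) 𝓘(ℝ, E) (fun x : G => (α w)⁻¹ * x) (α w) :=
    (contMDiff_mul_left (I := 𝓘(ℝ, E)) (n := ∞)).mdifferentiableAt (by simp)
  exact (MDifferentiableAt.comp w h hα).hasMFDerivAt

/-- Chain rule for `α w' = α w * ((α w)⁻¹ * α w')`: left translation, read in the chart, converts
the logarithmic derivative into the coordinate derivative. -/
theorem hasFDerivAt_oneChart_comp {α : W → G} {w : W}
    (hα : MDifferentiableAt 𝓘(ℝ, W) 𝓘(ℝ, E) α w) (hw : α w ∈ (oneChart E G).source) :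
    HasFDerivAt (fun w' => oneChart E G (α w'))
      ((leftTrans E G (oneChart E G (α w))).comp (logD α w : W →L[ℝ] E)) w := by
  have h1 := hasMFDerivAt_leftTrans hw
  have h2 := hasMFDerivAt_logD hα
  have h1' : HasMFDerivAt 𝓘(ℝ, E) 𝓘(ℝ, E) (fun y => oneChart E G (α w * y)) ((α w)⁻¹ * α w)
      (leftTrans E G (oneChart E G (α w))) := by rwa [inv_mul_cancel]
  have h3 := HasMFDerivAt.comp w h1' h2
  have h4 : (fun w' => oneChart E G (α w')) =
      (fun y => oneChart E G (α w * y)) ∘ fun w' => (α w)⁻¹ * α w' := by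
    ext w'; simp
  exact (HasMFDerivAt.congr_of_eventuallyEq
    (f' := (leftTrans E G (oneChart E G (α w))).comp (logD α w : W →L[ℝ] E)) h3
    (Filter.Eventually.of_forall fun w' => congrFun h4 w')).hasFDerivAt

theorem velG_eq_logD {h : ℝ → G} {t : ℝ} (hh : MDifferentiableAt 𝓘(ℝ, ℝ) 𝓘(ℝ, E) h t) :
    (velG h t : E) = logD h t 1 := by
  have h1 : MDifferentiableAt 𝓘(ℝ, E) 𝓘(ℝ, E) (fun x : G => (h t)⁻¹ * x) (h t) :=
    (contMDiff_mul_left (I := 𝓘(ℝ, E)) (n := ∞)).mdifferentiableAt (by simp)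
  have := (HasMFDerivAt.comp t h1.hasMFDerivAt hh.hasMFDerivAt).mfderiv
  exact (congrArg (fun f : ℝ →L[ℝ] E => f 1) this).symm

theorem leftTrans_one : leftTrans E G (oneChart E G 1) = ContinuousLinearMap.id ℝ E := by
  have h := hasMFDerivAt_leftTrans (E := E) (G := G) one_mem_oneChart
  exact hasMFDerivAt_unique (HasMFDerivAt.congr_of_eventuallyEq
    (f' := leftTrans E G (oneChart E G 1)) h
    (Filter.Eventually.of_forall fun y => by simp)) hasMFDerivAt_oneChart

theorem logD_const_mul (g : G) (α : W → G) (w : W) :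
    (logD (fun w' => g * α w') w : W →L[ℝ] E) = logD α w := by
  have h : (fun w' => (g * α w)⁻¹ * (g * α w')) = fun w' => (α w)⁻¹ * α w' := by
    ext w'; group
  let D : (W → G) → W →L[ℝ] E := fun f => mfderiv 𝓘(ℝ, W) 𝓘(ℝ, E) f w
  exact congrArg D h

theorem mdifferentiableAt_const_mul (g : G) {α : W → G} {w : W}
    (hα : MDifferentiableAt 𝓘(ℝ, W) 𝓘(ℝ, E) α w) :
    MDifferentiableAt 𝓘(ℝ, W) 𝓘(ℝ, E) (fun w' => g * α w') w :=
  MDifferentiableAt.comp w (g := fun x : G => g * x)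
    ((contMDiff_mul_left (I := 𝓘(ℝ, E)) (n := ∞)).mdifferentiableAt (by simp)) hα

variable [FiniteDimensional ℝ E]

/-- The chain rule applied to the inverse chart exhibits a right inverse of `leftTrans`; in finite
dimension it is two-sided. -/
theorem leftTrans_isInvertible {x : E} (hx : x ∈ (oneChart E G).target) :
    (leftTrans E G x).IsInvertible := by
  have hs := (oneChart E G).map_target hx
  have h1 := hasFDerivAt_oneChart_comp (E := E) (α := (oneChart E G).symm) (w := x)
    ((contMDiffAt_oneChart_symm hx).mdifferentiableAt (by simp)) hs
  rw [(oneChart E G).right_inv hx] at h1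
  have h2 : HasFDerivAt (fun w' => oneChart E G ((oneChart E G).symm w'))
      (ContinuousLinearMap.id ℝ E) x :=
    (hasFDerivAt_id x).congr_of_eventuallyEq <| by
      filter_upwards [(oneChart E G).open_target.mem_nhds hx] with y hy
      exact (oneChart E G).right_inv hy
  have h3 := h1.unique h2
  set Θ : E →L[ℝ] E := logD (oneChart E G).symm x
  have h4 : Θ.comp (leftTrans E G x) = ContinuousLinearMap.id ℝ E := by
    have : (Θ : E →ₗ[ℝ] E) ∘ₗ (leftTrans E G x : E →ₗ[ℝ] E) = LinearMap.id :=
      (LinearMap.comp_eq_id_comm (f := (leftTrans E G x : E →ₗ[ℝ] E)) (g := (Θ : E →ₗ[ℝ] E))).1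
        (by ext y; exact congrArg (fun f : E →L[ℝ] E => f y) h3)
    ext y
    exact congrArg (fun f : E →ₗ[ℝ] E => f y) this
  exact ⟨ContinuousLinearEquiv.equivOfInverse (leftTrans E G x) Θ
    (fun y => congrArg (fun f : E →L[ℝ] E => f y) h4)
    (fun y => congrArg (fun f : E →L[ℝ] E => f y) h3), rfl⟩

theorem logD_eq_inverse {α : W → G} {w : W}
    (hα : MDifferentiableAt 𝓘(ℝ, W) 𝓘(ℝ, E) α w) (hw : α w ∈ (oneChart E G).source) :
    logD α w = ((leftTrans E G (oneChart E G (α w))).inverse).comp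
      (fderiv ℝ (fun w' => oneChart E G (α w')) w) := by
  rw [(hasFDerivAt_oneChart_comp hα hw).fderiv, ← ContinuousLinearMap.comp_assoc,
    (leftTrans_isInvertible ((oneChart E G).map_source hw)).inverse_comp_self,
    ContinuousLinearMap.id_comp]

theorem contDiffAt_leftTrans_inverse {x : E} (hx : x ∈ (oneChart E G).target) :
    ContDiffAt ℝ ∞ (fun y => (leftTrans E G y).inverse) x := by
  have : CompleteSpace E := FiniteDimensional.complete ℝ E
  obtain ⟨f, hf⟩ := leftTrans_isInvertible (G := G) hx
  refine ContDiffAt.comp x (g := ContinuousLinearMap.inverse) (f := leftTrans E G) ?_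
    (contDiffAt_leftTrans hx)
  rw [← hf]
  exact contDiffAt_map_inverse f

/-- Left translation by `(α w)⁻¹` leaves the logarithmic derivative unchanged and brings the values
near `1`, where it is `leftTrans⁻¹` composed with an ordinary derivative. -/
theorem contDiffOn_logD {α : W → G} {U : Set W} (hU : IsOpen U)
    (hα : ContMDiffOn 𝓘(ℝ, W) 𝓘(ℝ, E) ∞ α U) :
    ContDiffOn ℝ ∞ (logD α : W → W →L[ℝ] E) U := by
  intro w hw
  refine ContDiffAt.contDiffWithinAt ?_
  set β : W → G := fun w' => (α w)⁻¹ * α w' with hβ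
  have hβs : ∀ w' ∈ U, ContMDiffAt 𝓘(ℝ, W) 𝓘(ℝ, E) ∞ β w' := fun w' hw' =>
    ((contMDiff_mul_left (I := 𝓘(ℝ, E)) (n := ∞) (a := (α w)⁻¹)).contMDiffAt).comp w'
      (hα.contMDiffAt (hU.mem_nhds hw'))
  have hβ1 : β w = 1 := by simp [hβ]
  have hmem : ∀ᶠ w' in 𝓝 w, w' ∈ U ∧ β w' ∈ (oneChart E G).source :=
    (hU.mem_nhds hw |> fun h => (eventually_mem_set.2 h)).and
      ((hβs w hw).continuousAt ((oneChart E G).open_source.mem_nhds (by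
        rw [hβ1]; exact one_mem_oneChart)))
  have heq : (logD α : W → W →L[ℝ] E) =ᶠ[𝓝 w] fun w' =>
      ((leftTrans E G (oneChart E G (β w'))).inverse).comp
      (fderiv ℝ (fun w'' => oneChart E G (β w'')) w') := by
    filter_upwards [hmem] with w' hw'
    rw [← logD_eq_inverse ((hβs w' hw'.1).mdifferentiableAt (by simp)) hw'.2, hβ, logD_const_mul]
  refine ContDiffAt.congr_of_eventuallyEq ?_ heq
  have h1 : ContDiffAt ℝ ∞ (fun w'' => oneChart E G (β w'')) w := by
    rw [← contMDiffAt_iff_contDiffAt]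
    exact ContMDiffAt.comp w (g := oneChart E G) (contMDiffAt_oneChart (by
      rw [hβ1]; exact one_mem_oneChart)) (hβs w hw)
  refine ContDiffAt.clm_comp ?_ (h1.fderiv_right (m := ∞) (by simp))
  exact ContDiffAt.comp w (g := fun y => (leftTrans E G y).inverse)
    (contDiffAt_leftTrans_inverse (by rw [hβ1]; exact oneChart_one_mem)) h1

/-- In the chart, the left-invariant field of `C` is `x ↦ leftTrans x C`, and `leftTrans` is the
identity at the base point. The formula is the coordinate expression of the bracket of two such
fields. -/
theorem bracket_eq (A B : E) : bracket G A B =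
    fderiv ℝ (leftTrans E G) (oneChart E G 1) A B -
      fderiv ℝ (leftTrans E G) (oneChart E G 1) B A := by
  -- The pullbacks to the chart through which the Lie bracket on the manifold is defined.
  let vf : E → E → E := fun C => VectorField.mpullbackWithin 𝓘(ℝ, E) 𝓘(ℝ, E)
    (extChartAt 𝓘(ℝ, E) (1 : G)).symm
    (mulInvariantVectorField (I := 𝓘(ℝ, E)) (G := G) C) (range 𝓘(ℝ, E))
  have hV : ∀ C : E, vf C =ᶠ[𝓝 (oneChart E G 1)] fun x => (leftTrans E G x C : E) := by
    intro C
    filter_upwards [(oneChart E G).open_target.mem_nhds oneChart_one_mem] with x hx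
    have hs := (oneChart E G).map_target hx
    have hm : HasMFDerivAt 𝓘(ℝ, E) 𝓘(ℝ, E) (fun y : G => (oneChart E G).symm x * y) 1
        (mfderiv 𝓘(ℝ, E) 𝓘(ℝ, E) (fun y : G => (oneChart E G).symm x * y) 1) :=
      ((contMDiff_mul_left (I := 𝓘(ℝ, E)) (n := ∞)).mdifferentiableAt (by simp)).hasMFDerivAt
    have he : MDifferentiableAt 𝓘(ℝ, E) 𝓘(ℝ, E) (oneChart E G) ((oneChart E G).symm x * 1) :=
      (contMDiffAt_oneChart (by simpa using hs)).mdifferentiableAt (by simp)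
    have h1 := hasMFDerivAt_unique (hasMFDerivAt_leftTrans hs)
      (HasMFDerivAt.comp (1 : G) he.hasMFDerivAt hm)
    rw [(oneChart E G).right_inv hx] at h1
    have hxt : x ∈ (extChartAt 𝓘(ℝ, E) (1 : G)).target := by
      rw [extChartAt_target]; exact ⟨hx, mem_range_self x⟩
    have h2 := ContinuousLinearMap.inverse_eq
      (mfderivWithin_extChartAt_symm_comp_mfderiv_extChartAt hxt)
      (mfderiv_extChartAt_comp_mfderivWithin_extChartAt_symm hxt)
    have h3 : (mfderiv 𝓘(ℝ, E) 𝓘(ℝ, E) (oneChart E G) ((oneChart E G).symm x) : E →L[ℝ] E) =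
        mfderiv 𝓘(ℝ, E) 𝓘(ℝ, E) (oneChart E G) ((oneChart E G).symm x * 1) := by
      let D : G → E →L[ℝ] E := fun y => mfderiv 𝓘(ℝ, E) 𝓘(ℝ, E) (oneChart E G) y
      exact congrArg D (mul_one _).symm
    let X : E := mfderiv 𝓘(ℝ, E) 𝓘(ℝ, E) (fun y : G => (oneChart E G).symm x * y) 1 C
    have h4 := congrArg (fun f : E →L[ℝ] E => f X) (h2.trans h3)
    exact h4.trans (congrArg (fun f : E →L[ℝ] E => f C) h1).symm
  have h0 : bracket G A B = VectorField.lieBracket ℝ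
      (fun x => (leftTrans E G x A : E)) (fun x => (leftTrans E G x B : E)) (oneChart E G 1) := by
    have h5 : (mfderiv 𝓘(ℝ, E) 𝓘(ℝ, E) (extChartAt 𝓘(ℝ, E) (1 : G)) 1 : E →L[ℝ] E).inverse =
        ContinuousLinearMap.id ℝ E :=
      (congrArg (fun f : E →L[ℝ] E => f.inverse) mfderiv_extChartAt_self).trans
        ContinuousLinearMap.inverse_id
    have h6 : ((extChartAt 𝓘(ℝ, E) (1 : G)).symm ⁻¹' univ ∩ range 𝓘(ℝ, E) : Set E) = univ := by
      simp
    have h7 := (hV A).lieBracket_vectorField_eq (𝕜 := ℝ) (hV B)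
    rw [← h7, ← VectorField.lieBracketWithin_univ, ← h6]
    exact congrArg (fun f : E →L[ℝ] E => f _) h5
  rw [h0, VectorField.lieBracket]
  have hd : DifferentiableAt ℝ (leftTrans E G) (oneChart E G 1) :=
    (contDiffAt_leftTrans oneChart_one_mem).differentiableAt (by simp)
  have hf : ∀ C : E, HasFDerivAt (fun x => (leftTrans E G x C : E))
      ((ContinuousLinearMap.apply ℝ E C).comp (fderiv ℝ (leftTrans E G) (oneChart E G 1)))
      (oneChart E G 1) := fun C =>
    (ContinuousLinearMap.apply ℝ E C).hasFDerivAt.comp _ hd.hasFDerivAt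
  rw [(hf A).fderiv, (hf B).fderiv, leftTrans_one]
  simp

end LieGroupCalculus

end CoisotropicProblem

/-! ### The adjoint action and the Maurer–Cartan equation. -/

namespace CoisotropicProblem

open Filter

section AdjointCalculus

variable {E : Type v} [NormedAddCommGroup E] [NormedSpace ℝ E]
variable {G : Type u} [TopologicalSpace G] [ChartedSpace E G] [Group G] [LieGroup 𝓘(ℝ, E) ∞ G]
variable {W : Type*} [NormedAddCommGroup W] [NormedSpace ℝ W]

theorem mdifferentiableAt_conj (g x : G) :
    MDifferentiableAt 𝓘(ℝ, E) 𝓘(ℝ, E) (fun x : G => g * x * g⁻¹) x :=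
  ((contMDiff_const.mul contMDiff_id).mul contMDiff_const :
    ContMDiff 𝓘(ℝ, E) 𝓘(ℝ, E) ∞ (fun x : G => g * x * g⁻¹)).mdifferentiableAt (by simp)

theorem hasMFDerivAt_conj {f : W → G} {w : W} {f' : W →L[ℝ] E} (g : G) (hf1 : f w = 1)
    (hf : HasMFDerivAt 𝓘(ℝ, W) 𝓘(ℝ, E) f w f') :
    HasMFDerivAt 𝓘(ℝ, W) 𝓘(ℝ, E) (fun w' => g * f w' * g⁻¹) w ((Ad g : E →L[ℝ] E).comp f') := by
  have h : HasMFDerivAt 𝓘(ℝ, E) 𝓘(ℝ, E) (fun x : G => g * x * g⁻¹) (f w) (Ad g : E →L[ℝ] E) := by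
    rw [hf1]; exact (mdifferentiableAt_conj g 1).hasMFDerivAt
  exact HasMFDerivAt.comp w h hf

theorem logD_eq_of_hasMFDerivAt {f : W → G} {w : W} {f' : W →L[ℝ] E} (hf1 : f w = 1)
    (hf : HasMFDerivAt 𝓘(ℝ, W) 𝓘(ℝ, E) f w f') : logD f w = f' := by
  have h1 := hasMFDerivAt_logD hf.mdifferentiableAt
  refine hasMFDerivAt_unique (HasMFDerivAt.congr_of_eventuallyEq
    (f' := (logD f w : W →L[ℝ] E)) h1 (Eventually.of_forall fun y => by simp [hf1])) hf

/-- The two partial derivatives of the multiplication at `(1, 1)` are read off from `y * 1 = y` and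
`1 * y = y`. -/
theorem hasMFDerivAt_mul_of_eq_one {f g : W → G} {w : W} {f' g' : W →L[ℝ] E}
    (hf1 : f w = 1) (hg1 : g w = 1) (hf : HasMFDerivAt 𝓘(ℝ, W) 𝓘(ℝ, E) f w f')
    (hg : HasMFDerivAt 𝓘(ℝ, W) 𝓘(ℝ, E) g w g') :
    HasMFDerivAt 𝓘(ℝ, W) 𝓘(ℝ, E) (fun w' => f w' * g w') w (f' + g') := by
  have : IsTopologicalGroup G := topologicalGroup_of_lieGroup (E := E) 𝓘(ℝ, E) ∞
  rw [hasMFDerivAt_iff_of_eq_one hf1] at hf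
  rw [hasMFDerivAt_iff_of_eq_one hg1] at hg
  rw [hasMFDerivAt_iff_of_eq_one (by simp [hf1, hg1])]
  refine ⟨hf.1.mul hg.1, ?_⟩
  have hs := (oneChart E G).open_source.mem_nhds one_mem_oneChart
  have hm : HasFDerivAt (mulChart E G)
      (ContinuousLinearMap.fst ℝ E E + ContinuousLinearMap.snd ℝ E E)
      (oneChart E G 1, oneChart E G 1) := by
    have h0 := ((contDiffAt_mulChart_right (E := E) (G := G) oneChart_one_mem).differentiableAt
        (by simp)).hasFDerivAt
    set D := fderiv ℝ (mulChart E G) (oneChart E G 1, oneChart E G 1)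
    have ht := (oneChart E G).open_target.mem_nhds oneChart_one_mem
    have h1 : D.comp (ContinuousLinearMap.inl ℝ E E) = ContinuousLinearMap.id ℝ E := by
      refine (HasFDerivAt.comp (oneChart E G 1) (g := mulChart E G)
        (f := fun y => (y, oneChart E G 1)) h0 (hasFDerivAt_prodMk_left _ _)).unique
        ((hasFDerivAt_id _).congr_of_eventuallyEq ?_)
      filter_upwards [ht] with y hy
      simp [mulChart, (oneChart E G).right_inv hy]
    have h2 : D.comp (ContinuousLinearMap.inr ℝ E E) = ContinuousLinearMap.id ℝ E := by
      refine (HasFDerivAt.comp (oneChart E G 1) (g := mulChart E G)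
        (f := fun y => (oneChart E G 1, y)) h0 (hasFDerivAt_prodMk_right _ _)).unique
        ((hasFDerivAt_id _).congr_of_eventuallyEq ?_)
      filter_upwards [ht] with y hy
      simp [mulChart, (oneChart E G).right_inv hy]
    convert! h0 using 1
    ext y
    · simpa using (congrArg (fun f : E →L[ℝ] E => f y) h1).symm
    · simpa using (congrArg (fun f : E →L[ℝ] E => f y) h2).symm
  have hm' : HasFDerivAt (mulChart E G)
      (ContinuousLinearMap.fst ℝ E E + ContinuousLinearMap.snd ℝ E E)
      (oneChart E G (f w), oneChart E G (g w)) := by rwa [hf1, hg1]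
  have h3 := HasFDerivAt.comp w hm' (hf.2.prodMk hg.2)
  have h4 : (ContinuousLinearMap.fst ℝ E E + ContinuousLinearMap.snd ℝ E E).comp (f'.prod g') =
      f' + g' := by ext; simp
  rw [h4] at h3
  refine h3.congr_of_eventuallyEq ?_
  filter_upwards [hf.1.preimage_mem_nhds (hf1 ▸ hs), hg.1.preimage_mem_nhds (hg1 ▸ hs)]
    with y hy1 hy2
  simp [mulChart, (oneChart E G).left_inv hy1, (oneChart E G).left_inv hy2]

/-- After translation to `1`, the product becomes the conjugate by `(β w)⁻¹` of the translated `α`,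
times the translated `β`. -/
theorem logD_mul {α β : W → G} {w : W} (hα : MDifferentiableAt 𝓘(ℝ, W) 𝓘(ℝ, E) α w)
    (hβ : MDifferentiableAt 𝓘(ℝ, W) 𝓘(ℝ, E) β w) :
    (logD (fun w' => α w' * β w') w : W →L[ℝ] E) =
      (Ad (β w)⁻¹ : E →L[ℝ] E).comp (logD α w) + logD β w := by
  have h1 := hasMFDerivAt_conj (β w)⁻¹ (by simp) (hasMFDerivAt_logD hα)
  have h2 := hasMFDerivAt_mul_of_eq_one (by simp) (by simp) h1 (hasMFDerivAt_logD hβ)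
  have h3 := logD_eq_of_hasMFDerivAt (by simp) h2
  refine ((logD_const_mul (α w * β w)⁻¹ _ w).symm.trans ?_).trans h3
  congr 1
  ext w'
  group

theorem mdifferentiableAt_mul {α β : W → G} {w : W}
    (hα : MDifferentiableAt 𝓘(ℝ, W) 𝓘(ℝ, E) α w)
    (hβ : MDifferentiableAt 𝓘(ℝ, W) 𝓘(ℝ, E) β w) :
    MDifferentiableAt 𝓘(ℝ, W) 𝓘(ℝ, E) (fun w' => α w' * β w') w := by
  have h : MDifferentiableAt (𝓘(ℝ, E).prod 𝓘(ℝ, E)) 𝓘(ℝ, E) (fun z : G × G => z.1 * z.2)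
      (α w, β w) := (contMDiff_mul 𝓘(ℝ, E) ∞).mdifferentiableAt (by simp)
  exact MDifferentiableAt.comp w h (hα.prodMk hβ)

theorem mdifferentiableAt_inv {α : W → G} {w : W}
    (hα : MDifferentiableAt 𝓘(ℝ, W) 𝓘(ℝ, E) α w) :
    MDifferentiableAt 𝓘(ℝ, W) 𝓘(ℝ, E) (fun w' => (α w')⁻¹) w :=
  MDifferentiableAt.comp w (g := fun z : G => z⁻¹)
    ((contMDiff_inv 𝓘(ℝ, E) ∞).mdifferentiableAt (by simp)) hα

theorem logD_const (g : G) (w : W) : (logD (fun _ : W => g) w : W →L[ℝ] E) = 0 := by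
  have h := hasMFDerivAt_const (I := 𝓘(ℝ, W)) (I' := 𝓘(ℝ, E)) (1 : G) w
  have h1 := logD_eq_of_hasMFDerivAt (f := fun _ : W => (1 : G)) (w := w) (f' := (0 : W →L[ℝ] E))
    rfl h
  rw [← h1, ← logD_const_mul g⁻¹]
  simp

variable (E) in
theorem Ad_comp (g h : G) : (Ad (g * h) : E →L[ℝ] E) = (Ad g).comp (Ad h) := by
  have h1 : HasMFDerivAt 𝓘(ℝ, E) 𝓘(ℝ, E) (fun x : G => g * x * g⁻¹) (h * 1 * h⁻¹)
      (Ad g : E →L[ℝ] E) := by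
    rw [show h * 1 * h⁻¹ = 1 by group]
    exact (mdifferentiableAt_conj (E := E) g 1).hasMFDerivAt
  let F : E →L[ℝ] E := (Ad g : E →L[ℝ] E).comp (Ad h : E →L[ℝ] E)
  have h3 : HasMFDerivAt 𝓘(ℝ, E) 𝓘(ℝ, E) (fun x : G => g * h * x * (g * h)⁻¹) 1 F :=
    HasMFDerivAt.congr_of_eventuallyEq (f' := F)
      (HasMFDerivAt.comp (1 : G) h1 (mdifferentiableAt_conj (E := E) h 1).hasMFDerivAt)
      (Eventually.of_forall fun x => by simp [mul_assoc])
  exact (hasMFDerivAt_unique h3 (mdifferentiableAt_conj (E := E) (g * h) 1).hasMFDerivAt).symm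

theorem Ad_mul (g h : G) (A : E) : (Ad (g * h) A : E) = Ad g (Ad h A) := by rw [Ad_comp]; rfl

@[simp] theorem Ad_one (A : E) : (Ad (1 : G) A : E) = A := by
  have h := hasMFDerivAt_unique (HasMFDerivAt.congr_of_eventuallyEq
    (f' := ContinuousLinearMap.id ℝ E) (hasMFDerivAt_id (1 : G))
    (Eventually.of_forall fun x => by simp))
    (mdifferentiableAt_conj (E := E) (1 : G) 1).hasMFDerivAt
  exact congrArg (fun f : E →L[ℝ] E => f A) h.symm

@[simp] theorem Ad_inv_Ad (g : G) (A : E) : (Ad g⁻¹ (Ad g A) : E) = A := by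
  rw [← Ad_mul]; simp

@[simp] theorem Ad_Ad_inv (g : G) (A : E) : (Ad g (Ad g⁻¹ A) : E) = A := by
  rw [← Ad_mul]; simp

theorem Ad_injective (g : G) : Function.Injective (Ad g : E →L[ℝ] E) := fun A B h => by
  simpa using congrArg (Ad g⁻¹ : E →L[ℝ] E) h

theorem coAd_apply (g : G) (η : Dual E) (A : E) : coAd g η A = η (Ad g⁻¹ A) := rfl

theorem coAd_mul (g h : G) (η : Dual E) : coAd (g * h) η = coAd g (coAd h η) := by
  ext A; simp [coAd_apply, Ad_mul]

@[simp] theorem coAd_one (η : Dual E) : coAd (1 : G) η = η := by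
  ext A; simp [coAd_apply]

theorem coAd_eq_iff (g : G) (η μ : Dual E) : coAd g η = μ ↔ η = coAd g⁻¹ μ := by
  constructor
  · rintro rfl; simp [← coAd_mul]
  · rintro rfl; simp [← coAd_mul]

/-- Right translation by `g` followed by left translation by `g⁻¹` is conjugation by `g⁻¹`. -/
theorem fundamental_eq (g : G) (A : E) : fundamental g A = Ad g⁻¹ A := by
  have h1 : MDifferentiableAt 𝓘(ℝ, E) 𝓘(ℝ, E) (fun x : G => g⁻¹ * x) g :=
    (contMDiff_mul_left (I := 𝓘(ℝ, E)) (n := ∞)).mdifferentiableAt (by simp)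
  have h2 : MDifferentiableAt 𝓘(ℝ, E) 𝓘(ℝ, E) (fun x : G => x * g) 1 :=
    (contMDiff_mul_right (I := 𝓘(ℝ, E)) (n := ∞)).mdifferentiableAt (by simp)
  let F : E →L[ℝ] E := mfderiv 𝓘(ℝ, E) 𝓘(ℝ, E) (fun x : G => x * g) 1
  let M : E →L[ℝ] E := maurerCartan g
  have h5 : HasMFDerivAt 𝓘(ℝ, E) 𝓘(ℝ, E) (fun x : G => g⁻¹ * x) (1 * g) M := by
    rw [one_mul]; exact h1.hasMFDerivAt
  have h4 : HasMFDerivAt 𝓘(ℝ, E) 𝓘(ℝ, E) (fun x : G => g⁻¹ * x * g⁻¹⁻¹) 1 (M.comp F) :=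
    HasMFDerivAt.congr_of_eventuallyEq (f' := M.comp F)
      (HasMFDerivAt.comp (1 : G) h5 h2.hasMFDerivAt)
      (Eventually.of_forall fun x => by simp [mul_assoc])
  have h6 := hasMFDerivAt_unique h4 (mdifferentiableAt_conj (E := E) g⁻¹ 1).hasMFDerivAt
  exact congrArg (fun f : E →L[ℝ] E => f A) h6

theorem logD_inv {α : W → G} {w : W} (hα : MDifferentiableAt 𝓘(ℝ, W) 𝓘(ℝ, E) α w) :
    (logD (fun w' => (α w')⁻¹) w : W →L[ℝ] E) = -(Ad (α w) : E →L[ℝ] E).comp (logD α w) := by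
  have h := logD_mul hα (mdifferentiableAt_inv hα)
  simp only [mul_inv_cancel, inv_inv] at h
  rw [logD_const] at h
  exact eq_neg_of_add_eq_zero_right h.symm

variable [FiniteDimensional ℝ E]

/-- The Maurer-Cartan equation for the left logarithmic derivative. -/
theorem fderiv_logD_sub {α : W → G} {U : Set W} (hU : IsOpen U)
    (hα : ContMDiffOn 𝓘(ℝ, W) 𝓘(ℝ, E) ∞ α U) {w : W} (hw : w ∈ U) (u v : W) :
    fderiv ℝ (logD α : W → W →L[ℝ] E) w u v - fderiv ℝ (logD α : W → W →L[ℝ] E) w v u =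
      bracket G (logD α w v) (logD α w u) := by
  set β : W → G := fun w' => (α w)⁻¹ * α w' with hβ
  have hβs : ∀ w' ∈ U, ContMDiffAt 𝓘(ℝ, W) 𝓘(ℝ, E) ∞ β w' := fun w' hw' =>
    ((contMDiff_mul_left (I := 𝓘(ℝ, E)) (n := ∞) (a := (α w)⁻¹)).contMDiffAt).comp w'
      (hα.contMDiffAt (hU.mem_nhds hw'))
  have hβ1 : β w = 1 := by simp [hβ]
  have hmem : ∀ᶠ w' in 𝓝 w, w' ∈ U ∧ β w' ∈ (oneChart E G).source :=
    (eventually_mem_set.2 (hU.mem_nhds hw)).and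
      ((hβs w hw).continuousAt ((oneChart E G).open_source.mem_nhds (by
        rw [hβ1]; exact one_mem_oneChart)))
  set x : W → E := fun w' => oneChart E G (β w') with hx
  have hx1 : x w = oneChart E G 1 := by simp [hx, hβ1]
  have hxs : ContDiffAt ℝ ∞ x w := by
    rw [← contMDiffAt_iff_contDiffAt]
    exact ContMDiffAt.comp w (g := oneChart E G) (contMDiffAt_oneChart (by
      rw [hβ1]; exact one_mem_oneChart)) (hβs w hw)
  have hfx : fderiv ℝ x =ᶠ[𝓝 w] fun w' => (leftTrans E G (x w')).comp (logD α w') := by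
    filter_upwards [hmem] with w' hw'
    rw [(hasFDerivAt_oneChart_comp ((hβs w' hw'.1).mdifferentiableAt (by simp)) hw'.2).fderiv,
      hβ, logD_const_mul]
  set θ : W → W →L[ℝ] E := logD α with hθ
  have hθd : HasFDerivAt θ (fderiv ℝ θ w) w :=
    (((contDiffOn_logD hU hα).contDiffAt (hU.mem_nhds hw)).differentiableAt (by simp)).hasFDerivAt
  have hLd : HasFDerivAt (leftTrans E G) (fderiv ℝ (leftTrans E G) (oneChart E G 1)) (x w) := by
    rw [hx1]
    exact ((contDiffAt_leftTrans oneChart_one_mem).differentiableAt (by simp)).hasFDerivAt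
  have hxd : HasFDerivAt x (θ w) w := by
    have := (hxs.differentiableAt (by simp)).hasFDerivAt
    rw [hfx.self_of_nhds] at this
    simpa only [hx1, leftTrans_one, ContinuousLinearMap.id_comp] using this
  have h2 := HasFDerivAt.clm_comp (c := fun w' => leftTrans E G (x w')) (hLd.comp w hxd) hθd
  -- With `x` the coordinate expression, `dx = leftTrans(x) ∘ θ`. The product rule splits the second
  -- derivative into `dθ` and a derivative of `leftTrans`; its symmetry leaves exactly the
  -- antisymmetrization that is the bracket.
  have hsym := (hxs.isSymmSndFDerivAt (by simpa using (ENat.LEInfty.out : (2 : WithTop ℕ∞) ≤ ∞))).eq u v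
  rw [hfx.fderiv_eq, h2.fderiv] at hsym
  simp [hx1, leftTrans_one] at hsym
  rw [bracket_eq, sub_eq_sub_iff_add_eq_add]
  rw [hsym]; abel

end AdjointCalculus

end CoisotropicProblem

/-! ### Velocities of curves in the group, and the derivative of the adjoint action. -/

namespace CoisotropicProblem

open Filter

section Curves

variable {E : Type v} [NormedAddCommGroup E] [NormedSpace ℝ E]
variable {G : Type u} [TopologicalSpace G] [ChartedSpace E G] [Group G] [LieGroup 𝓘(ℝ, E) ∞ G]
variable {W : Type*} [NormedAddCommGroup W] [NormedSpace ℝ W]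
variable {W' : Type*} [NormedAddCommGroup W'] [NormedSpace ℝ W']

theorem logD_comp {α : W → G} {φ : W' → W} {w : W'} {φ' : W' →L[ℝ] W}
    (hα : MDifferentiableAt 𝓘(ℝ, W) 𝓘(ℝ, E) α (φ w)) (hφ : HasFDerivAt φ φ' w) :
    (logD (fun w' => α (φ w')) w : W' →L[ℝ] E) = (logD α (φ w) : W →L[ℝ] E).comp φ' :=
  (HasMFDerivAt.comp w (hasMFDerivAt_logD hα) hφ.hasMFDerivAt).mfderiv

variable (G) in
/-- The inverse of the preferred chart at the identity, centred at the origin. -/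
noncomputable def chartCurve (v : E) : G := (oneChart E G).symm (oneChart E G 1 + v)

variable (E G) in
/-- The domain of `chartCurve`. -/
def chartDomain : Set E := {v | oneChart E G 1 + v ∈ (oneChart E G).target}

theorem isOpen_chartDomain : IsOpen (chartDomain E G) :=
  (oneChart E G).open_target.preimage (by fun_prop)

theorem zero_mem_chartDomain : (0 : E) ∈ chartDomain E G := by
  simpa [chartDomain] using oneChart_one_mem (E := E) (G := G)

theorem contMDiffOn_chartCurve :
    ContMDiffOn 𝓘(ℝ, E) 𝓘(ℝ, E) ∞ (chartCurve G : E → G) (chartDomain E G) := fun v hv =>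
  (ContMDiffAt.comp v (g := (oneChart E G).symm) (f := fun v => oneChart E G 1 + v)
    (contMDiffAt_oneChart_symm hv)
    (contDiff_const.add contDiff_id).contMDiff.contMDiffAt).contMDiffWithinAt

@[simp] theorem chartCurve_zero : (chartCurve G (0 : E) : G) = 1 := by simp [chartCurve]

theorem hasMFDerivAt_chartCurve : HasMFDerivAt 𝓘(ℝ, E) 𝓘(ℝ, E) (chartCurve G : E → G) 0
    (ContinuousLinearMap.id ℝ E) := by
  rw [hasMFDerivAt_iff_of_eq_one chartCurve_zero]
  have ho := isOpen_chartDomain.mem_nhds (zero_mem_chartDomain (E := E) (G := G))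
  refine ⟨(contMDiffOn_chartCurve.contMDiffAt ho).continuousAt, ?_⟩
  refine ((hasFDerivAt_id (0 : E)).const_add (oneChart E G 1)).congr_of_eventuallyEq ?_
  filter_upwards [ho] with v hv
  exact (oneChart E G).right_inv hv

/-! ### Curves in the group -/

theorem velG_mul {h k : ℝ → G} {t : ℝ} (hh : MDifferentiableAt 𝓘(ℝ, ℝ) 𝓘(ℝ, E) h t)
    (hk : MDifferentiableAt 𝓘(ℝ, ℝ) 𝓘(ℝ, E) k t) :
    (velG (fun r => h r * k r) t : E) = Ad (k t)⁻¹ (velG h t) + velG k t := by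
  rw [velG_eq_logD (mdifferentiableAt_mul hh hk), velG_eq_logD hh, velG_eq_logD hk,
    logD_mul hh hk]
  rfl

theorem velG_inv {h : ℝ → G} {t : ℝ} (hh : MDifferentiableAt 𝓘(ℝ, ℝ) 𝓘(ℝ, E) h t) :
    (velG (fun r => (h r)⁻¹) t : E) = -Ad (h t) (velG h t) := by
  rw [velG_eq_logD (mdifferentiableAt_inv hh), velG_eq_logD hh, logD_inv hh]
  rfl

theorem velG_const_mul (g : G) {h : ℝ → G} {t : ℝ}
    (hh : MDifferentiableAt 𝓘(ℝ, ℝ) 𝓘(ℝ, E) h t) :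
    (velG (fun r => g * h r) t : E) = velG h t := by
  rw [velG_eq_logD (mdifferentiableAt_const_mul g hh), velG_eq_logD hh, logD_const_mul]

theorem velG_const (g : G) (t : ℝ) : (velG (fun _ => g) t : E) = 0 := by
  rw [velG_eq_logD mdifferentiableAt_const, logD_const]; rfl

theorem velG_congr {h k : ℝ → G} {t : ℝ} (hhk : h =ᶠ[𝓝 t] k) :
    (velG h t : E) = velG k t := by
  have h1 : (mfderiv 𝓘(ℝ, ℝ) 𝓘(ℝ, E) h t : ℝ →L[ℝ] E) = mfderiv 𝓘(ℝ, ℝ) 𝓘(ℝ, E) k t :=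
    hhk.mfderiv_eq
  have h2 := congrArg (fun f : ℝ →L[ℝ] E => (maurerCartan (h t) : E →L[ℝ] E) (f 1)) h1
  have h3 := congrArg (fun g : G => (maurerCartan g : E →L[ℝ] E)
    ((mfderiv 𝓘(ℝ, ℝ) 𝓘(ℝ, E) k t : ℝ →L[ℝ] E) 1)) hhk.self_of_nhds
  exact h2.trans h3

theorem velG_comp {h : ℝ → G} {τ : ℝ → ℝ} {t τ' : ℝ}
    (hh : MDifferentiableAt 𝓘(ℝ, ℝ) 𝓘(ℝ, E) h (τ t)) (hτ : HasDerivAt τ τ' t) :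
    (velG (fun r => h (τ r)) t : E) = τ' • velG h (τ t) := by
  have h1 : MDifferentiableAt 𝓘(ℝ, ℝ) 𝓘(ℝ, E) (fun r => h (τ r)) t :=
    MDifferentiableAt.comp t hh hτ.differentiableAt.mdifferentiableAt
  rw [velG_eq_logD h1, velG_eq_logD hh, logD_comp hh hτ.hasFDerivAt]
  simp [← map_smul]

theorem eventually_eq_of_logD_eq_zero {h : W → G} {s : Set W} (hs : IsOpen s)
    (hh : ∀ t ∈ s, MDifferentiableAt 𝓘(ℝ, W) 𝓘(ℝ, E) h t)
    (h0 : ∀ t ∈ s, (logD h t : W →L[ℝ] E) = 0) {t : W} (ht : t ∈ s) :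
    ∀ᶠ r in 𝓝 t, h r = h t := by
  set β : W → G := fun r => (h t)⁻¹ * h r with hβ
  have hβt : β t = 1 := by simp [hβ]
  have hβd : ∀ r ∈ s, MDifferentiableAt 𝓘(ℝ, W) 𝓘(ℝ, E) β r := fun r hr =>
    mdifferentiableAt_const_mul _ (hh r hr)
  have hmem : ∀ᶠ r in 𝓝 t, r ∈ s ∧ β r ∈ (oneChart E G).source :=
    (eventually_mem_set.2 (hs.mem_nhds ht)).and
      ((hβd t ht).continuousAt ((oneChart E G).open_source.mem_nhds (by
        rw [hβt]; exact one_mem_oneChart)))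
  obtain ⟨ε, hε, hb⟩ := Metric.eventually_nhds_iff_ball.1 hmem
  filter_upwards [Metric.ball_mem_nhds t hε] with r hr
  have hd : ∀ y ∈ Metric.ball t ε, HasFDerivWithinAt (fun r => oneChart E G (β r))
      (0 : W →L[ℝ] E) (Metric.ball t ε) y := by
    intro y hy
    have h1 := hasFDerivAt_oneChart_comp (hβd y (hb y hy).1) (hb y hy).2
    rw [hβ, logD_const_mul, h0 y (hb y hy).1, ContinuousLinearMap.comp_zero] at h1
    exact h1.hasFDerivWithinAt
  have h2 := (convex_ball t ε).is_const_of_fderivWithin_eq_zero (𝕜 := ℝ)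
    (fun y hy => (hd y hy).differentiableWithinAt)
    (fun y hy => (hd y hy).fderivWithin (Metric.isOpen_ball.uniqueDiffWithinAt hy)) hr
    (Metric.mem_ball_self hε)
  have h3 := (oneChart E G).injOn (hb r hr).2 (hb t (Metric.mem_ball_self hε)).2 h2
  exact mul_left_cancel h3

/-- The velocity of `h k⁻¹` is `Ad(k)` applied to the difference of the two velocities, so `h k⁻¹`
is locally constant. All uniqueness statements for curves in the group reduce to this one. -/
theorem eq_of_velG_eq {s : Set ℝ} (hs : IsOpen s) (hs' : IsPreconnected s) {h k : ℝ → G}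
    (hh : ∀ t ∈ s, MDifferentiableAt 𝓘(ℝ, ℝ) 𝓘(ℝ, E) h t)
    (hk : ∀ t ∈ s, MDifferentiableAt 𝓘(ℝ, ℝ) 𝓘(ℝ, E) k t)
    (hhk : ∀ t ∈ s, (velG h t : E) = velG k t) {t₀ t : ℝ} (ht₀ : t₀ ∈ s) (ht : t ∈ s) :
    h t * (k t)⁻¹ = h t₀ * (k t₀)⁻¹ := by
  have hd : ∀ t ∈ s, MDifferentiableAt 𝓘(ℝ, ℝ) 𝓘(ℝ, E) (fun r => h r * (k r)⁻¹) t :=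
    fun t ht => mdifferentiableAt_mul (hh t ht) (mdifferentiableAt_inv (hk t ht))
  have h0 : ∀ t ∈ s, (logD (fun r => h r * (k r)⁻¹) t : ℝ →L[ℝ] E) = 0 := by
    intro t ht
    have h1 : (velG (fun r => h r * (k r)⁻¹) t : E) = 0 := by
      rw [velG_mul (hh t ht) (mdifferentiableAt_inv (hk t ht)), velG_inv (hk t ht), hhk t ht]
      simp
    rw [velG_eq_logD (hd t ht)] at h1
    ext
    simpa using h1
  have hl : IsLocallyConstant (fun r : s => h r * (k r)⁻¹) := by
    rw [IsLocallyConstant.iff_eventually_eq]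
    intro r
    have h1 := eventually_eq_of_logD_eq_zero hs hd h0 r.2
    rw [nhds_subtype_eq_comap]
    exact h1.comap _
  have : PreconnectedSpace s := Subtype.preconnectedSpace hs'
  exact hl.apply_eq_of_preconnectedSpace ⟨t, ht⟩ ⟨t₀, ht₀⟩

variable [FiniteDimensional ℝ E]

theorem contDiffOn_velG {s : Set ℝ} (hs : IsOpen s) {h : ℝ → G}
    (hh : ContMDiffOn 𝓘(ℝ, ℝ) 𝓘(ℝ, E) ∞ h s) : ContDiffOn ℝ ∞ (velG h : ℝ → E) s := by
  refine ((contDiffOn_logD hs hh).clm_apply (contDiffOn_const (c := (1 : ℝ)))).congr ?_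
  intro t ht
  exact velG_eq_logD ((hh.contMDiffAt (hs.mem_nhds ht)).mdifferentiableAt (by simp))

/-- `Ad (α w)` is a partial logarithmic derivative, at `v = 0`, of the jointly smooth map `(w, v) ↦
α w * chartCurve v * (α w)⁻¹`. -/
theorem contDiffOn_Ad {α : W → G} {U : Set W} (hU : IsOpen U)
    (hα : ContMDiffOn 𝓘(ℝ, W) 𝓘(ℝ, E) ∞ α U) :
    ContDiffOn ℝ ∞ (fun w => (Ad (α w) : E →L[ℝ] E)) U := by
  set Γ : W × E → G := fun z => α z.1 * chartCurve G z.2 * (α z.1)⁻¹ with hΓ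
  have hV : IsOpen (U ×ˢ chartDomain E G) := hU.prod isOpen_chartDomain
  have h1 : ContMDiffOn 𝓘(ℝ, W × E) 𝓘(ℝ, E) ∞ (fun z : W × E => α z.1) (U ×ˢ chartDomain E G) :=
    hα.comp contDiff_fst.contMDiff.contMDiffOn (fun z hz => hz.1)
  have h2 : ContMDiffOn 𝓘(ℝ, W × E) 𝓘(ℝ, E) ∞ (fun z : W × E => (chartCurve G z.2 : G))
      (U ×ˢ chartDomain E G) :=
    contMDiffOn_chartCurve.comp contDiff_snd.contMDiff.contMDiffOn (fun z hz => hz.2)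
  have hΓs : ContMDiffOn 𝓘(ℝ, W × E) 𝓘(ℝ, E) ∞ Γ (U ×ˢ chartDomain E G) :=
    (h1.mul h2).mul h1.inv
  have h3 := contDiffOn_logD hV hΓs
  have h4 : ContDiffOn ℝ ∞ (fun w => (logD Γ (w, (0 : E)) : W × E →L[ℝ] E)) U :=
    h3.comp (contDiff_id.prodMk contDiff_const).contDiffOn
      (fun w hw => ⟨hw, zero_mem_chartDomain⟩)
  refine (h4.clm_comp (contDiffOn_const (c := ContinuousLinearMap.inr ℝ W E))).congr ?_
  intro w hw
  have h5 := hasMFDerivAt_conj (α w) chartCurve_zero (hasMFDerivAt_chartCurve (E := E) (G := G))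
  have h6 : logD (fun v : E => α w * chartCurve G v * (α w)⁻¹) 0 = (Ad (α w) : E →L[ℝ] E) :=
    (logD_eq_of_hasMFDerivAt (by simp) h5).trans (ContinuousLinearMap.comp_id _)
  rw [← h6]
  have h7 : MDifferentiableAt 𝓘(ℝ, W × E) 𝓘(ℝ, E) Γ (w, (0 : E)) :=
    (hΓs.contMDiffAt (hV.mem_nhds ⟨hw, zero_mem_chartDomain⟩)).mdifferentiableAt (by simp)
  exact logD_comp (φ := fun v : E => (w, v)) h7 (hasFDerivAt_prodMk_right _ _)

/-- This is the Maurer–Cartan equation for the two-parameter map `(t, r) ↦ chartCurve (t A) * k r`: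
its `t`-component at `t = 0` is `Ad(k⁻¹) A`, and its `r`-component is the velocity of `k`. -/
theorem hasDerivAt_Ad_inv_apply {s : Set ℝ} (hs : IsOpen s) {k : ℝ → G}
    (hk : ContMDiffOn 𝓘(ℝ, ℝ) 𝓘(ℝ, E) ∞ k s) {r : ℝ} (hr : r ∈ s) (A : E) :
    HasDerivAt (fun r => (Ad (k r)⁻¹ A : E)) (bracket G (Ad (k r)⁻¹ A) (velG k r)) r := by
  set f : ℝ × ℝ → G := fun z => chartCurve G (z.1 • A) * k z.2 with hf
  set U : Set (ℝ × ℝ) := {t : ℝ | t • A ∈ chartDomain E G} ×ˢ s with hU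
  have hUo : IsOpen U := (isOpen_chartDomain.preimage (by fun_prop)).prod hs
  have h0U : ∀ r ∈ s, ((0 : ℝ), r) ∈ U := fun r hr =>
    ⟨by simpa using zero_mem_chartDomain (E := E) (G := G), hr⟩
  have hf1 : ContMDiffOn 𝓘(ℝ, ℝ × ℝ) 𝓘(ℝ, E) ∞ (fun z : ℝ × ℝ => (chartCurve G (z.1 • A) : G)) U :=
    contMDiffOn_chartCurve.comp
      (contDiff_fst.smul contDiff_const : ContDiff ℝ ∞ fun z : ℝ × ℝ => z.1 • A).contMDiff.contMDiffOn
      (fun z hz => hz.1)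
  have hfs : ContMDiffOn 𝓘(ℝ, ℝ × ℝ) 𝓘(ℝ, E) ∞ f U :=
    hf1.mul (hk.comp contDiff_snd.contMDiff.contMDiffOn (fun z hz => hz.2))
  have hfd : ∀ z ∈ U, MDifferentiableAt 𝓘(ℝ, ℝ × ℝ) 𝓘(ℝ, E) f z := fun z hz =>
    (hfs.contMDiffAt (hUo.mem_nhds hz)).mdifferentiableAt (by simp)
  have hkd : ∀ r ∈ s, MDifferentiableAt 𝓘(ℝ, ℝ) 𝓘(ℝ, E) k r := fun r hr =>
    (hk.contMDiffAt (hs.mem_nhds hr)).mdifferentiableAt (by simp)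
  set θ : ℝ × ℝ → ℝ × ℝ →L[ℝ] E := logD f with hθ
  have hθd : ∀ z ∈ U, HasFDerivAt θ (fderiv ℝ θ z) z := fun z hz =>
    (((contDiffOn_logD hUo hfs).contDiffAt (hUo.mem_nhds hz)).differentiableAt
      (by simp)).hasFDerivAt
  have hθ2 : ∀ z ∈ U, θ z (0, 1) = velG k z.2 := by
    intro z hz
    have h1 := logD_comp (φ := fun r : ℝ => (z.1, r)) (w := z.2) (hfd z hz)
      (hasFDerivAt_prodMk_right _ _)
    have h2 := logD_const_mul (E := E) (chartCurve G (z.1 • A)) k z.2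
    rw [velG_eq_logD (hkd _ hz.2), ← h2]
    exact (congrArg (fun f : ℝ →L[ℝ] E => f 1) h1).symm
  have hθ1 : ∀ r ∈ s, θ (0, r) (1, 0) = Ad (k r)⁻¹ A := by
    intro r hr
    have h1 := logD_comp (φ := fun t : ℝ => (t, r)) (w := 0) (hfd _ (h0U r hr))
      (hasFDerivAt_prodMk_left _ _)
    have h3 : HasMFDerivAt 𝓘(ℝ, ℝ) 𝓘(ℝ, E) (fun t : ℝ => (chartCurve G (t • A) : G)) 0
        ((ContinuousLinearMap.id ℝ E).comp (ContinuousLinearMap.toSpanSingleton ℝ A)) := by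
      have h4 : HasMFDerivAt 𝓘(ℝ, E) 𝓘(ℝ, E) (chartCurve G : E → G) ((0 : ℝ) • A)
          (ContinuousLinearMap.id ℝ E) := by
        rw [zero_smul]; exact hasMFDerivAt_chartCurve
      exact HasMFDerivAt.comp (0 : ℝ) (f := fun t : ℝ => t • A) h4
        (ContinuousLinearMap.toSpanSingleton ℝ A).hasFDerivAt.hasMFDerivAt
    have h2 := logD_mul (E := E) (w := (0 : ℝ)) h3.mdifferentiableAt
      (mdifferentiableAt_const (c := k r))
    rw [logD_const, add_zero, logD_eq_of_hasMFDerivAt (by simp) h3] at h2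
    have h5 := congrArg (fun f : ℝ →L[ℝ] E => f 1) (h1.symm.trans h2)
    refine h5.trans ?_
    change (Ad (k r)⁻¹ : E →L[ℝ] E) ((1 : ℝ) • A) = _
    rw [one_smul]
  have hz := h0U r hr
  have hMC := fderiv_logD_sub hUo hfs hz (0, 1) (1, 0)
  have e1 : HasDerivAt (fun r => θ (0, r) (1, 0)) (fderiv ℝ θ (0, r) (0, 1) (1, 0)) r := by
    have h1 : HasFDerivAt (fun r : ℝ => θ (0, r))
      ((fderiv ℝ θ (0, r)).comp (ContinuousLinearMap.inr ℝ ℝ ℝ)) r :=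
      HasFDerivAt.comp (g := θ) r (hθd _ hz) (hasFDerivAt_prodMk_right _ _)
    have h2 := ((ContinuousLinearMap.apply ℝ E ((1 : ℝ), (0 : ℝ))).hasFDerivAt.comp r
      h1).hasDerivAt
    simpa [Function.comp_def] using h2
  -- The `r`-component does not depend on `t`, because `t` enters only through a left factor.
  have e2 : fderiv ℝ θ (0, r) (1, 0) (0, 1) = 0 := by
    have h1 : HasFDerivAt (fun t : ℝ => θ (t, r))
      ((fderiv ℝ θ (0, r)).comp (ContinuousLinearMap.inl ℝ ℝ ℝ)) 0 :=
      HasFDerivAt.comp (g := θ) (0 : ℝ) (hθd _ hz) (hasFDerivAt_prodMk_left _ _)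
    have h2 := ((ContinuousLinearMap.apply ℝ E ((0 : ℝ), (1 : ℝ))).hasFDerivAt.comp (0 : ℝ)
      h1).hasDerivAt
    have h3 : HasDerivAt (fun t : ℝ => θ (t, r) (0, 1)) 0 0 := by
      refine (hasDerivAt_const (0 : ℝ) (velG k r : E)).congr_of_eventuallyEq ?_
      have h4 : ∀ᶠ t : ℝ in 𝓝 0, (t, r) ∈ U :=
        (hUo.preimage (by fun_prop : Continuous fun t : ℝ => (t, r))).mem_nhds hz
      filter_upwards [h4] with t ht
      exact hθ2 _ ht
    simpa [Function.comp_def] using h2.unique h3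
  rw [← hθ] at hMC
  rw [e2, sub_zero, hθ1 r hr, hθ2 _ hz] at hMC
  rw [hMC] at e1
  refine e1.congr_of_eventuallyEq ?_
  filter_upwards [hs.mem_nhds hr] with r hr
  exact (hθ1 r hr).symm

end Curves

end CoisotropicProblem

/-! ### Differential equations on the group and the exponential map. -/

namespace CoisotropicProblem

open Filter

theorem exists_contDiffOn_integralCurve {V : Type*} [NormedAddCommGroup V] [NormedSpace ℝ V]
    [CompleteSpace V] {f : V → V} {O : Set V} (hO : IsOpen O) (hf : ContDiffOn ℝ ∞ f O) {x₀ : V}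
    (hx₀ : x₀ ∈ O) (t₀ : ℝ) : ∃ ε > (0 : ℝ), ∃ x : ℝ → V, x t₀ = x₀ ∧
      ContDiffOn ℝ ∞ x (Ioo (t₀ - ε) (t₀ + ε)) ∧
      ∀ t ∈ Ioo (t₀ - ε) (t₀ + ε), x t ∈ O ∧ HasDerivAt x (f (x t)) t := by
  have h1 : ContDiffAt ℝ 1 f x₀ := (hf.contDiffAt (hO.mem_nhds hx₀)).of_le (by simp)
  obtain ⟨x, hx0, ε, hε, hx⟩ :=
    h1.exists_forall_mem_closedBall_exists_eq_forall_mem_Ioo_hasDerivAt₀ t₀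
  have hc : ContinuousAt x t₀ := (hx t₀ (by constructor <;> linarith)).continuousAt
  obtain ⟨δ, hδ, hb⟩ := Metric.eventually_nhds_iff_ball.1
    (hc.preimage_mem_nhds (hO.mem_nhds (hx0 ▸ hx₀)))
  refine ⟨min ε δ, lt_min hε hδ, x, hx0, ?_, ?_⟩
  swap
  · intro t ht
    refine ⟨hb t ?_, hx t ⟨by linarith [ht.1, min_le_left ε δ], by linarith [ht.2, min_le_left ε δ]⟩⟩
    rw [Real.ball_eq_Ioo]
    exact ⟨by linarith [ht.1, min_le_right ε δ], by linarith [ht.2, min_le_right ε δ]⟩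
  have hs : ∀ t ∈ Ioo (t₀ - min ε δ) (t₀ + min ε δ), x t ∈ O ∧ HasDerivAt x (f (x t)) t := by
    intro t ht
    refine ⟨hb t ?_, hx t ⟨by linarith [ht.1, min_le_left ε δ], by linarith [ht.2, min_le_left ε δ]⟩⟩
    rw [Real.ball_eq_Ioo]
    exact ⟨by linarith [ht.1, min_le_right ε δ], by linarith [ht.2, min_le_right ε δ]⟩
  -- Bootstrapping: a solution of class `C^n` has derivative `f ∘ x` of class `C^n`.
  rw [contDiffOn_infty]
  intro n
  induction n with
  | zero =>
    exact contDiffOn_zero.2 fun t ht => (hs t ht).2.continuousAt.continuousWithinAt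
  | succ n ih =>
    rw [Nat.cast_succ, contDiffOn_succ_iff_deriv_of_isOpen isOpen_Ioo]
    refine ⟨fun t ht => (hs t ht).2.differentiableAt.differentiableWithinAt, by simp, ?_⟩
    refine ((hf.of_le (by exact_mod_cast le_top)).comp ih fun t ht => (hs t ht).1).congr ?_
    exact fun t ht => (hs t ht).2.deriv

section Exponential

variable {E : Type v} [NormedAddCommGroup E] [NormedSpace ℝ E]
variable {G : Type u} [TopologicalSpace G] [ChartedSpace E G] [Group G] [LieGroup 𝓘(ℝ, E) ∞ G]
variable [FiniteDimensional ℝ E]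

theorem velG_chartLine (B : E) :
    MDifferentiableAt 𝓘(ℝ, ℝ) 𝓘(ℝ, E) (fun t : ℝ => (chartCurve G (t • B) : G)) 0 ∧
    (velG (fun t : ℝ => (chartCurve G (t • B) : G)) 0 : E) = B := by
  have h3 : HasMFDerivAt 𝓘(ℝ, ℝ) 𝓘(ℝ, E) (fun t : ℝ => (chartCurve G (t • B) : G)) 0
      ((ContinuousLinearMap.id ℝ E).comp (ContinuousLinearMap.toSpanSingleton ℝ B)) := by
    have h4 : HasMFDerivAt 𝓘(ℝ, E) 𝓘(ℝ, E) (chartCurve G : E → G) ((0 : ℝ) • B)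
        (ContinuousLinearMap.id ℝ E) := by
      rw [zero_smul]; exact hasMFDerivAt_chartCurve
    exact HasMFDerivAt.comp (0 : ℝ) (f := fun t : ℝ => t • B) h4
      (ContinuousLinearMap.toSpanSingleton ℝ B).hasFDerivAt.hasMFDerivAt
  refine ⟨h3.mdifferentiableAt, ?_⟩
  rw [velG_eq_logD h3.mdifferentiableAt, logD_eq_of_hasMFDerivAt (by simp) h3]
  change (1 : ℝ) • B = B
  simp

/-- Differentiate `Ad(g) Ad(k⁻¹) A = Ad((g k g⁻¹)⁻¹) Ad(g) A` at `t = 0` along a curve `k` through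
`1` with velocity `B`. -/
theorem Ad_bracket (g : G) (A B : E) :
    (Ad g (bracket G A B) : E) = bracket G (Ad g A) (Ad g B) := by
  set s : Set ℝ := {t | t • B ∈ chartDomain E G} with hs
  have hso : IsOpen s := isOpen_chartDomain.preimage (by fun_prop)
  have h0 : (0 : ℝ) ∈ s := by simpa [hs] using zero_mem_chartDomain (E := E) (G := G)
  set k : ℝ → G := fun t => chartCurve G (t • B) with hk
  have hks : ContMDiffOn 𝓘(ℝ, ℝ) 𝓘(ℝ, E) ∞ k s :=
    contMDiffOn_chartCurve.comp
      (contDiff_id.smul contDiff_const : ContDiff ℝ ∞ fun z : ℝ => z • B).contMDiff.contMDiffOn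
      (fun z hz => hz)
  have hk0 : k 0 = 1 := by simp [hk]
  obtain ⟨hkd, hkv⟩ := velG_chartLine (G := G) B
  have hk2s : ContMDiffOn 𝓘(ℝ, ℝ) 𝓘(ℝ, E) ∞ (fun t => g * k t * g⁻¹) s :=
    (contMDiffOn_const.mul hks).mul contMDiffOn_const
  have hk2v : (velG (fun t => g * k t * g⁻¹) 0 : E) = Ad g B := by
    rw [velG_mul (mdifferentiableAt_const_mul g hkd) mdifferentiableAt_const, velG_const,
      velG_const_mul g hkd, hkv]
    simp
  have h1 := (Ad g : E →L[ℝ] E).hasFDerivAt.comp_hasDerivAt (0 : ℝ)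
    (hasDerivAt_Ad_inv_apply hso hks h0 A)
  have h2 := hasDerivAt_Ad_inv_apply hso hk2s h0 (Ad g A : E)
  rw [hk2v] at h2
  rw [hkv] at h1
  simp only [hk0, inv_one, Ad_one, mul_one, mul_inv_cancel] at h1 h2
  refine h1.unique (h2.congr_of_eventuallyEq (Eventually.of_forall fun t => ?_))
  simp [← Ad_mul, mul_assoc]

theorem hasDerivAt_coAd {s : Set ℝ} (hs : IsOpen s) {h : ℝ → G}
    (hh : ContMDiffOn 𝓘(ℝ, ℝ) 𝓘(ℝ, E) ∞ h s) {t : ℝ} (ht : t ∈ s) {η : ℝ → Dual E} {η' : Dual E}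
    (hη : HasDerivAt η η' t) :
    HasDerivAt (fun r => coAd (h r) (η r)) (coAd (h t) (η' + adStar G (η t) (velG h t))) t := by
  have h1 : HasDerivAt (fun r => (Ad (h r)⁻¹ : E →L[ℝ] E))
      (deriv (fun r => (Ad (h r)⁻¹ : E →L[ℝ] E)) t) t :=
    (((contDiffOn_Ad hs hh.inv).contDiffAt (hs.mem_nhds ht)).differentiableAt (by simp)).hasDerivAt
  refine (hη.clm_comp h1).congr_deriv ?_
  ext A
  have h2 := h1.clm_apply (hasDerivAt_const t A)
  have h3 := h2.unique (by simpa using hasDerivAt_Ad_inv_apply hs hh ht A)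
  simp only [map_zero, add_zero] at h3
  simp only [coAd_apply, add_apply, ContinuousLinearMap.comp_apply, h3, adStar_apply]
  rw [add_right_inj, ← map_neg]
  congr 1
  simp only [bracket_eq]
  abel

/-- In the chart the equation `h⁻¹h' = a` reads `x' = leftTrans(x) a(t)`; time is adjoined as a
coordinate to make it autonomous. -/
theorem exists_velG_eq_local {a : ℝ → E} {s : Set ℝ} (hs : IsOpen s) (ha : ContDiffOn ℝ ∞ a s)
    {t₀ : ℝ} (ht₀ : t₀ ∈ s) : ∃ ε > (0 : ℝ), Ioo (t₀ - ε) (t₀ + ε) ⊆ s ∧ ∃ h : ℝ → G,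
      ContMDiffOn 𝓘(ℝ, ℝ) 𝓘(ℝ, E) ∞ h (Ioo (t₀ - ε) (t₀ + ε)) ∧
      ∀ t ∈ Ioo (t₀ - ε) (t₀ + ε), (velG h t : E) = a t := by
  have : CompleteSpace E := FiniteDimensional.complete ℝ E
  set O : Set (ℝ × E) := s ×ˢ (oneChart E G).target with hO
  have hOo : IsOpen O := hs.prod (oneChart E G).open_target
  set f : ℝ × E → ℝ × E := fun z => (1, leftTrans E G z.2 (a z.1)) with hf
  have hfs : ContDiffOn ℝ ∞ f O := by
    refine contDiffOn_const.prodMk (ContDiffOn.clm_apply ?_ ?_)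
    · intro z hz
      exact (ContDiffAt.comp z (g := leftTrans E G) (contDiffAt_leftTrans hz.2)
        contDiff_snd.contDiffAt).contDiffWithinAt
    · exact ha.comp contDiff_fst.contDiffOn fun z hz => hz.1
  obtain ⟨ε, hε, z, hz0, hzs, hz⟩ := exists_contDiffOn_integralCurve hOo hfs
    (x₀ := (t₀, oneChart E G 1)) ⟨ht₀, oneChart_one_mem⟩ t₀
  have ht0m : t₀ ∈ Ioo (t₀ - ε) (t₀ + ε) := by constructor <;> linarith
  -- The adjoined time coordinate has derivative `1` and starts at `t₀`.
  have hτ : ∀ t ∈ Ioo (t₀ - ε) (t₀ + ε), (z t).1 = t := by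
    intro t ht
    have hd : ∀ r ∈ Ioo (t₀ - ε) (t₀ + ε), HasDerivAt (fun r => (z r).1 - r) 0 r := by
      intro r hr
      have h1 : HasDerivAt (fun r => (z r).1) 1 r := by
        simpa using (hz r hr).2.hasFDerivAt.fst.hasDerivAt
      exact (h1.sub (hasDerivAt_id' r)).congr_deriv (by simp)
    have := (convex_Ioo (t₀ - ε) (t₀ + ε)).is_const_of_fderivWithin_eq_zero (𝕜 := ℝ)
      (f := fun r => (z r).1 - r)
      (fun r hr => (hd r hr).differentiableAt.differentiableWithinAt)
      (fun r hr => by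
        rw [fderivWithin_of_isOpen isOpen_Ioo hr]
        have := (hd r hr).hasFDerivAt.fderiv
        rw [this]; ext; simp) ht ht0m
    simp only [hz0, sub_self] at this
    linarith
  refine ⟨ε, hε, fun t ht => by have := (hz t ht).1.1; rwa [hτ t ht] at this,
    fun t => (oneChart E G).symm (z t).2, ?_, ?_⟩
  · intro t ht
    exact ((contMDiffAt_oneChart_symm (hz t ht).1.2).comp t
      (contDiff_snd.contDiffAt.comp t
        (hzs.contDiffAt (isOpen_Ioo.mem_nhds ht))).contMDiffAt).contMDiffWithinAt
  · intro t ht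
    have hd : MDifferentiableAt 𝓘(ℝ, ℝ) 𝓘(ℝ, E) (fun t => (oneChart E G).symm (z t).2) t :=
      ((contMDiffAt_oneChart_symm (hz t ht).1.2).comp t
      (contDiff_snd.contDiffAt.comp t
        (hzs.contDiffAt (isOpen_Ioo.mem_nhds ht))).contMDiffAt).mdifferentiableAt (by simp)
    have h1 := (hasFDerivAt_oneChart_comp (E := E) hd
      ((oneChart E G).map_target (hz t ht).1.2)).hasDerivAt
    rw [(oneChart E G).right_inv (hz t ht).1.2] at h1
    have h2 : HasDerivAt (fun r => oneChart E G ((oneChart E G).symm (z r).2))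
        (leftTrans E G (z t).2 (a t)) t := by
      have h3 : HasDerivAt (fun r => (z r).2) (leftTrans E G (z t).2 (a (z t).1)) t := by
        simpa using (hz t ht).2.hasFDerivAt.snd.hasDerivAt
      rw [hτ t ht] at h3
      refine h3.congr_of_eventuallyEq ?_
      filter_upwards [isOpen_Ioo.mem_nhds ht] with r hr
      exact (oneChart E G).right_inv (hz r hr).1.2
    rw [velG_eq_logD hd]
    obtain ⟨e, he⟩ := leftTrans_isInvertible (hz t ht).1.2
    have h4 := h1.unique h2
    rw [← he] at h4
    exact e.injective h4

/-- Solutions cannot blow up inside `s`: a left translate of a solution is a solution, so a local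
solution near any time can be matched to a given one. -/
theorem exists_velG_eq {a : ℝ → E} {s : Set ℝ} (hs : IsOpen s) (hs' : IsPreconnected s)
    (ha : ContDiffOn ℝ ∞ a s) {t₀ : ℝ} (ht₀ : t₀ ∈ s) (g₀ : G) : ∃ h : ℝ → G,
      ContMDiffOn 𝓘(ℝ, ℝ) 𝓘(ℝ, E) ∞ h s ∧ h t₀ = g₀ ∧ ∀ t ∈ s, (velG h t : E) = a t := by
  classical
  let Sol : Set ℝ → (ℝ → G) → Prop := fun I h =>
    ContMDiffOn 𝓘(ℝ, ℝ) 𝓘(ℝ, E) ∞ h I ∧ ∀ t ∈ I, (velG h t : E) = a t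
  have sol_d : ∀ {I h}, IsOpen I → Sol I h → ∀ t ∈ I, MDifferentiableAt 𝓘(ℝ, ℝ) 𝓘(ℝ, E) h t :=
    fun hI hh t ht => (hh.1.contMDiffAt (hI.mem_nhds ht)).mdifferentiableAt (by simp)
  have sol_mono : ∀ {I I' h}, I' ⊆ I → Sol I h → Sol I' h := fun hI hh =>
    ⟨hh.1.mono hI, fun t ht => hh.2 t (hI ht)⟩
  have sol_congr : ∀ {I h k}, IsOpen I → (∀ t ∈ I, k t = h t) → Sol I h → Sol I k := by
    intro I h k hI hk hh
    refine ⟨hh.1.congr hk, fun t ht => (velG_congr ?_).trans (hh.2 t ht)⟩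
    filter_upwards [hI.mem_nhds ht] with r hr using hk r hr
  have sol_unique : ∀ {I h k}, IsOpen I → IsPreconnected I → Sol I h → Sol I k → ∀ t₁ ∈ I,
      h t₁ = k t₁ → ∀ t ∈ I, h t = k t := by
    intro I h k hI hI' hh hk t₁ ht₁ he t ht
    have := eq_of_velG_eq hI hI' (sol_d hI hh) (sol_d hI hk)
      (fun t ht => (hh.2 t ht).trans (hk.2 t ht).symm) ht₁ ht
    rwa [he, mul_inv_cancel, mul_inv_eq_one] at this
  have inter_conn : ∀ {I I' : Set ℝ}, IsPreconnected I → IsPreconnected I' →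
      IsPreconnected (I ∩ I') := by
    intro I I' h h'
    rw [isPreconnected_iff_ordConnected] at *
    exact h.inter h'
  let 𝒥 : Set (Set ℝ) := {I | IsOpen I ∧ IsPreconnected I ∧ I ⊆ s ∧ t₀ ∈ I ∧
    ∃ h, Sol I h ∧ h t₀ = g₀}
  have key : ∀ I : 𝒥, ∃ h, Sol I.1 h ∧ h t₀ = g₀ := fun I => I.2.2.2.2.2
  choose f hf hf0 using key
  set J : Set ℝ := ⋃₀ 𝒥 with hJ
  -- The choice of the interval is harmless: solutions through `g₀` agree on intersections.
  let H : ℝ → G := fun t => if ht : ∃ I : 𝒥, t ∈ I.1 then f ht.choose t else 1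
  have hH : ∀ I : 𝒥, ∀ t ∈ I.1, H t = f I t := by
    intro I t ht
    have hex : ∃ I : 𝒥, t ∈ I.1 := ⟨I, ht⟩
    simp only [H, dif_pos hex]
    set I' := hex.choose
    exact sol_unique (I'.2.1.inter I.2.1) (inter_conn I'.2.2.1 I.2.2.1)
      (sol_mono inter_subset_left (hf I')) (sol_mono inter_subset_right (hf I)) t₀
      ⟨I'.2.2.2.2.1, I.2.2.2.2.1⟩ ((hf0 I').trans (hf0 I).symm) t ⟨hex.choose_spec, ht⟩
  have hJo : IsOpen J := isOpen_sUnion fun I hI => hI.1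
  have hJc : IsPreconnected J :=
    isPreconnected_sUnion t₀ _ (fun I hI => hI.2.2.2.1) (fun I hI => hI.2.1)
  have hJs : J ⊆ s := sUnion_subset fun I hI => hI.2.2.1
  have sol_of_local : ∀ {I : Set ℝ} {h : ℝ → G}, (∀ t ∈ I, ∃ I', IsOpen I' ∧ t ∈ I' ∧ Sol I' h) →
      Sol I h := by
    intro I h hl
    refine ⟨fun t ht => ?_, fun t ht => ?_⟩
    · obtain ⟨I', hI', htI, hS⟩ := hl t ht
      exact (hS.1.contMDiffAt (hI'.mem_nhds htI)).contMDiffWithinAt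
    · obtain ⟨I', hI', htI, hS⟩ := hl t ht
      exact hS.2 t htI
  have hHsol : Sol J H := sol_of_local fun t ht => by
    obtain ⟨I, hI, htI⟩ := ht
    exact ⟨I, hI.1, htI, sol_congr hI.1 (hH ⟨I, hI⟩) (hf ⟨I, hI⟩)⟩
  have glob : ∀ t₁ ∈ s, ∃ ε > (0 : ℝ), Ioo (t₁ - ε) (t₁ + ε) ⊆ s ∧
      ∃ h, Sol (Ioo (t₁ - ε) (t₁ + ε)) h := fun t₁ ht₁ => exists_velG_eq_local hs ha ht₁
  have h0J : t₀ ∈ J := by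
    obtain ⟨ε, hε, hεs, h, hh⟩ := glob t₀ ht₀
    have h0 : t₀ ∈ Ioo (t₀ - ε) (t₀ + ε) := by constructor <;> linarith
    refine ⟨_, ⟨isOpen_Ioo, isPreconnected_Ioo, hεs, h0, fun t => g₀ * (h t₀)⁻¹ * h t, ⟨?_, ?_⟩, ?_⟩,
      h0⟩
    · exact contMDiffOn_const.mul hh.1
    · exact fun t ht => (velG_const_mul _ (sol_d isOpen_Ioo hh t ht)).trans (hh.2 t ht)
    · simp
  have hH0 : H t₀ = g₀ := by
    obtain ⟨I, hI, htI⟩ := h0J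
    exact (hH ⟨I, hI⟩ t₀ htI).trans (hf0 _)
  -- `J` is relatively closed in `s`: a local solution near a limit point `t₁`, translated to agree
  -- with `H` at some `t₂` in `J`, extends `H` past `t₁`.
  have hsJ : s ⊆ J := by
    refine hs'.subset_of_closure_inter_subset hJo ⟨t₀, ht₀, h0J⟩ ?_
    rintro t₁ ⟨ht₁, ht₁s⟩
    obtain ⟨ε, hε, hεs, h, hh⟩ := glob t₁ ht₁s
    set I := Ioo (t₁ - ε) (t₁ + ε) with hI
    have h1 : t₁ ∈ I := by constructor <;> linarith
    obtain ⟨t₂, ht₂I, ht₂J⟩ := mem_closure_iff.1 ht₁ I isOpen_Ioo h1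
    set k : ℝ → G := fun t => H t₂ * (h t₂)⁻¹ * h t with hk
    have hks : Sol I k := ⟨contMDiffOn_const.mul hh.1,
      fun t ht => (velG_const_mul _ (sol_d isOpen_Ioo hh t ht)).trans (hh.2 t ht)⟩
    have hHk : ∀ t ∈ J ∩ I, H t = k t :=
      sol_unique (hJo.inter isOpen_Ioo) (inter_conn hJc isPreconnected_Ioo)
        (sol_mono inter_subset_left hHsol) (sol_mono inter_subset_right hks) t₂ ⟨ht₂J, ht₂I⟩
        (by simp [hk])
    let K : ℝ → G := fun t => if t ∈ J then H t else k t
    have hKJ : ∀ t ∈ J, K t = H t := fun t ht => if_pos ht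
    have hKI : ∀ t ∈ I, K t = k t := fun t ht => by
      by_cases htJ : t ∈ J
      · exact (hKJ t htJ).trans (hHk t ⟨htJ, ht⟩)
      · exact if_neg htJ
    refine ⟨J ∪ I, ⟨hJo.union isOpen_Ioo, IsPreconnected.union t₂ ht₂J ht₂I hJc isPreconnected_Ioo,
      union_subset hJs hεs, Or.inl h0J, K, sol_of_local ?_, (hKJ t₀ h0J).trans hH0⟩, Or.inr h1⟩
    rintro t (ht | ht)
    · exact ⟨J, hJo, ht, sol_congr hJo hKJ hHsol⟩
    · exact ⟨I, isOpen_Ioo, ht, sol_congr isOpen_Ioo hKI hks⟩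
  obtain ⟨h1, h2⟩ := sol_mono hsJ hHsol
  exact ⟨H, h1, hH0, h2⟩

/-! ### One-parameter subgroups -/

theorem IsOneParameterSubgroup.mdifferentiableAt {A : E} {γ : ℝ → G}
    (hγ : IsOneParameterSubgroup A γ) (t : ℝ) : MDifferentiableAt 𝓘(ℝ, ℝ) 𝓘(ℝ, E) γ t :=
  hγ.1.mdifferentiable (by simp) t

theorem IsOneParameterSubgroup.zero {A : E} {γ : ℝ → G}
    (hγ : IsOneParameterSubgroup A γ) : γ 0 = 1 := by
  have := hγ.2.1 0 0
  simpa using this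

theorem IsOneParameterSubgroup.velG_eq {A : E} {γ : ℝ → G}
    (hγ : IsOneParameterSubgroup A γ) (t : ℝ) : (velG γ t : E) = A := by
  have h1 := velG_comp (E := E) (h := γ) (τ := fun r => t + r) (t := 0) (τ' := 1)
    (hγ.mdifferentiableAt _) ((hasDerivAt_id' (0 : ℝ)).const_add t)
  simp only [hγ.2.1, add_zero, one_smul] at h1
  rw [← h1, velG_const_mul _ (hγ.mdifferentiableAt 0), hγ.2.2]
  
/-- The curves `γ (s + r)` and `γ s * γ r` in `r` have the same velocity and the same initial value.
-/
theorem isOneParameterSubgroup_of_velG {A : E} {γ : ℝ → G}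
    (hγ : ContMDiff 𝓘(ℝ, ℝ) 𝓘(ℝ, E) ∞ γ) (h0 : γ 0 = 1) (hv : ∀ t, (velG γ t : E) = A) :
    IsOneParameterSubgroup A γ := by
  refine ⟨hγ, fun s t => ?_, hv 0⟩
  have hd : ∀ t, MDifferentiableAt 𝓘(ℝ, ℝ) 𝓘(ℝ, E) γ t := hγ.mdifferentiable (by simp)
  have hτ : ∀ r, HasDerivAt (fun r : ℝ => s + r) 1 r := fun r =>
    (hasDerivAt_id' (r : ℝ)).const_add s
  have h1 := eq_of_velG_eq isOpen_univ isPreconnected_univ (E := E) (h := fun r => γ (s + r))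
    (k := fun r => γ s * γ r)
    (fun r _ => MDifferentiableAt.comp r (hd _) (hτ r).differentiableAt.mdifferentiableAt)
    (fun r _ => mdifferentiableAt_const_mul _ (hd r))
    (fun r _ => by
      rw [velG_comp (hd _) (hτ r), velG_const_mul _ (hd r), hv, hv, one_smul])
    (mem_univ 0) (mem_univ t)
  simp only [add_zero, h0, mul_one, mul_inv_cancel] at h1
  exact mul_inv_eq_one.1 h1

theorem IsOneParameterSubgroup.eq {A : E} {γ γ' : ℝ → G}
    (hγ : IsOneParameterSubgroup A γ) (hγ' : IsOneParameterSubgroup A γ') : γ = γ' := by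
  ext t
  have := eq_of_velG_eq isOpen_univ isPreconnected_univ (fun r _ => hγ.mdifferentiableAt r)
    (fun r _ => hγ'.mdifferentiableAt r) (fun r _ => (hγ.velG_eq r).trans (hγ'.velG_eq r).symm)
    (mem_univ 0) (mem_univ t)
  simpa [hγ.zero, hγ'.zero, mul_inv_eq_one] using this

variable (G) in
theorem exists_isOneParameterSubgroup (A : E) : ∃ γ : ℝ → G, IsOneParameterSubgroup A γ := by
  obtain ⟨γ, h1, h2, h3⟩ := exists_velG_eq (G := G) isOpen_univ isPreconnected_univ
    (contDiffOn_const (c := A)) (mem_univ (0 : ℝ)) 1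
  exact ⟨γ, isOneParameterSubgroup_of_velG (contMDiffOn_univ.1 h1) h2 fun t => h3 t (mem_univ t)⟩

variable (G) in
/-- The one-parameter subgroup with initial velocity `A`. -/
noncomputable def oneParam (A : E) : ℝ → G := (exists_isOneParameterSubgroup G A).choose

theorem isOneParameterSubgroup_oneParam (A : E) : IsOneParameterSubgroup A (oneParam G A) :=
  (exists_isOneParameterSubgroup G A).choose_spec

theorem IsOneParameterSubgroup.lieExp_eq {A : E} {γ : ℝ → G} (hγ : IsOneParameterSubgroup A γ) :
    lieExp G A = γ 1 := by
  have h : IsOneParameterSubgroup A (Classical.epsilon (IsOneParameterSubgroup (G := G) A)) :=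
    Classical.epsilon_spec ⟨γ, hγ⟩
  rw [lieExp, h.eq hγ]

theorem bracket_swap (A B : E) : bracket G A B = -bracket G B A := by simp [bracket_eq]

/-- `Ad(γ⁻¹) B` solves the linear equation `y' = [y, A]`, of which the constant `B` is also a
solution. -/
theorem Ad_inv_eq_of_bracket_eq_zero {A B : E} {γ : ℝ → G} (hγ : IsOneParameterSubgroup A γ)
    (hAB : bracket G B A = 0) (t : ℝ) : (Ad (γ t)⁻¹ B : E) = B := by
  let ad : E →L[ℝ] E := LinearMap.toContinuousLinearMap ((bracket G (E := E)).flip A)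
  have h1 : ∀ t, HasDerivAt (fun r => (Ad (γ r)⁻¹ B : E)) (ad (Ad (γ t)⁻¹ B)) t := by
    intro t
    have := hasDerivAt_Ad_inv_apply isOpen_univ hγ.1.contMDiffOn (mem_univ t) B
    rwa [hγ.velG_eq] at this
  have h2 : ∀ t : ℝ, HasDerivAt (fun _ : ℝ => B) (ad B) t := by
    intro t
    have : ad B = 0 := hAB
    rw [this]; exact hasDerivAt_const t B
  have h3 := ODE_solution_unique_univ (v := fun _ => ad) (s := fun _ => univ) (t₀ := 0)
    (fun t => ad.lipschitz.lipschitzOnWith) (fun t => ⟨h1 t, mem_univ _⟩)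
    (fun t => ⟨h2 t, mem_univ _⟩) (by simp [hγ.zero])
  exact congrFun h3 t

/-- Conjugating `δ` by `γ s` gives a one-parameter subgroup with the same initial velocity, hence
`δ` itself. -/
theorem IsOneParameterSubgroup.comm {A B : E} {γ δ : ℝ → G} (hγ : IsOneParameterSubgroup A γ)
    (hδ : IsOneParameterSubgroup B δ) (hAB : bracket G A B = 0) (s t : ℝ) :
    γ s * δ t = δ t * γ s := by
  have h0 : bracket G B A = 0 := by rw [bracket_swap, hAB, neg_zero]
  have h1 : IsOneParameterSubgroup B (fun t => (γ s)⁻¹ * δ t * γ s) := by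
    refine isOneParameterSubgroup_of_velG ((contMDiff_const.mul hδ.1).mul contMDiff_const)
      (by simp [hδ.zero]) fun t => ?_
    rw [velG_mul (mdifferentiableAt_const_mul _ (hδ.mdifferentiableAt t)) mdifferentiableAt_const,
      velG_const_mul _ (hδ.mdifferentiableAt t), hδ.velG_eq, velG_const,
      Ad_inv_eq_of_bracket_eq_zero hγ h0, add_zero]
  have h2 := congrFun (h1.eq hδ) t
  calc γ s * δ t = γ s * ((γ s)⁻¹ * δ t * γ s) := by rw [h2]
    _ = δ t * γ s := by group

end Exponential

end CoisotropicProblem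

/-! ### The isotropy group near the identity. -/

namespace CoisotropicProblem

open Filter

section Isotropy

variable {E : Type v} [NormedAddCommGroup E] [NormedSpace ℝ E]
variable {G : Type u} [TopologicalSpace G] [ChartedSpace E G] [Group G] [LieGroup 𝓘(ℝ, E) ∞ G]
variable [FiniteDimensional ℝ E]

variable (G) in
/-- The isotropy group `G_μ`, as a subgroup. -/
def isotropySubgroup (μ : Dual E) : Subgroup G where
  carrier := isotropyGroup G μ
  one_mem' := coAd_one μ
  mul_mem' {a b} ha hb := by
    change coAd (a * b) μ = μ
    rw [coAd_mul, show coAd b μ = μ from hb, show coAd a μ = μ from ha]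
  inv_mem' {a} ha := ((coAd_eq_iff a μ μ).1 ha).symm

theorem mem_isotropySubgroup {μ : Dual E} {g : G} :
    g ∈ isotropySubgroup G μ ↔ coAd g μ = μ := Iff.rfl

theorem mem_isotropyAlgebra {μ : Dual E} {A : E} :
    A ∈ isotropyAlgebra G μ ↔ ∀ B, μ (bracket G A B) = 0 := by
  rw [isotropyAlgebra, LinearMap.mem_ker]
  constructor
  · intro h B
    have := congrArg (fun f : Dual E => f B) h
    simpa [adStar_apply] using this
  · intro h
    ext B
    simp [adStar_apply, h B]

theorem Ad_mem_isotropyAlgebra {η : Dual E} {g : G} {A : E} :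
    (Ad g A : E) ∈ isotropyAlgebra G (coAd g η) ↔ A ∈ isotropyAlgebra G η := by
  simp only [mem_isotropyAlgebra, coAd_apply, Ad_bracket, Ad_inv_Ad]
  refine ⟨fun h B => by simpa using h (Ad g B), fun h B => h _⟩

/-- The derivative of `Ad*(γ t) μ` is `Ad*(γ t)` applied to `ad*(A) μ = 0`. -/
theorem coAd_oneParam {μ : Dual E} {A : E} (hA : A ∈ isotropyAlgebra G μ) (t : ℝ) :
    coAd (oneParam G A t) μ = μ := by
  have hγ := isOneParameterSubgroup_oneParam (G := G) A
  have h1 : ∀ t, HasDerivAt (fun r => coAd (oneParam G A r) μ) 0 t := by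
    intro t
    have := hasDerivAt_coAd isOpen_univ hγ.1.contMDiffOn (mem_univ t) (hasDerivAt_const t μ)
    rw [hγ.velG_eq, zero_add, show adStar G μ A = 0 from hA] at this
    refine this.congr_deriv ?_
    ext B; simp [coAd_apply]
  have h2 := is_const_of_deriv_eq_zero (fun t => (h1 t).differentiableAt)
    (fun t => (h1 t).deriv) t 0
  simpa [hγ.zero] using h2

variable (G) in
/-- The product of the one-parameter subgroups with velocities `e i`. -/
noncomputable def prodParam : (n : ℕ) → (Fin n → E) → (Fin n → ℝ) → G
  | 0, _, _ => 1
  | n + 1, e, a => oneParam G (e 0) (a 0) * prodParam n (Fin.tail e) (Fin.tail a)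

theorem prodParam_zero : ∀ (n : ℕ) (e : Fin n → E), prodParam G n e 0 = 1
  | 0, _ => rfl
  | n + 1, e => by
    rw [prodParam, show Fin.tail (0 : Fin (n + 1) → ℝ) = 0 from rfl, prodParam_zero n]
    simp [(isOneParameterSubgroup_oneParam (e 0)).zero]

theorem contMDiff_prodParam : ∀ (n : ℕ) (e : Fin n → E),
    ContMDiff 𝓘(ℝ, Fin n → ℝ) 𝓘(ℝ, E) ∞ (prodParam G n e)
  | 0, _ => contMDiff_const
  | n + 1, e => by
    have h1 : ContMDiff 𝓘(ℝ, Fin (n + 1) → ℝ) 𝓘(ℝ, E) ∞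
        (fun a : Fin (n + 1) → ℝ => oneParam G (e 0) (a 0)) :=
      (isOneParameterSubgroup_oneParam (e 0)).1.comp (contDiff_apply ℝ ℝ 0).contMDiff
    have h2 : ContDiff ℝ ∞ (fun a : Fin (n + 1) → ℝ => Fin.tail a) :=
      contDiff_pi.2 fun i => contDiff_apply ℝ ℝ i.succ
    exact h1.mul ((contMDiff_prodParam n (Fin.tail e)).comp h2.contMDiff)

theorem logD_prodParam : ∀ (n : ℕ) (e : Fin n → E) (a : Fin n → ℝ),
    (logD (prodParam G n e) 0 : (Fin n → ℝ) →L[ℝ] E) a = ∑ i, a i • e i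
  | 0, e, a => by
    rw [show prodParam G 0 e = fun _ => 1 from rfl, logD_const]; simp
  | n + 1, e, a => by
    have h1 : MDifferentiableAt 𝓘(ℝ, Fin (n + 1) → ℝ) 𝓘(ℝ, E)
        (fun a : Fin (n + 1) → ℝ => oneParam G (e 0) (a 0)) 0 :=
      ((isOneParameterSubgroup_oneParam (e 0)).1.comp
        (contDiff_apply ℝ ℝ 0).contMDiff).mdifferentiable (by simp) 0
    let T : (Fin (n + 1) → ℝ) →L[ℝ] (Fin n → ℝ) :=
      ContinuousLinearMap.pi fun i => ContinuousLinearMap.proj i.succ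
    have h3 : MDifferentiableAt 𝓘(ℝ, Fin n → ℝ) 𝓘(ℝ, E) (prodParam G n (Fin.tail e))
        (T 0) := (contMDiff_prodParam n (Fin.tail e)).mdifferentiable (by simp) _
    have h2 : MDifferentiableAt 𝓘(ℝ, Fin (n + 1) → ℝ) 𝓘(ℝ, E)
        (fun a : Fin (n + 1) → ℝ => prodParam G n (Fin.tail e) (T a)) 0 :=
      MDifferentiableAt.comp _ h3 T.differentiableAt.mdifferentiableAt
    have h4 := logD_mul h1 h2
    have h5 := logD_comp h3 T.hasFDerivAt
    let P : (Fin (n + 1) → ℝ) →L[ℝ] ℝ := ContinuousLinearMap.proj 0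
    have h6 := logD_comp (α := oneParam G (e 0)) (φ := P) (w := 0)
      ((isOneParameterSubgroup_oneParam (e 0)).mdifferentiableAt _) P.hasFDerivAt
    have h7 : prodParam G (n + 1) e = fun a =>
      oneParam G (e 0) (P a) * prodParam G n (Fin.tail e) (T a) := rfl
    change (logD (fun a => oneParam G (e 0) (P a) * prodParam G n (Fin.tail e) (T a)) 0 :
      (Fin (n + 1) → ℝ) →L[ℝ] E) a = _
    have h8 : logD (oneParam G (e 0)) (P 0) = ContinuousLinearMap.toSpanSingleton ℝ (e 0) := by
      ext
      rw [← velG_eq_logD ((isOneParameterSubgroup_oneParam (e 0)).mdifferentiableAt _),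
        (isOneParameterSubgroup_oneParam (e 0)).velG_eq]
      simp
    have h9 : ∀ x : E, (Ad (prodParam G n (Fin.tail e) (T 0))⁻¹ x : E) = x := by
      intro x
      rw [map_zero, prodParam_zero]; simp
    have h10 := congrArg (fun f : (Fin (n + 1) → ℝ) →L[ℝ] E => f a) h4
    refine h10.trans ?_
    rw [h5]
    change (Ad (prodParam G n (Fin.tail e) (T 0))⁻¹ : E →L[ℝ] E)
      ((logD (fun a => oneParam G (e 0) (P a)) 0 : (Fin (n + 1) → ℝ) →L[ℝ] E) a) +
      (logD (prodParam G n (Fin.tail e)) (T 0) : (Fin n → ℝ) →L[ℝ] E) (T a) = _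
    rw [h9, h6, h8, map_zero, logD_prodParam n, Fin.sum_univ_succ]
    rfl

theorem prodParam_mem {H : Subgroup G} : ∀ (n : ℕ) (e : Fin n → E)
    (_ : ∀ i t, oneParam G (e i) t ∈ H) (a : Fin n → ℝ), prodParam G n e a ∈ H
  | 0, _, _, _ => H.one_mem
  | n + 1, e, he, a => H.mul_mem (he 0 _)
      (prodParam_mem n (Fin.tail e) (fun i => he i.succ) (Fin.tail a))

theorem prodParam_comm {x : G} : ∀ (n : ℕ) (e : Fin n → E)
    (_ : ∀ i t, x * oneParam G (e i) t = oneParam G (e i) t * x) (a : Fin n → ℝ),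
    x * prodParam G n e a = prodParam G n e a * x
  | 0, _, _, _ => by simp [prodParam]
  | n + 1, e, he, a => by
    rw [prodParam, ← mul_assoc, he, mul_assoc, prodParam_comm n (Fin.tail e) (fun i => he i.succ), mul_assoc]

theorem prodParam_add : ∀ (n : ℕ) (e : Fin n → E)
    (_ : ∀ i j, bracket G (e i) (e j) = 0) (a b : Fin n → ℝ),
    prodParam G n e (a + b) = prodParam G n e a * prodParam G n e b
  | 0, _, _, _, _ => by simp [prodParam]
  | n + 1, e, he, a, b => by
    have h0 := isOneParameterSubgroup_oneParam (G := G) (e 0)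
    have hc := prodParam_comm (x := oneParam G (e 0) (b 0)) n (Fin.tail e)
      (fun i t => h0.comm (isOneParameterSubgroup_oneParam _) (he 0 i.succ) _ _) (Fin.tail a)
    rw [prodParam, show Fin.tail (a + b) = Fin.tail a + Fin.tail b from rfl,
      prodParam_add n (Fin.tail e) (fun i j => he i.succ j.succ), Pi.add_apply, h0.2.1, prodParam, prodParam]
    simp only [mul_assoc]
    rw [← mul_assoc (oneParam G (e 0) (b 0)), hc]
    simp only [mul_assoc]

/-- A subgroup containing the one-parameter subgroups with velocities in a linear subspace contains
the image of a smooth map with differential at the origin the inclusion of the subspace; this map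
is a homomorphism if the subspace is Abelian. -/
theorem exists_subgroup_parametrization (𝔥 : Submodule ℝ E) (H : Subgroup G)
    (hH : ∀ A ∈ 𝔥, ∀ t, oneParam G A t ∈ H) : ∃ ψ : 𝔥 → G,
      ContMDiff 𝓘(ℝ, 𝔥) 𝓘(ℝ, E) ∞ ψ ∧ ψ 0 = 1 ∧
      HasMFDerivAt 𝓘(ℝ, 𝔥) 𝓘(ℝ, E) ψ 0 𝔥.subtypeL ∧ (∀ a, ψ a ∈ H) ∧
      ((∀ A ∈ 𝔥, ∀ B ∈ 𝔥, bracket G A B = 0) → ∀ a b, ψ (a + b) = ψ a * ψ b) := by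
  -- Coordinates of the second kind: `ψ` is the product of the one-parameter subgroups of a basis of
  -- `𝔥`, with the coordinates as times.
  let b := Module.finBasis ℝ 𝔥
  let e : Fin (Module.finrank ℝ 𝔥) → E := fun i => b i
  let c : 𝔥 →L[ℝ] (Fin (Module.finrank ℝ 𝔥) → ℝ) :=
    LinearMap.toContinuousLinearMap b.equivFun.toLinearMap
  have hs : ContMDiff 𝓘(ℝ, 𝔥) 𝓘(ℝ, E) ∞ (fun a => prodParam G _ e (c a)) :=
    (contMDiff_prodParam _ e).comp c.contDiff.contMDiff
  have h0 : prodParam G _ e (c 0) = 1 := by rw [map_zero, prodParam_zero]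
  refine ⟨fun a => prodParam G _ e (c a), hs, h0, ?_, fun a => prodParam_mem _ _ (fun i t =>
    hH _ (b i).2 t) _, fun hb a a' => ?_⟩
  · have h1 := hs.mdifferentiable (by simp) 0
    have h2 := hasMFDerivAt_logD h1
    have h3 : (logD (fun a => prodParam G _ e (c a)) 0 : 𝔥 →L[ℝ] E) = 𝔥.subtypeL := by
      rw [logD_comp ((contMDiff_prodParam _ e).mdifferentiable (by simp) _) c.hasFDerivAt]
      ext a
      rw [ContinuousLinearMap.comp_apply, map_zero, logD_prodParam]
      have h4 := congrArg (𝔥.subtype) (b.sum_equivFun a)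
      rw [map_sum] at h4
      exact h4
    rw [h3] at h2
    exact HasMFDerivAt.congr_of_eventuallyEq (f' := 𝔥.subtypeL) h2
      (Eventually.of_forall fun a => by simp only [h0, inv_one, one_mul])
  · change prodParam G _ e (c (a + a')) = _
    rw [← prodParam_add _ _ (fun i j => hb _ (b i).2 _ (b j).2), map_add]

theorem _root_.HasMFDerivAt.comp_clm {W W' : Type*} [NormedAddCommGroup W] [NormedSpace ℝ W]
    [NormedAddCommGroup W'] [NormedSpace ℝ W'] {β : W → G} {β' : W →L[ℝ] E} (T : W' →L[ℝ] W) {z : W'}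
    (h : HasMFDerivAt 𝓘(ℝ, W) 𝓘(ℝ, E) β (T z) β') :
    HasMFDerivAt 𝓘(ℝ, W') 𝓘(ℝ, E) (fun z => β (T z)) z (β'.comp T) :=
  HasMFDerivAt.comp (g := β) (f := fun z : W' => T z) z h T.hasFDerivAt.hasMFDerivAt

/-- Elements of the group near the identity are products of an element of a local slice and of an
element of a given subgroup. -/
theorem eventually_exists_chartCurve_mul {𝔥 𝔪 : Submodule ℝ E} (h𝔪 : IsCompl 𝔪 𝔥) {ψ : 𝔥 → G}
    (hψ : ContMDiff 𝓘(ℝ, 𝔥) 𝓘(ℝ, E) ∞ ψ) (h0 : ψ 0 = 1)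
    (hd : HasMFDerivAt 𝓘(ℝ, 𝔥) 𝓘(ℝ, E) ψ 0 𝔥.subtypeL) {O : Set 𝔪} (hO : O ∈ 𝓝 (0 : 𝔪)) :
    ∀ᶠ g : G in 𝓝 1, ∃ m ∈ O, ∃ a : 𝔥, g = chartCurve G (m : E) * ψ a := by
  have : CompleteSpace E := FiniteDimensional.complete ℝ E
  set p : 𝔪 × 𝔥 →L[ℝ] E := 𝔪.subtypeL.comp (ContinuousLinearMap.fst ℝ 𝔪 𝔥) with hp
  set q : 𝔪 × 𝔥 →L[ℝ] 𝔥 := ContinuousLinearMap.snd ℝ 𝔪 𝔥 with hq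
  set S : 𝔪 × 𝔥 → G := fun z => chartCurve G (p z) * ψ (q z) with hS
  have hS0 : S 0 = 1 := by simp [hS, h0]
  have ho := isOpen_chartDomain.mem_nhds (zero_mem_chartDomain (E := E) (G := G))
  have hc : ContMDiffAt 𝓘(ℝ, E) 𝓘(ℝ, E) ∞ (chartCurve G : E → G) (p 0) := by
    rw [map_zero]; exact contMDiffOn_chartCurve.contMDiffAt ho
  have hSs : ContMDiffAt 𝓘(ℝ, 𝔪 × 𝔥) 𝓘(ℝ, E) ∞ S 0 :=
    (hc.comp (0 : 𝔪 × 𝔥) p.contDiff.contMDiff.contMDiffAt).mul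
      ((hψ.contMDiffAt).comp (0 : 𝔪 × 𝔥) q.contDiff.contMDiff.contMDiffAt)
  have hSd : HasMFDerivAt 𝓘(ℝ, 𝔪 × 𝔥) 𝓘(ℝ, E) S 0 (p + 𝔥.subtypeL.comp q) := by
    have h1 : HasMFDerivAt 𝓘(ℝ, E) 𝓘(ℝ, E) (chartCurve G : E → G) (p 0)
        (ContinuousLinearMap.id ℝ E) := by rw [map_zero]; exact hasMFDerivAt_chartCurve
    have h3 : HasMFDerivAt 𝓘(ℝ, 𝔥) 𝓘(ℝ, E) ψ (q 0) 𝔥.subtypeL := by rwa [map_zero]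
    have h2 := h1.comp_clm p
    have h4 := h3.comp_clm q
    exact hasMFDerivAt_mul_of_eq_one (f' := p) (g' := 𝔥.subtypeL.comp q) (by simp) (by simp [h0])
      h2 h4
  have hfd := ((hasMFDerivAt_iff_of_eq_one hS0).1 hSd).2
  have hfs : ContDiffAt ℝ ∞ (fun z => oneChart E G (S z)) 0 := by
    rw [← contMDiffAt_iff_contDiffAt]
    exact ContMDiffAt.comp (0 : 𝔪 × 𝔥) (g := oneChart E G) (contMDiffAt_oneChart (by
      rw [hS0]; exact one_mem_oneChart)) hSs
  have hst := hfs.hasStrictFDerivAt' hfd (by simp)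
  -- The derivative at the origin is the sum map `𝔪 × 𝔥 → 𝔤`, onto since the subspaces are
  -- complementary; hence the image of a neighbourhood is a neighbourhood.
  have hsurj : (p + 𝔥.subtypeL.comp q).range = ⊤ := by
    rw [LinearMap.range_eq_top]
    intro x
    have hx : x ∈ 𝔪 ⊔ 𝔥 := by rw [h𝔪.sup_eq_top]; trivial
    obtain ⟨y, hy, z, hz, rfl⟩ := Submodule.mem_sup.1 hx
    exact ⟨(⟨y, hy⟩, ⟨z, hz⟩), rfl⟩
  have hmap := hst.map_nhds_eq_of_surj hsurj
  have hN : {z : 𝔪 × 𝔥 | z.1 ∈ O} ∩ S ⁻¹' (oneChart E G).source ∈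
      𝓝 (0 : 𝔪 × 𝔥) := by
    refine inter_mem ?_ ?_
    · exact continuousAt_fst.preimage_mem_nhds hO
    · exact hSs.continuousAt.preimage_mem_nhds ((oneChart E G).open_source.mem_nhds
        (by rw [hS0]; exact one_mem_oneChart))
  have him := image_mem_map (m := fun z => oneChart E G (S z)) hN
  rw [hmap, hS0] at him
  have hec : ContinuousAt (oneChart E G) 1 := (contMDiffAt_oneChart one_mem_oneChart).continuousAt
  filter_upwards [hec.preimage_mem_nhds him, (oneChart E G).open_source.mem_nhds one_mem_oneChart]
    with g hg hgs
  obtain ⟨z, hz, hzg⟩ := hg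
  exact ⟨z.1, hz.1, z.2, ((oneChart E G).injOn hz.2 hgs hzg).symm⟩

/-- The map `m ↦ Ad*(chartCurve m) μ` is strictly differentiable at the origin, with
derivative `ad*`. -/
theorem hasStrictFDerivAt_coAd_chartCurve (μ : Dual E) :
    HasStrictFDerivAt (fun m : E => coAd (chartCurve G m : G) μ)
      (LinearMap.toContinuousLinearMap (adStar G μ)) 0 := by
  have ho := isOpen_chartDomain (E := E) (G := G)
  have h0 := zero_mem_chartDomain (E := E) (G := G)
  have h1 : ContDiffAt ℝ ∞ (fun m : E => coAd (chartCurve G m : G) μ) 0 :=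
    (ContDiffOn.clm_comp contDiffOn_const
      (contDiffOn_Ad ho contMDiffOn_chartCurve.inv)).contDiffAt (ho.mem_nhds h0)
  have h2 := (h1.differentiableAt (by simp)).hasFDerivAt
  refine h1.hasStrictFDerivAt' ?_ (by simp)
  convert! h2 using 1
  ext1 B
  set s : Set ℝ := {t | t • B ∈ chartDomain E G} with hs
  have hso : IsOpen s := ho.preimage (by fun_prop)
  have h0s : (0 : ℝ) ∈ s := by simpa [hs] using h0
  have hks : ContMDiffOn 𝓘(ℝ, ℝ) 𝓘(ℝ, E) ∞ (fun t : ℝ => (chartCurve G (t • B) : G)) s :=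
    contMDiffOn_chartCurve.comp
      (contDiff_id.smul contDiff_const : ContDiff ℝ ∞ fun z : ℝ => z • B).contMDiff.contMDiffOn
      (fun z hz => hz)
  have h3 := hasDerivAt_coAd hso hks h0s (hasDerivAt_const (0 : ℝ) μ)
  rw [(velG_chartLine B).2, zero_smul, chartCurve_zero, coAd_one, zero_add] at h3
  have h4 : HasFDerivAt (fun m : E => coAd (chartCurve G m : G) μ)
      (fderiv ℝ (fun m : E => coAd (chartCurve G m : G) μ) 0) ((0 : ℝ) • B) := by
    rwa [zero_smul]
  have h5 := h4.comp_hasDerivAt (0 : ℝ) ((hasDerivAt_id (0 : ℝ)).smul_const B)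
  have h6 := h3.unique h5
  simpa using h6

/-- A strictly differentiable map with injective derivative is injective near the point. -/
theorem _root_.HasStrictFDerivAt.exists_mem_nhds_injOn {V V' : Type*} [NormedAddCommGroup V]
    [NormedSpace ℝ V] [FiniteDimensional ℝ V] [NormedAddCommGroup V'] [NormedSpace ℝ V'] {f : V → V'}
    {f' : V →L[ℝ] V'} {x : V} (hf : HasStrictFDerivAt f f' x) (hf' : Function.Injective f') :
    ∃ N ∈ 𝓝 x, InjOn f N := by
  obtain ⟨K, hK, hKf⟩ := f'.toLinearMap.exists_antilipschitzWith (LinearMap.ker_eq_bot.2 hf')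
  -- `f'` expands distances by at least `K⁻¹`; an error of half that size cannot cancel it.
  obtain ⟨N, hN, hNf⟩ := hf.approximates_deriv_on_nhds (c := K⁻¹ / 2) (Or.inr (by positivity))
  refine ⟨N, hN, ?_⟩
  intro y hy z hz hyz
  have h1 := hNf y hy z hz
  have h2 := hKf.le_mul_dist y z
  rw [hyz, sub_self, zero_sub, norm_neg] at h1
  rw [dist_eq_norm, dist_eq_norm, ← map_sub] at h2
  change ‖y - z‖ ≤ K * ‖f' (y - z)‖ at h2
  have hK' : (0 : ℝ) < K := hK
  push_cast at h1
  have h3 : ‖y - z‖ ≤ ‖y - z‖ / 2 := by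
    calc ‖y - z‖ ≤ K * ‖f' (y - z)‖ := h2
      _ ≤ K * ((K : ℝ)⁻¹ / 2 * ‖y - z‖) := by gcongr
      _ = ‖y - z‖ / 2 := by field_simp
  have h4 : ‖y - z‖ = 0 := by linarith [norm_nonneg (y - z)]
  exact sub_eq_zero.1 (norm_eq_zero.1 h4)

/-- The identity component of `G_μ` is Abelian if its Lie algebra is. -/
theorem commute_of_mem_connectedComponentIn {μ : Dual E}
    (hab : ∀ A ∈ isotropyAlgebra G μ, ∀ B ∈ isotropyAlgebra G μ, bracket G A B = 0) {a b : G}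
    (ha : a ∈ connectedComponentIn (isotropyGroup G μ) 1)
    (hb : b ∈ connectedComponentIn (isotropyGroup G μ) 1) : a * b = b * a := by
  have : IsTopologicalGroup G := topologicalGroup_of_lieGroup (E := E) 𝓘(ℝ, E) ∞
  set 𝔥 := isotropyAlgebra G μ with h𝔥
  obtain ⟨ψ, hψ, hψ0, hψd, hψH, hψa⟩ := exists_subgroup_parametrization 𝔥 (isotropySubgroup G μ)
    (fun A hA t => coAd_oneParam hA t)
  have hψa := hψa hab
  -- Since `𝔥` is the kernel of `ad*` at `μ`, the orbit map is an immersion along a complement `𝔪`,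
  -- so it is injective on a small slice.
  obtain ⟨𝔪, h𝔪⟩ := 𝔥.exists_isCompl
  have h1 : HasStrictFDerivAt (fun m : 𝔪 => coAd (chartCurve G (m : E) : G) μ)
      ((LinearMap.toContinuousLinearMap (adStar G μ)).comp 𝔪.subtypeL) 0 :=
    HasStrictFDerivAt.comp (g := fun m : E => coAd (chartCurve G m : G) μ) (0 : 𝔪)
      (hasStrictFDerivAt_coAd_chartCurve μ) 𝔪.subtypeL.hasStrictFDerivAt
  have h2 : Function.Injective ((LinearMap.toContinuousLinearMap (adStar G μ)).comp 𝔪.subtypeL) := by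
    rw [injective_iff_map_eq_zero]
    intro m hm
    have hm' : (m : E) ∈ 𝔥 := hm
    exact Subtype.ext (Submodule.disjoint_def.1 h𝔪.symm.disjoint m m.2 hm')
  obtain ⟨N, hN, hNi⟩ := h1.exists_mem_nhds_injOn h2
  have h3 := eventually_exists_chartCurve_mul h𝔪.symm hψ hψ0 hψd hN
  -- An element of `G_μ` near `1` factors as `chartCurve m * ψ a`. Its first factor fixes `μ`, so `m
  -- = 0` by injectivity on the slice.
  have h4 : ∀ᶠ g : isotropySubgroup G μ in 𝓝 1, ∃ a, (g : G) = ψ a := by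
    have hc : Tendsto (fun g : isotropySubgroup G μ => (g : G)) (𝓝 1) (𝓝 1) :=
      continuous_subtype_val.continuousAt
    filter_upwards [hc.eventually h3] with g hg
    obtain ⟨m, hm, a, hga⟩ := hg
    have h5 : coAd (chartCurve G (m : E) : G) μ = μ := by
      have h6 := g.2
      rw [hga, mem_isotropySubgroup, coAd_mul, show coAd (ψ a) μ = μ from hψH a] at h6
      exact h6
    have h7 : m = 0 := hNi hm (mem_of_mem_nhds hN) (by simp [h5])
    exact ⟨a, by rw [hga, h7]; simp⟩
  -- The image of the homomorphism `ψ`; being a neighbourhood of `1` in `G_μ`, it is open and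
  -- therefore closed, so it contains the identity component.
  let K : Subgroup (isotropySubgroup G μ) :=
    { carrier := {g | ∃ a, (g : G) = ψ a}
      one_mem' := ⟨0, by simp [hψ0]⟩
      mul_mem' := by
        rintro g g' ⟨a, ha⟩ ⟨a', ha'⟩
        exact ⟨a + a', by rw [hψa, ← ha, ← ha']; rfl⟩
      inv_mem' := by
        rintro g ⟨a, ha⟩
        refine ⟨-a, ?_⟩
        rw [Subgroup.coe_inv, ha, inv_eq_iff_mul_eq_one, ← hψa, add_neg_cancel, hψ0] }
  have hKo : IsOpen (K : Set (isotropySubgroup G μ)) := K.isOpen_of_mem_nhds h4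
  have hKc : IsClosed (K : Set (isotropySubgroup G μ)) := K.isClosed_of_isOpen hKo
  have hcc : ∀ a ∈ connectedComponentIn (isotropyGroup G μ) 1, ∃ x, a = ψ x := by
    intro a ha
    rw [connectedComponentIn_eq_image (show (1 : G) ∈ isotropyGroup G μ from coAd_one μ)] at ha
    obtain ⟨g, hg, rfl⟩ := ha
    exact (IsClopen.connectedComponent_subset ⟨hKc, hKo⟩ K.one_mem) hg
  obtain ⟨x, rfl⟩ := hcc a ha
  obtain ⟨y, rfl⟩ := hcc b hb
  rw [← hψa, ← hψa, add_comm]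

end Isotropy

end CoisotropicProblem

/-! ### The characteristic field and the linearized phase portrait. -/

namespace CoisotropicProblem

open Filter

theorem _root_.Submodule.finrank_eq_one_iff_exists {V : Type*} [AddCommGroup V] [Module ℝ V]
    (S : Submodule ℝ V) :
    Module.finrank ℝ S = 1 ↔ ∃ v ∈ S, v ≠ 0 ∧ ∀ w ∈ S, ∃ c : ℝ, c • v = w := by
  rw [finrank_eq_one_iff']
  exact ⟨fun ⟨v, h0, h⟩ => ⟨v, v.2, fun h' => h0 (Subtype.ext h'), fun w hw =>
      (h ⟨w, hw⟩).imp fun c hc => congrArg Subtype.val hc⟩,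
    fun ⟨v, hv, h0, h⟩ => ⟨⟨v, hv⟩, fun h' => h0 (congrArg Subtype.val h'), fun w =>
      (h w w.2).imp fun c hc => Subtype.ext hc⟩⟩

namespace InvariantLagrangian

section Phase

variable {E : Type v} [NormedAddCommGroup E] [NormedSpace ℝ E] [FiniteDimensional ℝ E]
variable {G : Type u} [TopologicalSpace G] [ChartedSpace E G] [Group G] [LieGroup 𝓘(ℝ, E) ∞ G]
variable {𝓛 : InvariantLagrangian E} {F : Submfd.{v, w} 𝓛}

theorem existsUnique_isCharacteristicVector (hN : Nondegenerate G F) (p : F.carrier) :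
    ∃! X, IsCharacteristicVector G F p X := by
  obtain ⟨h1, h2⟩ := hN.2 p
  obtain ⟨v, hv, hv0, -⟩ := (kerPsiY G F p).finrank_eq_one_iff_exists.1 h1
  have hω : 𝓛.indep v.1 ≠ 0 := fun h => hv0 (h2 v hv h)
  refine ⟨(𝓛.indep v.1)⁻¹ • v, ⟨Submodule.smul_mem _ _ hv, ?_⟩, ?_⟩
  · simp [hω]
  · rintro X ⟨hX, hX1⟩
    have h3 := h2 (X - (𝓛.indep v.1)⁻¹ • v) (Submodule.sub_mem _ hX (Submodule.smul_mem _ _ hv))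
      (by simp [hω, hX1])
    exact sub_eq_zero.1 h3

theorem isCharacteristicVector_xi (hN : Nondegenerate G F) (p : F.carrier) :
    IsCharacteristicVector G F p (xi G F p) :=
  Classical.epsilon_spec (existsUnique_isCharacteristicVector hN p).exists

theorem eq_smul_xi (hN : Nondegenerate G F) {p : F.carrier} {X : E × 𝓛.V}
    (hX : X ∈ kerPsiY G F p) : X = 𝓛.indep X.1 • xi G F p := by
  have h1 := isCharacteristicVector_xi hN p
  refine sub_eq_zero.1 ((hN.2 p).2 _ (Submodule.sub_mem _ hX (Submodule.smul_mem _ _ h1.1)) ?_)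
  simp [h1.2]

theorem phaseField_mem_tangentF (hN : Nondegenerate G F) (p : F.carrier) :
    phaseField G F p ∈ tangentF F p :=
  (isCharacteristicVector_xi hN p).1.1.2

theorem fderiv_constraint (x y : 𝓛.V) :
    fderiv ℝ 𝓛.constraint x y = y.2 (Q x) + x.2 y.1 - fderiv ℝ 𝓛.L x.1 y.1 := by
  have h1 : HasFDerivAt (fun x : 𝓛.V => (x.1 : E)) (𝓛.𝔞.subtypeL.comp
      (ContinuousLinearMap.fst ℝ 𝓛.𝔞 (Dual E))) x :=
    (𝓛.𝔞.subtypeL.comp (ContinuousLinearMap.fst ℝ 𝓛.𝔞 (Dual E))).hasFDerivAt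
  have h2 : HasFDerivAt (fun x : 𝓛.V => x.2) (ContinuousLinearMap.snd ℝ 𝓛.𝔞 (Dual E)) x :=
    (ContinuousLinearMap.snd ℝ 𝓛.𝔞 (Dual E)).hasFDerivAt
  have h3 : HasFDerivAt (fun x : 𝓛.V => 𝓛.L x.1) ((fderiv ℝ 𝓛.L x.1).comp
      (ContinuousLinearMap.fst ℝ 𝓛.𝔞 (Dual E))) x :=
    ((𝓛.contDiff_L.differentiable (by simp) x.1).hasFDerivAt).comp x
      (ContinuousLinearMap.fst ℝ 𝓛.𝔞 (Dual E)).hasFDerivAt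
  have h4 := (h2.clm_apply (h1.const_add 𝓛.P)).sub h3
  have h5 : fderiv ℝ 𝓛.constraint x = _ := h4.fderiv
  rw [h5]
  simp [Q, add_comm]

theorem mem_tangentZ {x : 𝓛.V} {X : E × 𝓛.V} :
    X ∈ 𝓛.tangentZ x ↔ X.2.2 (Q x) + x.2 X.2.1 - fderiv ℝ 𝓛.L x.1 X.2.1 = 0 := by
  rw [← fderiv_constraint]; rfl

theorem mdifferentiableAt_incl (p : F.carrier) :
    MDifferentiableAt (𝓡 F.dim) 𝓘(ℝ, 𝓛.V) F.incl p :=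
  F.contMDiff_incl.mdifferentiable (by simp) p

theorem tangentY_le_tangentZ (hF : IsPhaseSpace G F) (p : F.carrier) :
    tangentY F p ≤ 𝓛.tangentZ (F.incl p) := by
  rintro ⟨A, w⟩ ⟨-, u, hu⟩
  have hc : ContDiff ℝ ∞ 𝓛.constraint := by
    have h1 : ContDiff ℝ ∞ (fun x : 𝓛.V => 𝓛.P + (x.1 : E)) :=
      contDiff_const.add (𝓛.𝔞.subtypeL.contDiff.comp contDiff_fst)
    exact (contDiff_snd.clm_apply h1).sub (𝓛.contDiff_L.comp contDiff_fst)
  have h1 := (hc.differentiable (by simp) (F.incl p)).hasFDerivAt.hasMFDerivAt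
  have h2 := h1.comp p (mdifferentiableAt_incl p).hasMFDerivAt
  have h3 : 𝓛.constraint ∘ F.incl = fun _ => 0 := funext hF.subset
  rw [h3] at h2
  have h4 := hasMFDerivAt_unique h2 (hasMFDerivAt_const (c := (0 : ℝ)) (x := p))
  have h5 : (fderiv ℝ 𝓛.constraint (F.incl p)) (mfderiv (𝓡 F.dim) 𝓘(ℝ, 𝓛.V) F.incl p u) = 0 :=
    congrArg (fun f : EuclideanSpace ℝ (Fin F.dim) →L[ℝ] ℝ => f u) h4
  change fderiv ℝ 𝓛.constraint (F.incl p) w = 0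
  rw [← h5]
  exact congrArg _ hu.symm

theorem indep_Q (x : 𝓛.V) : 𝓛.indep (Q x) = 1 := by
  simp [Q, 𝓛.indep_P, 𝓛.indep_𝔞 _ x.1.2]

theorem indep_ham (p : F.carrier) : 𝓛.indep (ham p) = 1 := indep_Q _

/-- The integral vector tangent to `Y` lies in the kernel of `Ψ_Y`, hence is a multiple of `ξ`, with
nonzero factor because `ω` does not vanish on it. So `ξ` inherits annihilation by all of `T Z̃`,
which leaves many more test vectors than `T Y`. -/
theorem isIntegralVector_xi (hF : IsCoisotropic G F) (p : F.carrier) :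
    𝓛.IsIntegralVector G (F.incl p) (xi G F p) := by
  obtain ⟨X, hX, hXi⟩ := hF.phaseSpace.integral p
  have h1 := eq_smul_xi hF.nondegenerate (p := p) (X := X)
    ⟨hX, fun Y hY => hXi.2.2 Y (tangentY_le_tangentZ hF.phaseSpace p hY)⟩
  have hc := isCharacteristicVector_xi hF.nondegenerate p
  refine ⟨tangentY_le_tangentZ hF.phaseSpace p hc.1.1, by rw [hc.2]; exact one_ne_zero,
    fun Y hY => ?_⟩
  have h2 := hXi.2.2 Y hY
  rw [h1] at h2
  simp only [Psi_apply, Prod.smul_snd, Prod.smul_fst, map_smul, LinearMap.smul_apply,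
    smul_apply, smul_eq_mul] at h2 ⊢
  refine (mul_eq_zero.1 ?_).resolve_left hXi.2.1
  linear_combination h2

/-- Test vectors `(0, 0, ζ - ζ(Q) ω)`: they are tangent to `Z̃` because `ω(Q) = 1`, and `Ψ` pairs
them with `ξ.1` alone. -/
theorem xi_fst (hF : IsCoisotropic G F) (p : F.carrier) : (xi G F p).1 = ham p := by
  have h := isIntegralVector_xi hF p
  have hc := isCharacteristicVector_xi hF.nondegenerate p
  have h1 : ∀ ζ : Dual E, ζ (xi G F p).1 = ζ (ham p) := by
    intro ζ
    have h2 := h.2.2 (0, 0, ζ - ζ (ham p) • 𝓛.indep) (by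
      rw [mem_tangentZ]
      change (ζ - ζ (ham p) • 𝓛.indep) (ham p) + _ - _ = 0
      simp [indep_ham])
    simp [Psi_apply, hc.2] at h2
    linarith
  by_contra hne
  obtain ⟨f, hf⟩ := SeparatingDual.exists_ne_zero (R := ℝ) (sub_ne_zero.2 hne)
  exact hf (by rw [map_sub, h1, sub_self])

theorem xi_eq (hF : IsCoisotropic G F) (p : F.carrier) :
    xi G F p = (ham p, phaseField G F p) := Prod.ext (xi_fst hF p) rfl

/-- The test vector `(0, a, -c ω)` is tangent to `Z̃` exactly when `c` is the defect `⟨η; a⟩ -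
dL(a)`; pairing with `ξ` forces `c = 0`. -/
theorem legendre_apply (hF : IsCoisotropic G F) (p : F.carrier) (a : 𝓛.𝔞) :
    legendre p a = fderiv ℝ 𝓛.L (F.incl p).1 a := by
  have h := isIntegralVector_xi hF p
  set c := legendre p a - fderiv ℝ 𝓛.L (F.incl p).1 a with hc
  have h2 := h.2.2 (0, a, -c • 𝓛.indep) (by
    rw [mem_tangentZ]
    change (-c • 𝓛.indep) (ham p) + legendre p a - _ = 0
    simp [indep_ham]; linarith)
  simp [Psi_apply, xi_fst hF, indep_ham] at h2
  linarith

/-- The Euler–Poincaré equation, obtained from the purely horizontal test vectors `(B, 0)`. -/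
theorem phaseField_snd (hF : IsCoisotropic G F) (p : F.carrier) :
    (phaseField G F p).2 = -adStar G (legendre p) (ham p) := by
  ext B
  have h := (isIntegralVector_xi hF p).2.2 (B, 0) (by rw [mem_tangentZ]; simp)
  rw [xi_eq hF] at h
  simp only [Psi_apply] at h
  rw [neg_apply, adStar_apply]
  simp at h
  change (phaseField G F p).2 B = - - legendre p _
  change (phaseField G F p).2 B - legendre p _ = 0 at h
  linarith

/-- Such a `(0, w)` lies in the kernel of `Ψ_Y` and has `ω = 0`. In other words the Legendre
transform is an immersion. -/
theorem eq_zero_of_snd_eq_zero (hN : Nondegenerate G F) {p : F.carrier} {w : 𝓛.V}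
    (hw : w ∈ tangentF F p) (h : w.2 = 0) : w = 0 := by
  have h1 := (hN.2 p).2 (0, w) ⟨⟨trivial, hw⟩, fun Y _ => by simp [Psi_apply, h]⟩ (by simp)
  exact congrArg Prod.snd h1

theorem isRegularPoint_iff (hF : IsCoisotropic G F) (p : F.carrier) :
    IsRegularPoint G F p ↔ adStar G (legendre p) (ham p) ≠ 0 := by
  rw [IsRegularPoint, not_iff_not]
  constructor
  · intro h
    have h1 := phaseField_snd hF p
    rw [h] at h1
    simpa using h1.symm
  · intro h
    refine eq_zero_of_snd_eq_zero hF.nondegenerate (phaseField_mem_tangentF hF.nondegenerate p) ?_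
    rw [phaseField_snd hF, h, neg_zero]

theorem continuous_legendre : Continuous (legendre (F := F)) :=
  continuous_snd.comp F.contMDiff_incl.continuous

variable (G) in
/-- The Lie bracket as a continuous bilinear map. -/
noncomputable def bracketL : E →L[ℝ] E →L[ℝ] E :=
  LinearMap.toContinuousLinearMap
    ((LinearMap.toContinuousLinearMap : (E →ₗ[ℝ] E) ≃ₗ[ℝ] (E →L[ℝ] E)).toLinearMap ∘ₗ bracket G)

theorem bracketL_apply (A B : E) : bracketL G A B = bracket G A B := rfl

theorem adStar_eq_comp (η : Dual E) (A : E) : adStar G η A = -η.comp (bracketL G A) := by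
  exact ContinuousLinearMap.ext fun B => rfl

theorem contDiff_adStar : ContDiff ℝ ∞ (fun z : Dual E × E => adStar G z.1 z.2) := by
  have h1 : ContDiff ℝ ∞ (bracketL (E := E) G) := (bracketL (E := E) G).contDiff
  have h0 : ContDiff ℝ ∞ (fun z : Dual E × E => bracketL G z.2) := h1.comp contDiff_snd
  have h2 : ContDiff ℝ ∞ (fun z : Dual E × E => z.1) := contDiff_fst
  simp only [adStar_eq_comp]
  exact (h2.clm_comp h0).neg

theorem isOpen_setOf_isRegularPoint (hF : IsCoisotropic G F) :
    IsOpen {p : F.carrier | IsRegularPoint G F p} := by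
  simp only [isRegularPoint_iff hF]
  have h1 : Continuous (fun p : F.carrier => (legendre p, ham p)) := by
    refine continuous_legendre.prodMk ?_
    exact continuous_const.add (continuous_subtype_val.comp
      (continuous_fst.comp F.contMDiff_incl.continuous))
  have h2 : Continuous (fun z : Dual E × E => adStar G z.1 z.2) :=
    (contDiff_adStar (E := E) (G := G)).continuous
  have h3 : Continuous (fun p : F.carrier => adStar G (legendre p) (ham p)) :=
    Continuous.comp (g := fun z : Dual E × E => adStar G z.1 z.2)
      (f := fun p : F.carrier => (legendre p, ham p)) h2 h1
  exact isOpen_ne_fun h3 continuous_const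

theorem fundamental_one (A : E) : (fundamental (1 : G) A : E) = A := by
  rw [fundamental_eq]; simp

theorem phaseField_mem_tangentPortrait (hF : IsCoisotropic G F) (p : F.carrier) :
    phaseField G F p ∈ tangentPortrait G F p :=
  ⟨phaseField_mem_tangentF hF.nondegenerate p, -ham p, by
    rw [map_neg, ← phaseField_snd hF]; rfl⟩

/-- If `w.2 = ad*(A) η`, then `(-A, w)` is polar to the orbit directions; coisotropy writes it as an
orbit direction plus a multiple of `ξ`. The orbit direction has no `𝓕`-component. -/
theorem exists_eq_smul_phaseField (hF : IsCoisotropic G F) {p : F.carrier}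
    (hp : IsRegularPoint G F p) {w : 𝓛.V} (hw : w ∈ tangentPortrait G F p) :
    ∃ c : ℝ, w = c • phaseField G F p := by
  obtain ⟨hw1, A, hA⟩ := hw
  have hA : adStar G (legendre p) A = w.2 := hA
  obtain ⟨B, K, hK, h⟩ := hF.coisotropic 1 p hp (-A, w) ⟨trivial, hw1⟩ (fun B => by
    rw [fundamental_one, Psi_apply]
    have h1 := congrArg (fun f : Dual E => f B) hA
    simp only [adStar_apply] at h1
    change (1 / 2 : ℝ) * (w.2 B - (0 : Dual E) (-A) - legendre p (bracket G (-A) B)) = 0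
    rw [← h1]; simp)
  have h1 := congrArg Prod.snd h
  have h2 := eq_smul_xi hF.nondegenerate hK
  refine ⟨𝓛.indep K.1, ?_⟩
  rw [h2] at h1
  have h3 : w = (0 : 𝓛.V) + 𝓛.indep K.1 • phaseField G F p := h1
  rwa [zero_add] at h3

/-- The functional chosen in the definition of `sigma` is meaningful because the tangent space is
the line spanned by `Φ`, on which the normalization fixes it. -/
theorem sigma_smul_phaseField (hF : IsCoisotropic G F) {p : F.carrier}
    (hp : IsRegularPoint G F p) :
    (Module.finrank ℝ (tangentPortrait G F p) = 1 ∧ ∃! f, IsTimeForm G F p f) ∧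
    ∀ c : ℝ, sigma G F p (c • phaseField G F p) = c := by
  have hΦ := phaseField_mem_tangentPortrait hF p
  have h1 : Module.finrank ℝ (tangentPortrait G F p) = 1 := by
    refine (tangentPortrait G F p).finrank_eq_one_iff_exists.2 ⟨_, hΦ, hp, fun w hw => ?_⟩
    obtain ⟨c, hc⟩ := exists_eq_smul_phaseField hF hp hw
    exact ⟨c, hc.symm⟩
  obtain ⟨f, hf⟩ := SeparatingDual.exists_eq_one (R := ℝ) (V := 𝓛.V) hp
  have h2 : IsTimeForm G F p (f.toLinearMap.domRestrict (tangentPortrait G F p)) := ⟨hΦ, hf⟩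
  refine ⟨⟨h1, _, h2, ?_⟩, ?_⟩
  · rintro f' ⟨_, hf'⟩
    ext ⟨w, hw⟩
    obtain ⟨c, rfl⟩ := exists_eq_smul_phaseField hF hp hw
    have h3 : (⟨c • phaseField G F p, hw⟩ : tangentPortrait G F p) =
      c • ⟨phaseField G F p, hΦ⟩ := rfl
    rw [h3, map_smul, map_smul, hf']
    exact congrArg (c • ·) hf.symm
  · intro c
    have hc : c • phaseField G F p ∈ tangentPortrait G F p := Submodule.smul_mem _ _ hΦ
    have h3 : IsTimeForm G F p (Classical.epsilon (IsTimeForm G F p)) :=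
      Classical.epsilon_spec ⟨_, h2⟩
    obtain ⟨_, h4⟩ := h3
    rw [sigma, dif_pos hc, show (⟨c • phaseField G F p, hc⟩ : tangentPortrait G F p) =
      c • ⟨phaseField G F p, hΦ⟩ from rfl, map_smul, h4, smul_eq_mul, mul_one]

/-- Whatever functional has been chosen is linear, so no regularity of `p` enters. -/
theorem sigma_zero (p : F.carrier) : sigma G F p 0 = 0 := by
  rw [sigma, dif_pos (Submodule.zero_mem _)]
  exact map_zero (Classical.epsilon (IsTimeForm G F p))

theorem eq_sigma_smul (hF : IsCoisotropic G F) {p : F.carrier}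
    (hp : IsRegularPoint G F p) {w : 𝓛.V} (hw : w ∈ tangentPortrait G F p) :
    w = sigma G F p w • phaseField G F p := by
  obtain ⟨c, rfl⟩ := exists_eq_smul_phaseField hF hp hw
  rw [(sigma_smul_phaseField hF hp).2]

end Phase

end InvariantLagrangian

end CoisotropicProblem

/-! ### Commutativity of the isotropy algebras. -/

namespace CoisotropicProblem

open Filter Asymptotics

section IsotropyAlgebra

variable {E : Type v} [NormedAddCommGroup E] [NormedSpace ℝ E] [FiniteDimensional ℝ E]
variable {G : Type u} [TopologicalSpace G] [ChartedSpace E G] [Group G] [LieGroup 𝓘(ℝ, E) ∞ G]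

theorem isotropyAlgebra_swap {η : Dual E} {A B : E} (hB : B ∈ isotropyAlgebra G η) :
    η (bracket G A B) = 0 := by
  rw [bracket_swap, map_neg, mem_isotropyAlgebra.1 hB, neg_zero]

theorem norm_apply_bracket_le (η : Dual E) (A B : E) :
    ‖η (bracket G A B)‖ ≤ ‖η‖ * (‖bracketL (E := E) G‖ * ‖A‖ * ‖B‖) := by
  rw [← bracketL_apply]
  exact (η.le_opNorm _).trans (by gcongr; exact (bracketL (E := E) G).le_opNorm₂ A B)

theorem norm_adStar_le (η : Dual E) (A : E) :
    ‖adStar G η A‖ ≤ ‖η‖ * (‖bracketL (E := E) G‖ * ‖A‖) := by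
  rw [adStar_eq_comp, norm_neg]
  refine (ContinuousLinearMap.opNorm_comp_le _ _).trans ?_
  gcongr
  exact (bracketL (E := E) G).le_opNorm A

theorem adStar_sub (η η' : Dual E) (A : E) :
    adStar G (η - η') A = adStar G η A - adStar G η' A := by
  rw [adStar_eq_comp, adStar_eq_comp, adStar_eq_comp, ContinuousLinearMap.sub_comp]
  abel

/-- Along a curve of covectors with isotropy algebras of constant dimension, the velocity
annihilates the derived algebra of the isotropy algebra. -/
theorem apply_bracket_eq_zero_of_finrank_eq {η : ℝ → Dual E} {ζ : Dual E} (hη : HasDerivAt η ζ 0)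
    (hd : ∀ᶠ t in 𝓝 (0 : ℝ), Module.finrank ℝ (isotropyAlgebra G (η t)) =
      Module.finrank ℝ (isotropyAlgebra G (η 0))) {A B : E} (hA : A ∈ isotropyAlgebra G (η 0))
    (hB : B ∈ isotropyAlgebra G (η 0)) : ζ (bracket G A B) = 0 := by
  set 𝔥 := isotropyAlgebra G (η 0) with h𝔥
  set C := ‖bracketL (E := E) G‖ with hC
  obtain ⟨𝔪, h𝔪⟩ := 𝔥.exists_isCompl
  set P : E →ₗ[ℝ] 𝔥 := 𝔥.projectionOnto 𝔪 h𝔪 with hP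
  have hinj : Function.Injective ((adStar G (η 0)).prod P) := by
    rw [injective_iff_map_eq_zero]
    intro x hx
    have h1 : x ∈ 𝔥 := congrArg Prod.fst hx
    have h2 : P x = 0 := congrArg Prod.snd hx
    have h3 := Submodule.projectionOnto_apply_left h𝔪 ⟨x, h1⟩
    exact congrArg Subtype.val (h3.symm.trans h2)
  obtain ⟨K, hK, hKT⟩ := ((adStar G (η 0)).prod P).exists_antilipschitzWith
    (LinearMap.ker_eq_bot.2 hinj)
  have hKT' : ∀ x, P x = 0 → ‖x‖ ≤ K * ‖adStar G (η 0) x‖ := by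
    intro x hx
    have h1 := hKT.le_mul_dist x 0
    rw [map_zero, dist_zero_right, dist_zero_right] at h1
    have h2 : ((adStar G (η 0)).prod P) x = (adStar G (η 0) x, 0) := by simp [hx]
    rw [h2, Prod.norm_mk, norm_zero, max_eq_left (norm_nonneg _)] at h1
    exact h1
  -- For `t` near `0`, the lower bound `1 / K` of `ad*` at `η 0` on the kernel of `P` survives for
  -- `η t` with `2 K` in place of `K`.
  have hsmall : ∀ᶠ t in 𝓝 (0 : ℝ), K * (‖η t - η 0‖ * C) ≤ 1 / 2 := by
    have h1 : Tendsto (fun t => K * (‖η t - η 0‖ * C)) (𝓝 0) (𝓝 (K * (‖η 0 - η 0‖ * C))) :=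
      (((hη.continuousAt.sub continuousAt_const).norm.mul continuousAt_const).const_mul _)
    rw [sub_self, norm_zero, zero_mul, mul_zero] at h1
    exact (h1.eventually (gt_mem_nhds (by norm_num : (0 : ℝ) < 1 / 2))).mono fun t ht => le_of_lt ht
  have hbound : ∀ᶠ t in 𝓝 (0 : ℝ), ‖η t (bracket G A B)‖ ≤
      (C * (2 * K * (C * ‖A‖)) * ‖B‖) * ‖‖η t - η 0‖ * ‖η t - η 0‖‖ := by
    filter_upwards [hsmall, hd] with t ht hdt
    have h1 : ∀ x, P x = 0 → ‖x‖ ≤ 2 * K * ‖adStar G (η t) x‖ := by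
      intro x hx
      have h2 := hKT' x hx
      have h3 : adStar G (η 0) x = adStar G (η t) x - adStar G (η t - η 0) x := by
        rw [adStar_sub]; abel
      have h4 : ‖adStar G (η 0) x‖ ≤ ‖adStar G (η t) x‖ + ‖η t - η 0‖ * (C * ‖x‖) := by
        rw [h3]
        exact (norm_sub_le _ _).trans (by gcongr; exact norm_adStar_le _ _)
      have h5 : ‖x‖ ≤ K * (‖adStar G (η t) x‖ + ‖η t - η 0‖ * (C * ‖x‖)) :=
        h2.trans (by gcongr)
      have h6 := mul_le_mul_of_nonneg_right ht (norm_nonneg x)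
      nlinarith
    -- `P` is injective on the isotropy algebra of `η t`, hence bijective onto `𝔥` by equality of
    -- dimensions. So `A` deforms to an element `A'` of that algebra, at distance of order `‖η t - η
    -- 0‖`.
    obtain ⟨A', hA', hPA⟩ : ∃ A' ∈ isotropyAlgebra G (η t), P A' = P A := by
      set R := P.domRestrict (isotropyAlgebra G (η t)) with hR
      have h2 : Function.Injective R := by
        rw [injective_iff_map_eq_zero]
        intro x hx
        have h3 := h1 x hx
        rw [show adStar G (η t) x = 0 from x.2, norm_zero, mul_zero] at h3
        exact Subtype.ext (norm_le_zero_iff.1 h3)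
      obtain ⟨A', hA'⟩ := (LinearMap.injective_iff_surjective_of_finrank_eq_finrank hdt).1 h2 (P A)
      exact ⟨A', A'.2, hA'⟩
    have h2 := h1 (A - A') (by rw [map_sub, hPA, sub_self])
    have h3 : adStar G (η t) (A - A') = adStar G (η t - η 0) A := by
      rw [map_sub, show adStar G (η t) A' = 0 from hA', adStar_sub,
        show adStar G (η 0) A = 0 from hA]
    rw [h3] at h2
    -- `A'` is isotropic for `η t` and `B` for `η 0`, so both factors can be replaced by
    -- differences, and the value is quadratic in `η t - η 0`.
    have h4 : η t (bracket G A B) = (η t - η 0) (bracket G (A - A') B) := by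
      rw [sub_apply, isotropyAlgebra_swap hB, map_sub, LinearMap.sub_apply, map_sub,
        mem_isotropyAlgebra.1 hA']
      ring
    rw [h4]
    have h5 := norm_adStar_le (G := G) (η t - η 0) A
    calc ‖(η t - η 0) (bracket G (A - A') B)‖
        ≤ ‖η t - η 0‖ * (C * ‖A - A'‖ * ‖B‖) := norm_apply_bracket_le _ _ _
      _ ≤ ‖η t - η 0‖ * (C * (2 * K * (‖η t - η 0‖ * (C * ‖A‖))) * ‖B‖) := by
          gcongr
          exact h2.trans (by gcongr)
      _ = _ := by rw [Real.norm_of_nonneg (by positivity)]; ring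
  have hδ : (fun t => ‖η t - η 0‖ * ‖η t - η 0‖) =o[𝓝 0] fun t : ℝ => t := by
    have h1 : (fun t => ‖η t - η 0‖) =O[𝓝 0] fun t : ℝ => t := by
      simpa using hη.isBigO_sub.norm_left
    have h2 : (fun t => ‖η t - η 0‖) =o[𝓝 0] fun _ : ℝ => (1 : ℝ) := by
      rw [isLittleO_one_iff]
      simpa using ((hη.continuousAt.sub (continuousAt_const (y := η 0))).norm).tendsto
    simpa using h1.mul_isLittleO h2
  have h1 : HasDerivAt (fun t => η t (bracket G A B)) 0 0 := by
    rw [hasDerivAt_iff_isLittleO]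
    have h2 := (IsBigO.of_bound _ hbound).trans_isLittleO hδ
    simpa [mem_isotropyAlgebra.1 hA] using h2
  have h2 : HasDerivAt (fun t => η t (bracket G A B)) (ζ (bracket G A B)) 0 := by
    simpa using hη.clm_apply (hasDerivAt_const (0 : ℝ) (bracket G A B))
  exact h2.unique h1

/-- A covector vanishing on the isotropy algebra of `η` is tangent to the coadjoint orbit. -/
theorem mem_range_adStar {η ζ : Dual E} (h : ∀ A ∈ isotropyAlgebra G η, ζ A = 0) :
    ζ ∈ LinearMap.range (adStar G η) := by
  have h1 : (ζ : Module.Dual ℝ E) ∈ (LinearMap.ker (adStar G η)).dualAnnihilator := by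
    rw [Submodule.mem_dualAnnihilator]; exact h
  rw [← LinearMap.range_dualMap_eq_dualAnnihilator_ker] at h1
  obtain ⟨φ, hφ⟩ := h1
  set e : (E →ₗ[ℝ] ℝ) ≃ₗ[ℝ] (E →L[ℝ] ℝ) := LinearMap.toContinuousLinearMap with he
  -- By reflexivity `φ` is evaluation at a vector `B`; skew-symmetry of the bracket then exchanges
  -- `A` and `B`, at the price of a sign.
  obtain ⟨B, hB⟩ := (Module.evalEquiv ℝ E).surjective (φ ∘ₗ e.toLinearMap)
  refine ⟨-B, ?_⟩
  ext A
  have h2 := congrArg (fun f : E →ₗ[ℝ] ℝ => f A) hφ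
  have h3 := congrArg (fun f : Module.Dual ℝ (Module.Dual ℝ E) => f (e.symm (adStar G η A))) hB
  simp only [Module.evalEquiv_apply, Module.Dual.eval_apply, LinearMap.comp_apply] at h3
  change φ (adStar G η A) = ζ A at h2
  rw [← h2]
  change adStar G η A B = φ (e (e.symm (adStar G η A))) at h3
  rw [e.apply_symm_apply] at h3
  rw [← h3, map_neg, neg_apply, adStar_apply, adStar_apply, bracket_swap, map_neg, neg_neg]

/-- The pairing induces a map from `S` to the dual of `H`: onto because the right kernel is trivial,
with kernel `N`. -/
theorem _root_.Submodule.finrank_eq_of_pairing {V H : Type*} [AddCommGroup V] [Module ℝ V]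
    [FiniteDimensional ℝ V] [AddCommGroup H] [Module ℝ H] [FiniteDimensional ℝ H]
    (S N : Submodule ℝ V) (hN : N ≤ S) (b : V →ₗ[ℝ] H →ₗ[ℝ] ℝ)
    (hb : ∀ w ∈ S, (∀ A, b w A = 0) ↔ w ∈ N) (hb' : ∀ A, (∀ w ∈ S, b w A = 0) → A = 0) :
    Module.finrank ℝ S = Module.finrank ℝ H + Module.finrank ℝ N := by
  let T : S →ₗ[ℝ] H →ₗ[ℝ] ℝ := b ∘ₗ S.subtype
  have hsurj : Function.Surjective T := by
    rw [← LinearMap.flip_injective_iff₁, injective_iff_map_eq_zero]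
    exact fun A hA => hb' A fun w hw => congrArg (fun f : S →ₗ[ℝ] ℝ => f ⟨w, hw⟩) hA
  have hker : LinearMap.ker T = N.comap S.subtype := by
    ext w
    rw [LinearMap.mem_ker, Submodule.mem_comap, Submodule.subtype_apply, ← hb w w.2]
    exact ⟨fun h A => congrArg (fun f : H →ₗ[ℝ] ℝ => f A) h, fun h => LinearMap.ext h⟩
  have h9 := T.finrank_range_add_finrank_ker
  rw [LinearMap.range_eq_top.2 hsurj, finrank_top, hker,
    (Submodule.comapSubtypeEquivOfLe hN).finrank_eq] at h9
  rw [← h9]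
  congr 1
  exact Subspace.dual_finrank_eq (K := ℝ) (V := H)

theorem bracket_bracket (A B C : E) : bracket G A (bracket G B C) =
    bracket G (bracket G A B) C + bracket G B (bracket G A C) := by
  have := lieGroup_three (E := E) G
  have : CompleteSpace E := FiniteDimensional.complete ℝ E
  exact leibniz_lie (L₁ := GroupLieAlgebra 𝓘(ℝ, E) G)
    (L₂ := GroupLieAlgebra 𝓘(ℝ, E) G) (M := GroupLieAlgebra 𝓘(ℝ, E) G) A B C

end IsotropyAlgebra

namespace InvariantLagrangian

section Phase

variable {E : Type v} [NormedAddCommGroup E] [NormedSpace ℝ E] [FiniteDimensional ℝ E]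
variable {G : Type u} [TopologicalSpace G] [ChartedSpace E G] [Group G] [LieGroup 𝓘(ℝ, E) ∞ G]
variable {𝓛 : InvariantLagrangian E} {F : Submfd.{v, w} 𝓛}

variable (F) in
/-- The chart of `𝓕` at `q`. -/
noncomputable abbrev chartF (q : F.carrier) :
    OpenPartialHomeomorph F.carrier (EuclideanSpace ℝ (Fin F.dim)) := chartAt _ q

variable (F) in
/-- The inclusion of `𝓕` in the chart at `q`. -/
noncomputable def localIncl (q : F.carrier) (u : EuclideanSpace ℝ (Fin F.dim)) : 𝓛.V :=
  F.incl ((chartF F q).symm u)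

theorem contDiffOn_localIncl (q : F.carrier) :
    ContDiffOn ℝ ∞ (localIncl F q) (chartF F q).target := by
  rw [← contMDiffOn_iff_contDiffOn]
  exact F.contMDiff_incl.comp_contMDiffOn (contMDiffOn_chart_symm (n := ∞))

theorem fderiv_localIncl (q : F.carrier) {u : EuclideanSpace ℝ (Fin F.dim)}
    (hu : u ∈ (chartF F q).target) :
    Function.Injective (fderiv ℝ (localIncl F q) u) ∧
    (fderiv ℝ (localIncl F q) u).toLinearMap.range = tangentF F ((chartF F q).symm u) := by
  have h1 := mdifferentiable_chart (I := 𝓡 F.dim) q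
  have h2 := h1.symm.mfderiv_bijective hu
  have h3 : (fderiv ℝ (localIncl F q) u : EuclideanSpace ℝ (Fin F.dim) →L[ℝ] 𝓛.V) =
      (mfderiv (𝓡 F.dim) 𝓘(ℝ, 𝓛.V) F.incl ((chartF F q).symm u)).comp
        (mfderiv (𝓡 F.dim) (𝓡 F.dim) (chartF F q).symm u) := by
    rw [← mfderiv_eq_fderiv]
    exact mfderiv_comp u (mdifferentiableAt_incl _) (h1.mdifferentiableAt_symm hu)
  constructor
  · rw [h3]
    exact (F.immersion _).comp h2.1
  · ext w
    rw [h3]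
    constructor
    · rintro ⟨a, rfl⟩
      exact ⟨mfderiv (𝓡 F.dim) (𝓡 F.dim) (chartF F q).symm u a, rfl⟩
    · rintro ⟨b, rfl⟩
      obtain ⟨a, rfl⟩ := h2.2 b
      exact ⟨a, rfl⟩

theorem exists_curve_of_mem_tangentF {p : F.carrier} {w : 𝓛.V} (hw : w ∈ tangentF F p) :
    ∃ c : ℝ → F.carrier, c 0 = p ∧ ContinuousAt c 0 ∧ HasDerivAt (fun t => F.incl (c t)) w 0 := by
  have hu : chartF F p p ∈ (chartF F p).target := mem_chart_target _ p
  have hsp : (chartF F p).symm (chartF F p p) = p := (chartF F p).left_inv (mem_chart_source _ p)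
  have h1 := (fderiv_localIncl p hu).2
  rw [hsp] at h1
  rw [← h1] at hw
  obtain ⟨a, ha⟩ := hw
  have h2 : HasDerivAt (fun t : ℝ => chartF F p p + t • a) a 0 := by
    simpa using ((hasDerivAt_id (0 : ℝ)).smul_const a).const_add (chartF F p p)
  have h0 : chartF F p p + (0 : ℝ) • a = chartF F p p := by simp
  refine ⟨fun t => (chartF F p).symm (chartF F p p + t • a), (congrArg _ h0).trans hsp, ?_, ?_⟩
  · refine ContinuousAt.comp (g := (chartF F p).symm) ?_ h2.continuousAt
    rw [h0]
    exact (chartF F p).continuousAt_symm hu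
  · have h3 : HasFDerivAt (localIncl F p) (fderiv ℝ (localIncl F p) (chartF F p p))
        (chartF F p p + (0 : ℝ) • a) := by
      rw [h0]
      exact (((contDiffOn_localIncl p).contDiffAt ((chartF F p).open_target.mem_nhds
        hu)).differentiableAt (by simp)).hasFDerivAt
    have h4 := h3.comp_hasDerivAt (0 : ℝ) h2
    exact h4.congr_deriv ha

/-- The vector `(A, 0)` lies in the kernel of `Ψ_Y`, so it is `ω(A) ξ`. Its `𝓕`-component `ω(A) Φ`
vanishes, and regularity gives `ω(A) = 0`. -/
theorem eq_zero_of_mem_isotropyAlgebra (hF : IsCoisotropic G F) {p : F.carrier}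
    (hp : IsRegularPoint G F p) {A : E} (hA : A ∈ isotropyAlgebra G (legendre p))
    (h : ∀ w ∈ tangentF F p, w.2 A = 0) : A = 0 := by
  have h2 : (A, (0 : 𝓛.V)) ∈ kerPsiY G F p := by
    refine ⟨⟨trivial, Submodule.zero_mem _⟩, fun Y hY => ?_⟩
    have h4 : (F.incl p).2 (bracket G A Y.1) = 0 := mem_isotropyAlgebra.1 hA Y.1
    rw [Psi_apply]
    simp [h _ hY.2, h4]
  have h5 := eq_smul_xi hF.nondegenerate h2
  have h6 : (0 : 𝓛.V) = 𝓛.indep A • phaseField G F p := congrArg Prod.snd h5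
  have h7 : 𝓛.indep A = 0 := (smul_eq_zero.1 h6.symm).resolve_right hp
  have h8 : A = 𝓛.indep A • (xi G F p).1 := congrArg Prod.fst h5
  rwa [h7, zero_smul] at h8

/-- Dimension count for the pairing `(w, A) ↦ w.2 A` between `T_p 𝓕` and the isotropy algebra; the
left kernel is the line tangent to the portrait. What matters later is that the dimension is the
same at all regular points. -/
theorem finrank_isotropyAlgebra (hF : IsCoisotropic G F) {p : F.carrier}
    (hp : IsRegularPoint G F p) :
    F.dim = Module.finrank ℝ (isotropyAlgebra G (legendre p)) + 1 := by
  set 𝔥 := isotropyAlgebra G (legendre p) with h𝔥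
  have h1 : Module.finrank ℝ (tangentF F p) = F.dim := by
    have h2 : Function.Injective (mfderiv (𝓡 F.dim) 𝓘(ℝ, 𝓛.V) F.incl p :
      EuclideanSpace ℝ (Fin F.dim) →L[ℝ] 𝓛.V).toLinearMap := F.immersion p
    exact (LinearMap.finrank_range_of_inj h2).trans finrank_euclideanSpace_fin
  let e : (E →L[ℝ] ℝ) →ₗ[ℝ] (E →ₗ[ℝ] ℝ) :=
    (LinearMap.toContinuousLinearMap : (E →ₗ[ℝ] ℝ) ≃ₗ[ℝ] (E →L[ℝ] ℝ)).symm.toLinearMap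
  let T0 : 𝓛.V →ₗ[ℝ] 𝔥 →ₗ[ℝ] ℝ :=
    LinearMap.lcomp ℝ ℝ 𝔥.subtype ∘ₗ e ∘ₗ LinearMap.snd ℝ 𝓛.𝔞 (Dual E)
  have h2 := (tangentF F p).finrank_eq_of_pairing (tangentPortrait G F p) inf_le_left T0
    (fun w hw => ⟨fun h => ⟨hw, mem_range_adStar fun A hA => h ⟨A, hA⟩⟩, by
      rintro ⟨-, B, hB⟩ A
      have hB : adStar G (legendre p) B = w.2 := hB
      change w.2 A = 0
      rw [← hB, adStar_apply, isotropyAlgebra_swap A.2, neg_zero]⟩)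
    (fun A hA => Subtype.ext (eq_zero_of_mem_isotropyAlgebra hF hp A.2 hA))
  rwa [h1, (sigma_smul_phaseField hF hp).1.1] at h2

/-- The isotropy algebra of the Legendre transform of a regular point is Abelian. -/
theorem bracket_eq_zero_of_isRegularPoint (hF : IsCoisotropic G F) {p : F.carrier}
    (hp : IsRegularPoint G F p) {A B : E} (hA : A ∈ isotropyAlgebra G (legendre p))
    (hB : B ∈ isotropyAlgebra G (legendre p)) : bracket G A B = 0 := by
  set 𝔥 := isotropyAlgebra G (legendre p) with h𝔥
  -- Every tangent vector of `𝓕` is the velocity of a curve, which stays regular near time `0`, so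
  -- the dimension of the isotropy algebra is constant along it.
  have h1 : ∀ w ∈ tangentF F p, w.2 (bracket G A B) = 0 := by
    intro w hw
    obtain ⟨c, hc0, hc, hcw⟩ := exists_curve_of_mem_tangentF hw
    have h2 : HasDerivAt (fun t => legendre (c t)) w.2 0 :=
      hcw.hasFDerivAt.snd.hasDerivAt.congr_deriv (by simp)
    have h3 : ∀ᶠ t in 𝓝 (0 : ℝ), IsRegularPoint G F (c t) :=
      hc.eventually ((isOpen_setOf_isRegularPoint hF).mem_nhds (by rw [hc0]; exact hp))
    refine apply_bracket_eq_zero_of_finrank_eq h2 ?_ (by rw [hc0]; exact hA) (by rw [hc0]; exact hB)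
    filter_upwards [h3] with t ht
    have h4 := finrank_isotropyAlgebra hF ht
    have h5 := finrank_isotropyAlgebra hF hp
    rw [hc0]
    omega
  -- The Jacobi identity puts the bracket back into the isotropy algebra, where the pairing with
  -- `T_p 𝓕` has no right kernel.
  refine eq_zero_of_mem_isotropyAlgebra hF hp (mem_isotropyAlgebra.2 fun C => ?_) h1
  rw [bracket_swap, bracket_bracket, map_neg, map_add, isotropyAlgebra_swap hB,
    mem_isotropyAlgebra.1 hA, add_zero, neg_zero]

theorem bracket_eq_zero_of_moment (hF : IsCoisotropic G F) {μ : Dual E}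
    (hμ : ∃ (g : G) (p : F.carrier), IsRegularPoint G F p ∧ moment g p = μ) {A B : E}
    (hA : A ∈ isotropyAlgebra G μ) (hB : B ∈ isotropyAlgebra G μ) : bracket G A B = 0 := by
  obtain ⟨g, p, hp, rfl⟩ := hμ
  rw [← Ad_Ad_inv g A] at hA ⊢
  rw [← Ad_Ad_inv g B] at hB ⊢
  rw [← Ad_bracket, bracket_eq_zero_of_isRegularPoint hF hp (Ad_mem_isotropyAlgebra.1 hA)
    (Ad_mem_isotropyAlgebra.1 hB), map_zero]

end Phase

end InvariantLagrangian

end CoisotropicProblem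

/-! ### The flow of the phase field and conservation of the moment map. -/

namespace CoisotropicProblem

open Filter

namespace InvariantLagrangian

section Flow

variable {E : Type v} [NormedAddCommGroup E] [NormedSpace ℝ E] [FiniteDimensional ℝ E]
variable {G : Type u} [TopologicalSpace G] [ChartedSpace E G] [Group G] [LieGroup 𝓘(ℝ, E) ∞ G]
variable {𝓛 : InvariantLagrangian E} {F : Submfd.{v, w} 𝓛}
variable {W : Type*} [NormedAddCommGroup W] [NormedSpace ℝ W]

theorem contDiffOn_incl {p : W → F.carrier} {s : Set W}
    (hp : ContMDiffOn 𝓘(ℝ, W) (𝓡 F.dim) ∞ p s) : ContDiffOn ℝ ∞ (fun r => F.incl (p r)) s := by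
  rw [← contMDiffOn_iff_contDiffOn]
  exact F.contMDiff_incl.comp_contMDiffOn hp

theorem contDiffOn_legendre {p : W → F.carrier} {s : Set W}
    (hp : ContMDiffOn 𝓘(ℝ, W) (𝓡 F.dim) ∞ p s) : ContDiffOn ℝ ∞ (fun r => legendre (p r)) s :=
  contDiff_snd.comp_contDiffOn (contDiffOn_incl hp)

theorem contDiffOn_ham {p : W → F.carrier} {s : Set W}
    (hp : ContMDiffOn 𝓘(ℝ, W) (𝓡 F.dim) ∞ p s) : ContDiffOn ℝ ∞ (fun r => ham (p r)) s :=
  contDiffOn_const.add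
    (𝓛.𝔞.subtypeL.contDiff.comp_contDiffOn (contDiff_fst.comp_contDiffOn (contDiffOn_incl hp)))

theorem hasDerivAt_incl {p : ℝ → F.carrier} {s : Set ℝ} (hs : IsOpen s)
    (hp : ContMDiffOn 𝓘(ℝ, ℝ) (𝓡 F.dim) ∞ p s) {t : ℝ} (ht : t ∈ s) :
    HasDerivAt (fun r => F.incl (p r)) (velF p t) t :=
  (((contDiffOn_incl hp).contDiffAt (hs.mem_nhds ht)).differentiableAt (by simp)).hasDerivAt

theorem hasDerivAt_legendre {p : ℝ → F.carrier} {s : Set ℝ} (hs : IsOpen s)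
    (hp : ContMDiffOn 𝓘(ℝ, ℝ) (𝓡 F.dim) ∞ p s) {t : ℝ} (ht : t ∈ s) :
    HasDerivAt (fun r => legendre (p r)) (velF p t).2 t :=
  (hasDerivAt_incl hs hp ht).hasFDerivAt.snd.hasDerivAt.congr_deriv (by simp)

theorem contDiffOn_velF {p : ℝ → F.carrier} {s : Set ℝ} (hs : IsOpen s)
    (hp : ContMDiffOn 𝓘(ℝ, ℝ) (𝓡 F.dim) ∞ p s) : ContDiffOn ℝ ∞ (velF p) s :=
  (contDiffOn_incl hp).deriv_of_isOpen hs (by simp)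

theorem velF_congr {p q : ℝ → F.carrier} {t : ℝ} (h : p =ᶠ[𝓝 t] q) : velF p t = velF q t :=
  (h.fun_comp F.incl).deriv_eq

/-- The phase field is smooth in the charts of `𝓕`. -/
theorem exists_localPhaseField (hF : IsCoisotropic G F) (q : F.carrier) :
    ∃ O ⊆ (chartF F q).target, IsOpen O ∧ chartF F q q ∈ O ∧
      ∃ X : EuclideanSpace ℝ (Fin F.dim) → EuclideanSpace ℝ (Fin F.dim), ContDiffOn ℝ ∞ X O ∧
        ∀ u ∈ O, fderiv ℝ (localIncl F q) u (X u) = phaseField G F ((chartF F q).symm u) := by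
  have hT := (chartF F q).open_target
  have hq : chartF F q q ∈ (chartF F q).target := mem_chart_target _ q
  have hsm : ContMDiffOn (𝓡 F.dim) (𝓡 F.dim) ∞ (chartF F q).symm (chartF F q).target :=
    contMDiffOn_chart_symm
  let D : EuclideanSpace ℝ (Fin F.dim) → EuclideanSpace ℝ (Fin F.dim) →L[ℝ] Dual E := fun u =>
    (ContinuousLinearMap.snd ℝ 𝓛.𝔞 (Dual E)).comp (fderiv ℝ (localIncl F q) u)
  have hDs : ContDiffOn ℝ ∞ D (chartF F q).target := contDiffOn_const.clm_comp
    ((contDiffOn_localIncl q).fderiv_of_isOpen hT (by simp))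
  have hD : Function.Injective (D (chartF F q q)) := by
    rw [injective_iff_map_eq_zero]
    intro w hw
    have h1 := fderiv_localIncl q hq
    have h2 := eq_zero_of_snd_eq_zero (G := G) hF.nondegenerate (w := fderiv ℝ (localIncl F q) _ w)
      (by rw [← h1.2]; exact ⟨w, rfl⟩) hw
    exact (injective_iff_map_eq_zero _).1 h1.1 w h2
  -- A left inverse of the differential of the Legendre transform at the centre keeps `R ∘ D u`
  -- invertible nearby. As `Φ` is already known to be tangent, its preimage is `(R D)⁻¹ R g`, a
  -- smooth expression in `g = -ad*(𝓗) η`.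
  obtain ⟨R₀, hR₀⟩ := (D (chartF F q q)).toLinearMap.exists_leftInverse_of_injective
    (LinearMap.ker_eq_bot.2 hD)
  let R : Dual E →L[ℝ] EuclideanSpace ℝ (Fin F.dim) := LinearMap.toContinuousLinearMap R₀
  let A : EuclideanSpace ℝ (Fin F.dim) →
    EuclideanSpace ℝ (Fin F.dim) →L[ℝ] EuclideanSpace ℝ (Fin F.dim) := fun u => R.comp (D u)
  have hA : ContDiffOn ℝ ∞ A (chartF F q).target := contDiffOn_const.clm_comp hDs
  have hA1 : A (chartF F q q) = 1 :=
    ContinuousLinearMap.ext fun x => congrArg (fun f : _ →ₗ[ℝ] _ => f x) hR₀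
  let g : EuclideanSpace ℝ (Fin F.dim) → Dual E := fun u =>
    -adStar G (legendre ((chartF F q).symm u)) (ham ((chartF F q).symm u))
  have hg : ContDiffOn ℝ ∞ g (chartF F q).target :=
    ((contDiff_adStar (E := E) (G := G)).comp_contDiffOn
      ((contDiffOn_legendre hsm).prodMk (contDiffOn_ham hsm))).neg
  refine ⟨(chartF F q).target ∩ A ⁻¹' {B | IsUnit B}, inter_subset_left,
    hA.continuousOn.isOpen_inter_preimage hT Units.isOpen, ⟨hq, ?_⟩,
    fun u => Ring.inverse (A u) (R (g u)), ?_, ?_⟩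
  · rw [mem_preimage, hA1]; exact isUnit_one
  · rintro u ⟨hu, hu'⟩
    obtain ⟨B, hB⟩ := hu'
    have h1 : ContDiffAt ℝ ∞ Ring.inverse (A u) := hB ▸ contDiffAt_ringInverse ℝ B
    have h2 := h1.comp u (hA.contDiffAt (hT.mem_nhds hu))
    exact (h2.clm_apply (R.contDiff.contDiffAt.comp u
      (hg.contDiffAt (hT.mem_nhds hu)))).contDiffWithinAt
  · rintro u ⟨hu, hu'⟩
    have h1 := phaseField_mem_tangentF hF.nondegenerate ((chartF F q).symm u)
    rw [← (fderiv_localIncl q hu).2] at h1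
    obtain ⟨w, hw⟩ := h1
    have hw : fderiv ℝ (localIncl F q) u w = phaseField G F ((chartF F q).symm u) := hw
    have h2 : D u w = g u := (congrArg Prod.snd hw).trans (phaseField_snd hF _)
    have h3 : Ring.inverse (A u) (R (g u)) = w := by
      rw [← h2]
      change (Ring.inverse (A u) * A u) w = w
      rw [Ring.inverse_mul_cancel _ hu']
      rfl
    exact (congrArg (fderiv ℝ (localIncl F q) u) h3).trans hw

/-- The flow of the phase field. -/
theorem exists_phaseFlow (hF : IsCoisotropic G F) (q : F.carrier) :
    ∃ ε > (0 : ℝ), ∃ c : ℝ → F.carrier, c 0 = q ∧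
      ContMDiffOn 𝓘(ℝ, ℝ) (𝓡 F.dim) ∞ c (Ioo (-ε) ε) ∧
      ∀ t ∈ Ioo (-ε) ε, velF c t = phaseField G F (c t) := by
  obtain ⟨O, hOT, hO, hqO, X, hX, hXΦ⟩ := exists_localPhaseField hF q
  obtain ⟨ε, hε, x, hx0, hxs, hx⟩ := exists_contDiffOn_integralCurve hO hX hqO 0
  rw [zero_sub, zero_add] at hxs hx
  refine ⟨ε, hε, fun t => (chartF F q).symm (x t), ?_, ?_, fun t ht => ?_⟩
  · simp only [hx0]
    exact (chartF F q).left_inv (mem_chart_source _ q)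
  · exact ContMDiffOn.comp (contMDiffOn_chart_symm (n := ∞)) hxs.contMDiffOn
      fun t ht => hOT (hx t ht).1
  · rw [← hXΦ _ (hx t ht).1]
    have h1 : HasFDerivAt (localIncl F q) (fderiv ℝ (localIncl F q) (x t)) (x t) :=
      (((contDiffOn_localIncl q).contDiffAt ((chartF F q).open_target.mem_nhds
        (hOT (hx t ht).1))).differentiableAt (by simp)).hasFDerivAt
    exact (h1.comp_hasDerivAt t (hx t ht).2).deriv

/-- The derivative of the moment is `Ad*(h)` applied to the expression assumed to vanish. This
serves integral curves of `ξ` as well as lifts of portrait curves of arbitrary speed. -/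
theorem moment_eq_of_velF_add_eq_zero {s : Set ℝ} (hs : IsOpenInterval s) {h : ℝ → G}
    {p : ℝ → F.carrier} (hhp : IsSmoothCurve s h p)
    (hv : ∀ t ∈ s, (velF p t).2 + adStar G (legendre (p t)) (velG h t) = 0) {t₀ t : ℝ}
    (ht₀ : t₀ ∈ s) (ht : t ∈ s) : moment (h t) (p t) = moment (h t₀) (p t₀) := by
  have h1 : ∀ t ∈ s, HasDerivAt (fun r => moment (h r) (p r)) 0 t := by
    intro t ht
    refine (hasDerivAt_coAd hs.1 hhp.1 ht (hasDerivAt_legendre hs.1 hhp.2 ht)).congr_deriv ?_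
    rw [hv t ht]
    exact ContinuousLinearMap.zero_comp _
  exact hs.1.is_const_of_deriv_eq_zero hs.2.1.isPreconnected
    (fun t ht => (h1 t ht).differentiableAt.differentiableWithinAt) (fun t ht => (h1 t ht).deriv)
    ht ht₀

/-- Near a regular point, the points of a piece of the coadjoint orbit that lie in `𝓕` are
distinguished by a linear functional. -/
theorem exists_nhds_eq_of_apply_eq (hF : IsCoisotropic G F) {q : F.carrier}
    (hq : IsRegularPoint G F q) {ℓ : 𝓛.V →L[ℝ] ℝ} (hℓ : ℓ (phaseField G F q) = 1) :
    ∃ U ∈ 𝓝 q, ∃ N ∈ 𝓝 (1 : G), ∀ p₁ ∈ U, ∀ p₂ ∈ U, ∀ g₁ ∈ N, ∀ g₂ ∈ N,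
      legendre p₁ = coAd g₁ (legendre q) → legendre p₂ = coAd g₂ (legendre q) →
      ℓ (F.incl p₁) = ℓ (F.incl p₂) → p₁ = p₂ := by
  set 𝔥 := isotropyAlgebra G (legendre q) with h𝔥
  obtain ⟨ψ, hψ, hψ0, hψd, hψH, -⟩ := exists_subgroup_parametrization 𝔥
    (isotropySubgroup G (legendre q)) (fun A hA t => coAd_oneParam hA t)
  obtain ⟨𝔪, h𝔪⟩ := 𝔥.exists_isCompl
  have hT := (chartF F q).open_target
  have hqT : chartF F q q ∈ (chartF F q).target := mem_chart_target _ q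
  have hsq : (chartF F q).symm (chartF F q q) = q := (chartF F q).left_inv (mem_chart_source _ q)
  set u₀ := chartF F q q with hu₀
  have hι : HasStrictFDerivAt (localIncl F q) (fderiv ℝ (localIncl F q) u₀) u₀ :=
    ((contDiffOn_localIncl q).contDiffAt (hT.mem_nhds hqT)).hasStrictFDerivAt (by simp)
  set D := fderiv ℝ (localIncl F q) u₀ with hD
  -- The first component vanishes where a point of `𝓕` meets the slice of the orbit; the second
  -- separates the points along the direction of `Φ`.
  let S : EuclideanSpace ℝ (Fin F.dim) × 𝔪 → Dual E × ℝ := fun z =>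
    ((localIncl F q z.1).2 - coAd (chartCurve G (z.2 : E) : G) (legendre q), ℓ (localIncl F q z.1))
  let S' : EuclideanSpace ℝ (Fin F.dim) × 𝔪 →L[ℝ] Dual E × ℝ :=
    ((((ContinuousLinearMap.snd ℝ 𝓛.𝔞 (Dual E)).comp D).comp (ContinuousLinearMap.fst ℝ _ _)) -
      (((LinearMap.toContinuousLinearMap (adStar G (legendre q))).comp 𝔪.subtypeL).comp
        (ContinuousLinearMap.snd ℝ _ _))).prod ((ℓ.comp D).comp (ContinuousLinearMap.fst ℝ _ _))
  have h1 : HasStrictFDerivAt (fun z : EuclideanSpace ℝ (Fin F.dim) × 𝔪 => localIncl F q z.1)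
      (D.comp (ContinuousLinearMap.fst ℝ _ _)) (u₀, 0) :=
    HasStrictFDerivAt.comp (g := localIncl F q) (f := Prod.fst) (u₀, (0 : 𝔪)) hι hasStrictFDerivAt_fst
  have h2 : HasStrictFDerivAt (fun m : 𝔪 => coAd (chartCurve G (m : E) : G) (legendre q))
      ((LinearMap.toContinuousLinearMap (adStar G (legendre q))).comp 𝔪.subtypeL) 0 :=
    HasStrictFDerivAt.comp (g := fun m : E => coAd (chartCurve G m : G) (legendre q)) (0 : 𝔪)
      (hasStrictFDerivAt_coAd_chartCurve (legendre q)) 𝔪.subtypeL.hasStrictFDerivAt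
  have h3 : HasStrictFDerivAt (fun z : EuclideanSpace ℝ (Fin F.dim) × 𝔪 =>
      coAd (chartCurve G (z.2 : E) : G) (legendre q))
      (((LinearMap.toContinuousLinearMap (adStar G (legendre q))).comp 𝔪.subtypeL).comp
        (ContinuousLinearMap.snd ℝ _ _)) (u₀, 0) :=
    HasStrictFDerivAt.comp (f := Prod.snd) (u₀, (0 : 𝔪)) h2 hasStrictFDerivAt_snd
  have hS : HasStrictFDerivAt S S' (u₀, 0) :=
    (((ContinuousLinearMap.snd ℝ 𝓛.𝔞 (Dual E)).hasStrictFDerivAt.comp (u₀, (0 : 𝔪)) h1).sub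
      h3).prodMk (ℓ.hasStrictFDerivAt.comp (u₀, (0 : 𝔪)) h1)
  have hι' := fderiv_localIncl q hqT
  rw [hsq] at hι'
  -- A kernel vector is tangent to both `𝓕` and the orbit, hence is `c Φ`; since `ℓ Φ = 1`, `c = 0`.
  -- The slice component then vanishes too.
  have hinj : Function.Injective S' := by
    rw [injective_iff_map_eq_zero]
    rintro ⟨w, m⟩ hwm
    have h4 : (D w).2 - adStar G (legendre q) m = 0 := congrArg Prod.fst hwm
    have h5 : ℓ (D w) = 0 := congrArg Prod.snd hwm
    have h6 : D w ∈ tangentPortrait G F q :=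
      ⟨by rw [← hι'.2]; exact ⟨w, rfl⟩, m, (sub_eq_zero.1 h4).symm⟩
    obtain ⟨c, hc⟩ := exists_eq_smul_phaseField hF hq h6
    rw [hc, map_smul, hℓ, smul_eq_mul, mul_one] at h5
    rw [h5, zero_smul] at hc
    have hw : w = 0 := (injective_iff_map_eq_zero D).1 hι'.1 w hc
    rw [hc, Prod.snd_zero, zero_sub, neg_eq_zero] at h4
    have hm : m = 0 := Subtype.ext (Submodule.disjoint_def.1 h𝔪.symm.disjoint m m.2 h4)
    rw [hw, hm]; rfl
  obtain ⟨M, hM, hMi⟩ := hS.exists_mem_nhds_injOn hinj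
  obtain ⟨M₁, hM₁, M₂, hM₂, hMM⟩ := mem_nhds_prod_iff.1 hM
  have h7 := eventually_exists_chartCurve_mul h𝔪.symm hψ hψ0 hψd hM₂
  refine ⟨(chartF F q).source ∩ chartF F q ⁻¹' M₁, inter_mem (chart_source_mem_nhds _ q)
    (((chartF F q).continuousAt (mem_chart_source _ q)).preimage_mem_nhds hM₁), _, h7, ?_⟩
  rintro p₁ ⟨hp₁, hp₁'⟩ p₂ ⟨hp₂, hp₂'⟩ g₁ ⟨m₁, hm₁, a₁, rfl⟩ g₂ ⟨m₂, hm₂, a₂, rfl⟩ hg₁ hg₂ he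
  rw [coAd_mul, show coAd (ψ a₁) (legendre q) = legendre q from hψH a₁] at hg₁
  rw [coAd_mul, show coAd (ψ a₂) (legendre q) = legendre q from hψH a₂] at hg₂
  have h8 : ∀ p ∈ (chartF F q).source, localIncl F q (chartF F q p) = F.incl p := fun p hp =>
    congrArg F.incl ((chartF F q).left_inv hp)
  have h9 : S (chartF F q p₁, m₁) = S (chartF F q p₂, m₂) := by
    simp only [S, h8 _ hp₁, h8 _ hp₂, he]
    change (legendre p₁ - _, _) = (legendre p₂ - _, _)
    rw [hg₁, hg₂, sub_self, sub_self]
  have h10 := hMi (hMM (mk_mem_prod hp₁' hm₁)) (hMM (mk_mem_prod hp₂' hm₂)) h9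
  exact (chartF F q).injOn hp₁ hp₂ (congrArg Prod.fst h10)

end Flow

end InvariantLagrangian

end CoisotropicProblem

/-! ### The topology of the orbit and of the phase portrait. -/

namespace CoisotropicProblem

open Filter

section Orbit

variable {E : Type v} [NormedAddCommGroup E] [NormedSpace ℝ E] [FiniteDimensional ℝ E]
variable {G : Type u} [TopologicalSpace G] [ChartedSpace E G] [Group G] [LieGroup 𝓘(ℝ, E) ∞ G]

/-- The orbit map `G → 𝓞(μ)`. -/
noncomputable def orbitMap (μ : Dual E) (g : G) : CoadjointOrbit G μ :=
  Set.rangeFactorization (fun g : G => coAd g μ) g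

theorem continuous_orbitMap (μ : Dual E) : Continuous (orbitMap (G := G) μ) :=
  continuous_coinduced_rng

/-- Openness is tested in `G`: if `Ad*(g') μ = Ad*(g) η` with `g ∈ N`, then `Ad*(k) μ = Ad*(k g'⁻¹
g) η`, and `k g'⁻¹ g` stays in `N` for `k` near `g'`. -/
theorem isOpen_setOf_coAd (μ η : Dual E) {N : Set G} (hN : IsOpen N) :
    IsOpen {z : CoadjointOrbit G μ | ∃ g ∈ N, z.1 = coAd g η} := by
  have : IsTopologicalGroup G := topologicalGroup_of_lieGroup (E := E) 𝓘(ℝ, E) ∞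
  refine isOpen_coinduced.2 (isOpen_iff_mem_nhds.2 ?_)
  rintro g' ⟨g, hg, hgg⟩
  have hgg : coAd g' μ = coAd g η := hgg
  have h1 : Tendsto (fun k : G => k * g'⁻¹ * g) (𝓝 g') (𝓝 (g' * g'⁻¹ * g)) :=
    Continuous.tendsto (by fun_prop) _
  rw [mul_inv_cancel, one_mul] at h1
  filter_upwards [h1.eventually (hN.mem_nhds hg)] with k hk
  refine ⟨_, hk, ?_⟩
  change coAd k μ = _
  rw [coAd_mul, ← hgg, ← coAd_mul, inv_mul_cancel_right]

end Orbit

namespace InvariantLagrangian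

section Portrait

variable {E : Type v} [NormedAddCommGroup E] [NormedSpace ℝ E] [FiniteDimensional ℝ E]
variable {G : Type u} [TopologicalSpace G] [ChartedSpace E G] [Group G] [LieGroup 𝓘(ℝ, E) ∞ G]
variable {𝓛 : InvariantLagrangian E} {F : Submfd.{v, w} 𝓛} {μ : Dual E}

theorem isOpenInterval_Ioo {a b : ℝ} (h : a < b) : IsOpenInterval (Ioo a b) :=
  ⟨isOpen_Ioo, ordConnected_Ioo, nonempty_Ioo.2 h⟩

/-- The phase portrait is parametrized, near each of its points, by the flow of the phase field. -/
theorem exists_portraitFlow (hF : IsCoisotropic G F) (x : PhasePortrait G F μ) :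
    ∃ ε > (0 : ℝ), ∃ c : ℝ → PhasePortrait G F μ, c 0 = x ∧
      ContMDiffOn 𝓘(ℝ, ℝ) (𝓡 F.dim) ∞ (fun t => (c t).pt) (Ioo (-ε) ε) ∧
      (∀ t ∈ Ioo (-ε) ε, velF (fun t => (c t).pt) t = phaseField G F (c t).pt) ∧
      Topology.IsOpenEmbedding ((Ioo (-ε) ε).domRestrict c) := by
  have : IsTopologicalGroup G := topologicalGroup_of_lieGroup (E := E) 𝓘(ℝ, E) ∞
  obtain ⟨⟨q, ⟨ζ, g₀, hg₀⟩⟩, hq, hqζ⟩ := x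
  change IsRegularPoint G F q at hq
  change legendre q = ζ at hqζ
  subst hqζ
  change coAd g₀ μ = legendre q at hg₀
  obtain ⟨ε₀, hε₀, c, hc0, hcs, hcv⟩ := exists_phaseFlow hF q
  have hI₀ := isOpenInterval_Ioo (neg_lt_self hε₀)
  have h0 : (0 : ℝ) ∈ Ioo (-ε₀) ε₀ := ⟨neg_lt_zero.2 hε₀, hε₀⟩
  -- Completing `c` to an integral curve `(h, c)` of `ξ` keeps the moment constant, so `c` stays in
  -- the orbit and `h⁻¹` lifts it continuously to `G`.
  obtain ⟨h, hhs, hh0, hhv⟩ := exists_velG_eq hI₀.1 hI₀.2.1.isPreconnected (contDiffOn_ham hcs) h0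
    (1 : G)
  have hmom : ∀ t ∈ Ioo (-ε₀) ε₀, legendre (c t) = coAd (h t)⁻¹ (legendre q) := by
    intro t ht
    have h1 := moment_eq_of_velF_add_eq_zero hI₀ ⟨hhs, hcs⟩ (fun t ht => by
      rw [hcv t ht, hhv t ht, phaseField_snd hF, neg_add_cancel]) h0 ht
    rw [moment, moment, hh0, coAd_one, hc0] at h1
    exact (coAd_eq_iff _ _ _).1 h1
  obtain ⟨ℓ, hℓ⟩ := SeparatingDual.exists_eq_one (R := ℝ) (V := 𝓛.V) hq
  obtain ⟨U, hU, N, hN, hUN⟩ := exists_nhds_eq_of_apply_eq hF hq hℓ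
  obtain ⟨U', hU'U, hU'o, hqU'⟩ := mem_nhds_iff.1 hU
  obtain ⟨N', hN'N, hN'o, h1N'⟩ := mem_nhds_iff.1 hN
  have hcc : ContinuousAt c 0 := hcs.continuousOn.continuousAt (hI₀.1.mem_nhds h0)
  have hhc : ContinuousAt h 0 := hhs.continuousOn.continuousAt (hI₀.1.mem_nhds h0)
  have hev : ∀ᶠ t in 𝓝 (0 : ℝ), t ∈ Ioo (-ε₀) ε₀ ∧ c t ∈ U' ∧ (h t)⁻¹ ∈ N' ∧
      IsRegularPoint G F (c t) ∧ 0 < ℓ (velF c t) := by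
    refine (hI₀.1.eventually_mem h0).and ?_
    refine (hcc.eventually (hU'o.mem_nhds (by rwa [hc0]))).and
      ((hhc.inv.eventually (hN'o.mem_nhds (by simpa [hh0] using h1N'))).and
      ((hcc.eventually ((isOpen_setOf_isRegularPoint hF).mem_nhds (by rw [hc0]; exact hq))).and ?_))
    have h1 : ContinuousAt (fun t => ℓ (velF c t)) 0 := ℓ.continuous.continuousAt.comp
      ((contDiffOn_velF hI₀.1 hcs).continuousOn.continuousAt (hI₀.1.mem_nhds h0))
    refine h1.eventually (lt_mem_nhds ?_)
    change 0 < ℓ (velF c 0)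
    rw [hcv 0 h0, hc0, hℓ]
    exact one_pos
  obtain ⟨ε, hε, hεev⟩ := Metric.eventually_nhds_iff.1 hev
  have hev : ∀ t ∈ Ioo (-ε) ε, t ∈ Ioo (-ε₀) ε₀ ∧ c t ∈ U' ∧ (h t)⁻¹ ∈ N' ∧
      IsRegularPoint G F (c t) ∧ 0 < ℓ (velF c t) := fun t ht =>
    hεev (by rw [Real.dist_eq, sub_zero]; exact abs_lt.2 ht)
  have hsub : Ioo (-ε) ε ⊆ Ioo (-ε₀) ε₀ := fun t ht => (hev t ht).1
  have h0ε : (0 : ℝ) ∈ Ioo (-ε) ε := ⟨neg_lt_zero.2 hε, hε⟩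
  -- The functional `ℓ` is strictly increasing along the flow, so it serves as a coordinate.
  set f : ℝ → ℝ := fun t => ℓ (F.incl (c t)) with hf
  have hfs : ContDiffOn ℝ ∞ f (Ioo (-ε) ε) :=
    ℓ.contDiff.comp_contDiffOn (contDiffOn_incl (hcs.mono hsub))
  have hfd : ∀ t ∈ Ioo (-ε) ε, HasDerivAt f (ℓ (velF c t)) t := fun t ht =>
    ℓ.hasFDerivAt.comp_hasDerivAt t (hasDerivAt_incl hI₀.1 hcs (hsub ht))
  have hfmono : StrictMonoOn f (Ioo (-ε) ε) := by
    refine strictMonoOn_of_deriv_pos (convex_Ioo _ _) hfs.continuousOn fun t ht => ?_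
    rw [interior_Ioo] at ht
    rw [(hfd t ht).deriv]
    exact (hev t ht).2.2.2.2
  have hfopen : ∀ J ⊆ Ioo (-ε) ε, IsOpen J → IsOpen (f '' J) := by
    intro J hJ hJo
    refine isOpen_iff_mem_nhds.2 ?_
    rintro _ ⟨t, ht, rfl⟩
    have h1 : HasStrictDerivAt f (ℓ (velF c t)) t :=
      (hfs.contDiffAt (isOpen_Ioo.mem_nhds (hJ ht))).hasStrictDerivAt' (hfd t (hJ ht)) (by simp)
    rw [← h1.map_nhds_eq (hev t (hJ ht)).2.2.2.2.ne']
    exact image_mem_map (hJo.mem_nhds ht)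
  have hlift : ∀ t ∈ Ioo (-ε) ε, legendre (c t) = (orbitMap (G := G) μ ((h t)⁻¹ * g₀)).1 := by
    intro t ht
    change _ = coAd _ μ
    rw [coAd_mul, hg₀, hmom t (hsub ht)]
  classical
  let x : PhasePortrait G F μ := ⟨(q, ⟨legendre q, g₀, hg₀⟩), hq, rfl⟩
  let C : ℝ → PhasePortrait G F μ := fun t => if ht : t ∈ Ioo (-ε) ε then
    ⟨(c t, orbitMap μ ((h t)⁻¹ * g₀)), (hev t ht).2.2.2.1, hlift t ht⟩ else x
  have hC : ∀ t (ht : t ∈ Ioo (-ε) ε), C t =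
      ⟨(c t, orbitMap μ ((h t)⁻¹ * g₀)), (hev t ht).2.2.2.1, hlift t ht⟩ := fun t ht => dif_pos ht
  have hCpt : ∀ t ∈ Ioo (-ε) ε, (C t).pt = c t := fun t ht => by rw [hC t ht]; rfl
  have hmem : ∀ t ∈ Ioo (-ε) ε, (fun t => (C t).pt) =ᶠ[𝓝 t] c := fun t ht => by
    filter_upwards [isOpen_Ioo.mem_nhds ht] with r hr using hCpt r hr
  refine ⟨ε, hε, C, ?_, (hcs.mono hsub).congr hCpt, fun t ht => ?_, ?_⟩
  · rw [hC 0 h0ε]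
    refine Subtype.ext (Prod.ext hc0 (Subtype.ext ?_))
    change coAd _ μ = legendre q
    rw [hh0, inv_one, one_mul, hg₀]
  · rw [velF_congr (hmem t ht), hcv t (hsub ht), hCpt t ht]
  · refine Topology.IsOpenEmbedding.of_continuous_injective_isOpenMap ?_ ?_ ?_
    · have h1 : (Ioo (-ε) ε).domRestrict C = fun t : Ioo (-ε) ε =>
          ⟨(c t, orbitMap μ ((h t)⁻¹ * g₀)), (hev t t.2).2.2.2.1, hlift t t.2⟩ :=
        funext fun t => hC t t.2
      rw [h1]
      have h2 : Continuous fun t : Ioo (-ε) ε => c t :=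
        (hcs.continuousOn.mono hsub).domRestrict
      have h3 : Continuous fun t : Ioo (-ε) ε => h t :=
        (hhs.continuousOn.mono hsub).domRestrict
      exact (h2.prodMk ((continuous_orbitMap μ).comp (h3.inv.mul continuous_const))).subtype_mk _
    · intro t t' htt
      have h1 : c t = c t' := by
        rw [← hCpt t t.2, ← hCpt t' t'.2]
        exact congrArg PhasePortrait.pt htt
      exact Subtype.ext (hfmono.injOn t.2 t'.2 (congrArg (fun p => ℓ (F.incl p)) h1))
    · intro V hV
      have hVo : IsOpen (Subtype.val '' V : Set ℝ) := isOpen_Ioo.isOpenMap_subtype_val V hV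
      have hVI : (Subtype.val '' V : Set ℝ) ⊆ Ioo (-ε) ε := by
        rintro _ ⟨t, -, rfl⟩; exact t.2
      -- A portrait point near `q`, near in the orbit topology as well, is determined by its value
      -- of `ℓ`. Hence the image of `V` is cut out by three open conditions.
      have h1 : (Ioo (-ε) ε).domRestrict C '' V = {y : PhasePortrait G F μ | y.1.1 ∈ U' ∧
          (∃ g ∈ N', y.1.2.1 = coAd g (legendre q)) ∧
          ℓ (F.incl y.1.1) ∈ f '' (Subtype.val '' V)} := by
        ext y
        constructor
        · rintro ⟨t, ht, rfl⟩
          change (C t).1.1 ∈ U' ∧ (∃ g ∈ N', (C t).1.2.1 = coAd g (legendre q)) ∧ ℓ (F.incl (C t).1.1) ∈ _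
          rw [hC t t.2]
          exact ⟨(hev t t.2).2.1, ⟨_, (hev t t.2).2.2.1, by
            rw [← hlift t t.2, hmom t (hsub t.2)]⟩, t, ⟨t, ht, rfl⟩, rfl⟩
        · rintro ⟨hyU, ⟨g, hg, hyg⟩, _, ⟨t, ht, rfl⟩, hyt⟩
          refine ⟨t, ht, ?_⟩
          have h2 : c t = y.1.1 := hUN _ (hU'U (hev t t.2).2.1) _ (hU'U hyU) _
            (hN'N (hev t t.2).2.2.1) _ (hN'N hg) (hmom t (hsub t.2)) (y.2.2.trans hyg) hyt
          change C t = y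
          rw [hC t t.2]
          exact Subtype.ext (Prod.ext h2 (Subtype.ext
            ((hlift t t.2).symm.trans ((congrArg legendre h2).trans y.2.2))))
      rw [h1]
      have h2 : Continuous fun y : PhasePortrait G F μ => y.1.1 :=
        continuous_fst.comp continuous_subtype_val
      have h3 : Continuous fun y : PhasePortrait G F μ => y.1.2 :=
        continuous_snd.comp continuous_subtype_val
      exact (hU'o.preimage h2).inter (((isOpen_setOf_coAd μ (legendre q) hN'o).preimage h3).inter
        ((hfopen _ hVI hVo).preimage (ℓ.continuous.comp (F.contMDiff_incl.continuous.comp h2))))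

end Portrait

end InvariantLagrangian

end CoisotropicProblem

/-! ### The connection on the reduced fibration and its horizontal curves. -/

namespace CoisotropicProblem

open Filter

namespace InvariantLagrangian

section Fibration

variable {E : Type v} [NormedAddCommGroup E] [NormedSpace ℝ E] [FiniteDimensional ℝ E]
variable {G : Type u} [TopologicalSpace G] [ChartedSpace E G] [Group G] [LieGroup 𝓘(ℝ, E) ∞ G]
variable {𝓛 : InvariantLagrangian E} {F : Submfd.{v, w} 𝓛} {μ : Dual E}

theorem PhasePortrait.isRegularPoint (x : PhasePortrait G F μ) : IsRegularPoint G F x.pt := x.2.1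

theorem PhasePortrait.legendre_pt (x : PhasePortrait G F μ) : legendre x.pt = x.1.2.1 := x.2.2

theorem PhasePortrait.ext_pt {x y : PhasePortrait G F μ} (h : x.pt = y.pt) : x = y :=
  Subtype.ext (Prod.ext h (Subtype.ext
    (x.legendre_pt.symm.trans ((congrArg legendre h).trans y.legendre_pt))))

/-- The velocity of a smooth curve in the phase portrait is tangent to the phase portrait. -/
theorem velF_mem_tangentPortrait (hF : IsCoisotropic G F) {s : Set ℝ} (hs : IsOpen s)
    {p : ℝ → F.carrier} (hp : ContMDiffOn 𝓘(ℝ, ℝ) (𝓡 F.dim) ∞ p s) {x : s → PhasePortrait G F μ}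
    (hx : Continuous x) (hxp : ∀ t, (x t).pt = p t) {t : ℝ} (ht : t ∈ s) :
    velF p t ∈ tangentPortrait G F (p t) := by
  classical
  set y := x ⟨t, ht⟩ with hy
  obtain ⟨ε, hε, c, hc0, hcs, hcv, hce⟩ := exists_portraitFlow hF y
  have h0 : (0 : ℝ) ∈ Ioo (-ε) ε := ⟨neg_lt_zero.2 hε, hε⟩
  let X : ℝ → PhasePortrait G F μ := fun r => if hr : r ∈ s then x ⟨r, hr⟩ else y
  have hX : ∀ r (hr : r ∈ s), X r = x ⟨r, hr⟩ := fun r hr => dif_pos hr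
  have hXc : ContinuousAt X t := by
    have h1 : s.domRestrict X = x := funext fun r => hX r r.2
    have h2 : ContinuousOn X s := by
      rw [continuousOn_iff_continuous_domRestrict, h1]; exact hx
    exact h2.continuousAt (hs.mem_nhds ht)
  have hXt : X t = (Ioo (-ε) ε).domRestrict c ⟨0, h0⟩ := (hX t ht).trans hc0.symm
  have : Nonempty (Ioo (-ε) ε) := ⟨⟨0, h0⟩⟩
  -- The portrait is locally the flow curve `c`, so `p = c ∘ τ` near `t`, with `τ` so far only
  -- continuous.
  let φ := hce.toOpenPartialHomeomorph _
  let τ : ℝ → ℝ := fun r => (φ.symm (X r)).1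
  have hφ : ∀ r : Ioo (-ε) ε, φ.symm (c r) = r := fun r => φ.left_inv (x := r) (mem_univ _)
  have htgt : φ.target = range ((Ioo (-ε) ε).domRestrict c) := by simp [φ]
  have hmem : X t ∈ φ.target := by rw [hXt, htgt]; exact mem_range_self _
  have hτt : τ t = 0 := by
    change (φ.symm (X t)).1 = 0
    rw [hXt]
    exact congrArg Subtype.val (hφ ⟨0, h0⟩)
  have hτc : ContinuousAt τ t := continuous_subtype_val.continuousAt.comp
    (ContinuousAt.comp (φ.continuousAt_symm hmem) hXc)
  have hpc : ∀ᶠ r in 𝓝 t, p r = (c (τ r)).pt := by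
    filter_upwards [hXc.eventually (φ.open_target.mem_nhds hmem), hs.mem_nhds ht] with r hr hrs
    have h1 : (Ioo (-ε) ε).domRestrict c (φ.symm (X r)) = X r := φ.right_inv hr
    have h2 : c (τ r) = X r := h1
    rw [h2, hX r hrs, hxp]
  have hyp : y.pt = p t := hxp ⟨t, ht⟩
  have hv0 : velF (fun t => (c t).pt) 0 = phaseField G F (p t) := by
    rw [hcv 0 h0, hc0, hyp]
  have hreg : phaseField G F (p t) ≠ 0 := by rw [← hyp]; exact y.isRegularPoint
  obtain ⟨ℓ, hℓ⟩ := SeparatingDual.exists_eq_one (R := ℝ) (V := 𝓛.V) hreg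
  set f : ℝ → ℝ := fun r => ℓ (F.incl (c r).pt) with hf
  have hfd : HasDerivAt f 1 0 := by
    have h1 := ℓ.hasFDerivAt.comp_hasDerivAt (0 : ℝ) (hasDerivAt_incl isOpen_Ioo hcs h0)
    rwa [hv0, hℓ] at h1
  have hfs : HasStrictDerivAt f 1 0 :=
    ((ℓ.contDiff.comp_contDiffOn (contDiffOn_incl hcs)).contDiffAt
      (isOpen_Ioo.mem_nhds h0)).hasStrictDerivAt' hfd (by simp)
  have hk : HasDerivAt (fun r => ℓ (F.incl (p r))) (ℓ (velF p t)) t :=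
    ℓ.hasFDerivAt.comp_hasDerivAt t (hasDerivAt_incl hs hp ht)
  -- Since `ℓ ∘ p = f ∘ τ` and `f' (0) = 1`, `τ` is the local inverse of `f` composed with the
  -- smooth function `ℓ ∘ p`.
  have hτd : HasDerivAt τ ((1 : ℝ)⁻¹ * ℓ (velF p t)) t := by
    have h1 := (hfs.to_localInverse one_ne_zero).hasDerivAt
    have h2 : f 0 = ℓ (F.incl (p t)) := by
      simp only [hf, hc0, hyp]
    rw [h2] at h1
    refine (h1.comp t hk).congr_of_eventuallyEq ?_
    have h3 := (hfs.hasStrictFDerivAt_equiv one_ne_zero).eventually_left_inverse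
    have h4 : Tendsto τ (𝓝 t) (𝓝 0) := by rw [← hτt]; exact hτc
    filter_upwards [h4.eventually h3, hpc] with r hr hpr
    have h5 : ℓ (F.incl (p r)) = f (τ r) := by rw [hpr]
    change τ r = hfs.localInverse f 1 0 one_ne_zero (ℓ (F.incl (p r)))
    rw [h5]
    exact hr.symm
  have hfin : HasDerivAt (fun r => F.incl (p r)) (((1 : ℝ)⁻¹ * ℓ (velF p t)) •
      phaseField G F (p t)) t := by
    have h1 : HasDerivAt (fun r => F.incl (c r).pt) (phaseField G F (p t)) (τ t) := by
      rw [hτt, ← hv0]; exact hasDerivAt_incl isOpen_Ioo hcs h0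
    refine (h1.scomp t hτd).congr_of_eventuallyEq ?_
    filter_upwards [hpc] with r hr
    rw [hr]; rfl
  rw [(hasDerivAt_incl hs hp ht).unique hfin]
  exact Submodule.smul_mem _ _ (phaseField_mem_tangentPortrait hF _)

/-- Near `t` the coefficient is the quotient `ℓ(X) / ℓ(Y)` for a functional with `ℓ(Y t) = 1`. -/
theorem _root_.ContDiffOn.of_eq_smul {V : Type*} [NormedAddCommGroup V] [NormedSpace ℝ V]
    {s : Set ℝ} (hs : IsOpen s) {f : ℝ → ℝ} {X Y : ℝ → V} (hX : ContDiffOn ℝ ∞ X s)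
    (hY : ContDiffOn ℝ ∞ Y s) (hY0 : ∀ t ∈ s, Y t ≠ 0) (h : ∀ t ∈ s, X t = f t • Y t) :
    ContDiffOn ℝ ∞ f s := by
  intro t ht
  obtain ⟨ℓ, hℓ⟩ := SeparatingDual.exists_eq_one (R := ℝ) (hY0 t ht)
  have h2 : ContDiffOn ℝ ∞ (fun r => ℓ (X r)) s := ℓ.contDiff.comp_contDiffOn hX
  have h3 : ContDiffOn ℝ ∞ (fun r => ℓ (Y r)) s := ℓ.contDiff.comp_contDiffOn hY
  have hne : ℓ (Y t) ≠ 0 := by rw [hℓ]; exact one_ne_zero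
  have h4 : ContDiffAt ℝ ∞ (fun r => ℓ (X r) / ℓ (Y r)) t :=
    (h2.contDiffAt (hs.mem_nhds ht)).div (h3.contDiffAt (hs.mem_nhds ht)) hne
  refine ContDiffAt.contDiffWithinAt (h4.congr_of_eventuallyEq ?_)
  have h5 : ContinuousAt (fun r => ℓ (Y r)) t := h3.continuousOn.continuousAt (hs.mem_nhds ht)
  filter_upwards [hs.mem_nhds ht, h5.eventually_ne hne] with r hrs hr
  rw [h r hrs, map_smul, smul_eq_mul, mul_div_cancel_right₀ _ hr]

/-- `sigma` is defined by a pointwise choice, so smoothness has to come from `p' = σ(p') Φ`. The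
`𝔤*`-components suffice: there `Φ` is `-ad*(𝓗) η`, smooth and nonzero at regular points. -/
theorem contDiffOn_speed (hF : IsCoisotropic G F) {s : Set ℝ} (hs : IsOpen s) {p : ℝ → F.carrier}
    (hp : ContMDiffOn 𝓘(ℝ, ℝ) (𝓡 F.dim) ∞ p s) (hr : ∀ t ∈ s, IsRegularPoint G F (p t))
    (hv : ∀ t ∈ s, velF p t ∈ tangentPortrait G F (p t)) : ContDiffOn ℝ ∞ (speed G p) s := by
  have h1 : ContDiffOn ℝ ∞ (fun r => -adStar G (legendre (p r)) (ham (p r))) s :=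
    ((contDiff_adStar (E := E) (G := G)).comp_contDiffOn
      ((contDiffOn_legendre hp).prodMk (contDiffOn_ham hp))).neg
  have h2 : ContDiffOn ℝ ∞ (fun r => (velF p r).2) s :=
    contDiff_snd.comp_contDiffOn (contDiffOn_velF hs hp)
  refine ContDiffOn.of_eq_smul hs h2 h1
    (fun t ht => neg_ne_zero.2 ((isRegularPoint_iff hF _).1 (hr t ht))) fun t ht => ?_
  rw [← phaseField_snd hF]
  exact congrArg Prod.snd (eq_sigma_smul hF (hr t ht) (hv t ht))

/-- Constant momentum means `η = Ad*(h⁻¹) μ`; the explicit lift `h⁻¹` gives continuity for the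
quotient topology of the orbit. -/
theorem exists_continuous_portrait {s : Set ℝ} {h : ℝ → G} {p : ℝ → F.carrier}
    (hhp : IsSmoothCurve s h p) (hr : ∀ t ∈ s, IsRegularPoint G F (p t))
    (hm : ∀ t ∈ s, moment (h t) (p t) = μ) :
    ∃ x : s → PhasePortrait G F μ, Continuous x ∧ ∀ t, (x t).pt = p t := by
  have : IsTopologicalGroup G := topologicalGroup_of_lieGroup (E := E) 𝓘(ℝ, E) ∞
  refine ⟨fun t => ⟨(p t, orbitMap μ (h t)⁻¹), hr t t.2, (coAd_eq_iff _ _ _).1 (hm t t.2)⟩,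
    Continuous.subtype_mk ?_ _, fun t => rfl⟩
  have h2 : Continuous fun t : s => p t := hhp.2.continuousOn.domRestrict
  have h3 : Continuous fun t : s => h t := hhp.1.continuousOn.domRestrict
  exact h2.prodMk ((continuous_orbitMap μ).comp h3.inv)

theorem InFibration.isRegularPoint {x₀ : PhasePortrait G F μ} {g : G} {p : F.carrier}
    (h : InFibration x₀ g p) : IsRegularPoint G F p := by
  obtain ⟨-, x, -, rfl⟩ := h
  exact x.isRegularPoint

theorem IsFibrationCurve.isPortraitCurve {x₀ : PhasePortrait G F μ} {s : Set ℝ} {h : ℝ → G}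
    {p : ℝ → F.carrier} (hc : IsFibrationCurve x₀ s h p) : IsPortraitCurve x₀ s p := by
  obtain ⟨x, hx, hxp⟩ := exists_continuous_portrait hc.1
    (fun t ht => (hc.2 t ht).isRegularPoint) (fun t ht => (hc.2 t ht).1)
  refine ⟨hc.1.2, x, hx, fun t => ⟨?_, hxp t⟩⟩
  obtain ⟨-, y, hy, hyp⟩ := hc.2 t t.2
  rwa [PhasePortrait.ext_pt ((hxp t).trans hyp.symm)]

theorem IsPortraitCurve.isRegularPoint {x₀ : PhasePortrait G F μ} {s : Set ℝ}
    {p : ℝ → F.carrier} (hp : IsPortraitCurve x₀ s p) {t : ℝ} (ht : t ∈ s) :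
    IsRegularPoint G F (p t) := by
  obtain ⟨-, x, -, hxp⟩ := hp
  rw [← (hxp ⟨t, ht⟩).2]
  exact (x ⟨t, ht⟩).isRegularPoint

theorem IsPortraitCurve.velF_mem (hF : IsCoisotropic G F) {x₀ : PhasePortrait G F μ} {s : Set ℝ}
    (hs : IsOpen s) {p : ℝ → F.carrier} (hp : IsPortraitCurve x₀ s p) {t : ℝ} (ht : t ∈ s) :
    velF p t ∈ tangentPortrait G F (p t) := by
  obtain ⟨hp, x, hx, hxp⟩ := hp
  exact velF_mem_tangentPortrait hF hs hp hx (fun t => (hxp t).2) ht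

theorem IsPortraitCurve.velF_eq (hF : IsCoisotropic G F) {x₀ : PhasePortrait G F μ} {s : Set ℝ}
    (hs : IsOpen s) {p : ℝ → F.carrier} (hp : IsPortraitCurve x₀ s p) {t : ℝ} (ht : t ∈ s) :
    velF p t = speed G p t • phaseField G F (p t) :=
  eq_sigma_smul hF (hp.isRegularPoint ht) (hp.velF_mem hF hs ht)

theorem IsPortraitCurve.contDiffOn_speed (hF : IsCoisotropic G F) {x₀ : PhasePortrait G F μ}
    {s : Set ℝ} (hs : IsOpen s) {p : ℝ → F.carrier} (hp : IsPortraitCurve x₀ s p) :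
    ContDiffOn ℝ ∞ (speed G p) s :=
  InvariantLagrangian.contDiffOn_speed hF hs hp.1 (fun _ ht => hp.isRegularPoint ht)
    (fun _ ht => hp.velF_mem hF hs ht)

theorem coAd_injective (g : G) : Function.Injective (coAd (E := E) g) := fun η ζ h => by
  have h1 := (coAd_eq_iff g η _).1 h
  rwa [← coAd_mul, inv_mul_cancel, coAd_one] at h1

/-- The connection form takes values in the isotropy algebra. -/
theorem IsFibrationCurve.theta_mem (hF : IsCoisotropic G F) {x₀ : PhasePortrait G F μ} {s : Set ℝ}
    (hs : IsOpen s) {h : ℝ → G} {p : ℝ → F.carrier} (hc : IsFibrationCurve x₀ s h p) {t : ℝ}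
    (ht : t ∈ s) : theta (h t) (p t) (vel h p t) ∈ isotropyAlgebra G μ := by
  have h1 := hasDerivAt_coAd hs hc.1.1 ht (hasDerivAt_legendre hs hc.1.2 ht)
  have h2 : HasDerivAt (fun r => coAd (h r) (legendre (p r))) 0 t := by
    refine (hasDerivAt_const t μ).congr_of_eventuallyEq ?_
    filter_upwards [hs.mem_nhds ht] with r hr using (hc.2 r hr).1
  -- The derivative of the constant moment. Substituting `p' = σ(p') Φ` shows that `h⁻¹h' - σ(p') 𝓗`
  -- is isotropic for `η`, and `Ad(h)` carries it into `𝔤_μ`.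
  have h3 : (velF p t).2 + adStar G (legendre (p t)) (velG h t) = 0 :=
    coAd_injective (h t) ((h1.unique h2).trans (ContinuousLinearMap.zero_comp _).symm)
  have h4 := hc.isPortraitCurve.velF_eq hF hs ht
  rw [h4, Prod.smul_snd, phaseField_snd hF] at h3
  rw [← (hc.2 t ht).1]
  refine Ad_mem_isotropyAlgebra.2 ?_
  change adStar G (legendre (p t)) (velG h t - speed G p t • ham (p t)) = 0
  rw [map_sub, map_smul, ← h3]
  module

theorem theta_fundamental (g : G) (p : F.carrier) (A : E) :
    theta g p (fundamental g A, 0) = A := by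
  rw [theta, sigma_zero, zero_smul, sub_zero, fundamental_eq, Ad_Ad_inv]

theorem InFibration.mul_left {x₀ : PhasePortrait G F μ} {g : G} {p : F.carrier}
    (h : InFibration x₀ g p) {m : G} (hm : m ∈ isotropyGroup G μ) : InFibration x₀ (m * g) p := by
  refine ⟨?_, h.2⟩
  rw [moment, coAd_mul]
  exact (congrArg _ h.1).trans hm

theorem theta_mul (m g : G) (p : F.carrier) (X : E × 𝓛.V) :
    theta (m * g) p X = Ad m (theta g p X) := by
  rw [theta, theta, Ad_mul]

theorem theta_eq_zero_iff {g : G} {p : F.carrier} {X : E × 𝓛.V} :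
    theta g p X = 0 ↔ X.1 = sigma G F p X.2 • ham p := by
  rw [theta, ← sub_eq_zero (b := sigma G F p X.2 • ham p)]
  exact map_eq_zero_iff (Ad g : E →L[ℝ] E) (Ad_injective g)

theorem IsFibrationCurve.isHorizontalCurve_iff_velG {x₀ : PhasePortrait G F μ} {s : Set ℝ}
    {h : ℝ → G} {p : ℝ → F.carrier} (hc : IsFibrationCurve x₀ s h p) :
    IsHorizontalCurve x₀ s h p ↔ ∀ t ∈ s, (velG h t : E) = speed G p t • ham (p t) :=
  ⟨fun H t ht => theta_eq_zero_iff.1 (H.2 t ht),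
    fun H => ⟨hc, fun t ht => theta_eq_zero_iff.2 (H t ht)⟩⟩

/-- Horizontality constrains only the `G`-component; the `𝓕`-component is automatic because the
portrait is one-dimensional. -/
theorem IsFibrationCurve.isHorizontalCurve_iff (hF : IsCoisotropic G F) {x₀ : PhasePortrait G F μ}
    {s : Set ℝ} (hs : IsOpen s) {h : ℝ → G} {p : ℝ → F.carrier} (hc : IsFibrationCurve x₀ s h p) :
    IsHorizontalCurve x₀ s h p ↔ ∀ t ∈ s, vel h p t = speed G p t • xi G F (p t) := by
  rw [hc.isHorizontalCurve_iff_velG]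
  refine forall₂_congr fun t ht => ?_
  rw [xi_eq hF]
  exact ⟨fun H => Prod.ext H (hc.isPortraitCurve.velF_eq hF hs ht), fun H => congrArg Prod.fst H⟩

theorem speed_eq_of_velF_eq (hF : IsCoisotropic G F) {p : ℝ → F.carrier} {t c : ℝ}
    (hr : IsRegularPoint G F (p t)) (h : velF p t = c • phaseField G F (p t)) :
    speed G p t = c := by
  rw [speed, h, (sigma_smul_phaseField hF hr).2]

theorem IsFibrationCurve.isCharacteristicCurve_iff (hF : IsCoisotropic G F)
    {x₀ : PhasePortrait G F μ} {s : Set ℝ} (hs : IsOpen s) {h : ℝ → G} {p : ℝ → F.carrier}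
    (hc : IsFibrationCurve x₀ s h p) : IsCharacteristicCurve s h p ↔
      IsHorizontalCurve x₀ s h p ∧ ∀ t ∈ s, speed G p t = 1 := by
  rw [hc.isHorizontalCurve_iff hF hs]
  constructor
  · rintro ⟨-, H⟩
    have h1 : ∀ t ∈ s, speed G p t = 1 := fun t ht => speed_eq_of_velF_eq hF (H t ht).1 (by
      rw [one_smul]
      exact congrArg Prod.snd (H t ht).2)
    exact ⟨fun t ht => by rw [h1 t ht, one_smul, (H t ht).2], h1⟩
  · rintro ⟨H, H1⟩
    exact ⟨hc.1, fun t ht => ⟨(hc.2 t ht).isRegularPoint, by rw [H t ht, H1 t ht, one_smul]⟩⟩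

theorem IsCharacteristicCurve.moment_eq (hF : IsCoisotropic G F) {s : Set ℝ} (hs : IsOpenInterval s)
    {h : ℝ → G} {p : ℝ → F.carrier} (hc : IsCharacteristicCurve s h p) {t₀ t : ℝ} (ht₀ : t₀ ∈ s)
    (ht : t ∈ s) : moment (h t) (p t) = moment (h t₀) (p t₀) := by
  refine moment_eq_of_velF_add_eq_zero hs hc.1 (fun t ht => ?_) ht₀ ht
  have h1 := (hc.2 t ht).2
  rw [xi_eq hF] at h1
  have h2 : (velG h t : E) = ham (p t) := congrArg Prod.fst h1
  have h3 : velF p t = phaseField G F (p t) := congrArg Prod.snd h1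
  rw [h2, h3, phaseField_snd hF, neg_add_cancel]

/-- The continuous lift to the portrait has connected range, so it stays in a single component. -/
theorem IsCharacteristicCurve.exists_isFibrationCurve {s : Set ℝ} (hs : IsOpenInterval s)
    {h : ℝ → G} {p : ℝ → F.carrier} (hc : IsCharacteristicCurve s h p)
    (hm : ∀ t ∈ s, moment (h t) (p t) = μ) {t₀ : ℝ} (ht₀ : t₀ ∈ s) :
    ∃ x₀ : PhasePortrait G F μ, x₀.pt = p t₀ ∧ IsFibrationCurve x₀ s h p := by
  obtain ⟨x, hx, hxp⟩ := exists_continuous_portrait hc.1 (fun t ht => (hc.2 t ht).1) hm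
  refine ⟨x ⟨t₀, ht₀⟩, hxp _, hc.1, fun t ht => ⟨hm t ht, x ⟨t, ht⟩, ?_, hxp _⟩⟩
  have : PreconnectedSpace s := Subtype.preconnectedSpace hs.2.1.isPreconnected
  exact (isPreconnected_range hx).subset_connectedComponent (mem_range_self _) (mem_range_self _)

end Fibration

end InvariantLagrangian

end CoisotropicProblem

/-! ### Reparametrization of horizontal curves. -/

namespace CoisotropicProblem

open Filter

namespace InvariantLagrangian

section Interval

theorem hasDerivAt_integral {V : Type*} [NormedAddCommGroup V] [NormedSpace ℝ V] [CompleteSpace V]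
    {s : Set ℝ} (hs : IsOpenInterval s) {a : ℝ → V} (ha : ContinuousOn a s) {t₀ t : ℝ}
    (ht₀ : t₀ ∈ s) (ht : t ∈ s) : HasDerivAt (fun t => ∫ r in t₀..t, a r) (a t) t :=
  intervalIntegral.integral_hasDerivAt_right
    ((ha.mono (hs.2.1.uIcc_subset ht₀ ht)).intervalIntegrable)
    (ha.stronglyMeasurableAtFilter hs.1 t ht) (ha.continuousAt (hs.1.mem_nhds ht))

theorem contDiffOn_integral {V : Type*} [NormedAddCommGroup V] [NormedSpace ℝ V] [CompleteSpace V]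
    {s : Set ℝ} (hs : IsOpenInterval s) {a : ℝ → V} (ha : ContDiffOn ℝ ∞ a s) {t₀ : ℝ}
    (ht₀ : t₀ ∈ s) : ContDiffOn ℝ ∞ (fun t => ∫ r in t₀..t, a r) s := by
  rw [contDiffOn_infty_iff_deriv_of_isOpen hs.1]
  exact ⟨fun t ht => (hasDerivAt_integral hs ha.continuousOn ht₀
      ht).differentiableAt.differentiableWithinAt,
    ha.congr fun t ht => (hasDerivAt_integral hs ha.continuousOn ht₀ ht).deriv⟩

/-- A smooth function with nowhere vanishing derivative on an open interval has a smooth inverse. -/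
theorem exists_contDiffOn_inverse {s : Set ℝ} (hs : IsOpenInterval s) {τ : ℝ → ℝ}
    (hτ : ContDiffOn ℝ ∞ τ s) (hτ' : ∀ t ∈ s, deriv τ t ≠ 0) :
    IsOpenInterval (τ '' s) ∧ InjOn τ s ∧ ∃ σ : ℝ → ℝ, ContDiffOn ℝ ∞ σ (τ '' s) ∧
      (∀ t ∈ s, σ (τ t) = t) ∧ ∀ t ∈ s, HasDerivAt σ (deriv τ t)⁻¹ (τ t) := by
  have hd : ∀ t ∈ s, HasDerivAt τ (deriv τ t) t := fun t ht =>
    ((hτ.contDiffAt (hs.1.mem_nhds ht)).differentiableAt (by simp)).hasDerivAt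
  have hlt : ∀ a ∈ s, ∀ b ∈ s, a < b → τ a ≠ τ b := by
    intro a ha b hb hab he
    obtain ⟨c, hc, hc0⟩ := exists_deriv_eq_zero hab
      (hτ.continuousOn.mono (hs.2.1.out ha hb)) he
    exact hτ' c (hs.2.1.out ha hb (Ioo_subset_Icc_self hc)) hc0
  have hinj : InjOn τ s := by
    intro a ha b hb hab
    rcases lt_trichotomy a b with h | h | h
    · exact absurd hab (hlt a ha b hb h)
    · exact h
    · exact absurd hab.symm (hlt b hb a ha h)
  have hnhds : ∀ t ∈ s, map τ (𝓝 t) = 𝓝 (τ t) := fun t ht =>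
    ((hτ.contDiffAt (hs.1.mem_nhds ht)).hasStrictDerivAt' (hd t ht) (by simp)).map_nhds_eq
      (hτ' t ht)
  have hopen : ∀ J ⊆ s, IsOpen J → IsOpen (τ '' J) := by
    intro J hJ hJo
    refine isOpen_iff_mem_nhds.2 ?_
    rintro _ ⟨t, ht, rfl⟩
    rw [← hnhds t (hJ ht)]
    exact image_mem_map (hJo.mem_nhds ht)
  have hI : IsOpenInterval (τ '' s) := ⟨hopen s subset_rfl hs.1,
    (hs.2.1.isPreconnected.image τ hτ.continuousOn).ordConnected, hs.2.2.image τ⟩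
  have hmap : IsOpenMap (s.domRestrict τ) := by
    intro V hV
    rw [show s.domRestrict τ = τ ∘ Subtype.val from rfl, image_comp]
    exact hopen _ (by rintro _ ⟨x, -, rfl⟩; exact x.2) (hs.1.isOpenMap_subtype_val V hV)
  let e : OpenPartialHomeomorph ℝ ℝ := OpenPartialHomeomorph.ofContinuousOpenRestrict
    (BijOn.toPartialEquiv τ s (τ '' s) hinj.bijOn_image) hτ.continuousOn hmap hs.1
  have hleft : ∀ t ∈ s, e.symm (τ t) = t := fun t ht => e.left_inv ht
  refine ⟨hI, hinj, e.symm, ?_, hleft, ?_⟩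
  · rintro _ ⟨t, ht, rfl⟩
    have hmem : τ t ∈ e.target := mem_image_of_mem τ ht
    refine (e.contDiffAt_symm_deriv (hτ' t ht) hmem ?_ ?_).contDiffWithinAt
    · rw [hleft t ht]; exact hd t ht
    · rw [hleft t ht]; exact hτ.contDiffAt (hs.1.mem_nhds ht)
  · intro t ht
    have hmem : τ t ∈ e.target := mem_image_of_mem τ ht
    refine e.hasDerivAt_symm hmem (hτ' t ht) ?_
    rw [hleft t ht]; exact hd t ht

end Interval

section Reparametrization

variable {E : Type v} [NormedAddCommGroup E] [NormedSpace ℝ E] [FiniteDimensional ℝ E]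
variable {G : Type u} [TopologicalSpace G] [ChartedSpace E G] [Group G] [LieGroup 𝓘(ℝ, E) ∞ G]
variable {𝓛 : InvariantLagrangian E} {F : Submfd.{v, w} 𝓛} {μ : Dual E}

theorem IsSmoothCurve.comp {s s' : Set ℝ} {h : ℝ → G} {p : ℝ → F.carrier}
    (hhp : IsSmoothCurve s h p) {τ : ℝ → ℝ} (hτ : ContDiffOn ℝ ∞ τ s') (hm : MapsTo τ s' s) :
    IsSmoothCurve s' (fun t => h (τ t)) (fun t => p (τ t)) :=
  ⟨hhp.1.comp hτ.contMDiffOn hm, hhp.2.comp hτ.contMDiffOn hm⟩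

theorem IsFibrationCurve.comp {x₀ : PhasePortrait G F μ} {s s' : Set ℝ} {h : ℝ → G}
    {p : ℝ → F.carrier} (hc : IsFibrationCurve x₀ s h p) {τ : ℝ → ℝ} (hτ : ContDiffOn ℝ ∞ τ s')
    (hm : MapsTo τ s' s) : IsFibrationCurve x₀ s' (fun t => h (τ t)) (fun t => p (τ t)) :=
  ⟨hc.1.comp hτ hm, fun _ ht => hc.2 _ (hm ht)⟩

theorem vel_comp {s : Set ℝ} (hs : IsOpen s) {h : ℝ → G} {p : ℝ → F.carrier}
    (hhp : IsSmoothCurve s h p) {τ : ℝ → ℝ} {t τ' : ℝ} (ht : τ t ∈ s) (hτ : HasDerivAt τ τ' t) :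
    vel (fun r => h (τ r)) (fun r => p (τ r)) t = τ' • vel h p (τ t) :=
  Prod.ext (velG_comp ((hhp.1.contMDiffAt (hs.mem_nhds ht)).mdifferentiableAt (by simp)) hτ)
    ((hasDerivAt_incl hs hhp.2 ht).scomp t hτ).deriv

/-- A horizontal curve with nowhere vanishing velocity is a reparametrized integral curve of the
characteristic field. -/
theorem IsHorizontalCurve.exists_reparametrization (hF : IsCoisotropic G F)
    {x₀ : PhasePortrait G F μ} {s : Set ℝ} (hs : IsOpenInterval s) {h : ℝ → G} {p : ℝ → F.carrier}
    (hc : IsHorizontalCurve x₀ s h p) (hv : ∀ t ∈ s, vel h p t ≠ 0) :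
    ∃ (s' : Set ℝ) (τ : ℝ → ℝ) (h' : ℝ → G) (p' : ℝ → F.carrier),
      IsOpenInterval s' ∧ ContDiffOn ℝ ∞ τ s ∧ BijOn τ s s' ∧
      (∀ t ∈ s, deriv τ t = speed G p t ∧ speed G p t ≠ 0) ∧
      IsCharacteristicCurve s' h' p' ∧ IsFibrationCurve x₀ s' h' p' ∧
      ∀ t ∈ s, h t = h' (τ t) ∧ p t = p' (τ t) := by
  have hvel := (hc.1.isHorizontalCurve_iff hF hs.1).1 hc
  have hsp : ∀ t ∈ s, speed G p t ≠ 0 := fun t ht h0 =>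
    hv t ht (by rw [hvel t ht, h0, zero_smul])
  have hsc := hc.1.isPortraitCurve.contDiffOn_speed hF hs.1
  obtain ⟨t₀, ht₀⟩ := hs.2.2
  -- The new time has differential `σ^μ` along the curve; non-vanishing velocity keeps it from being
  -- critical, since the velocity is `σ(p') ξ`.
  set τ : ℝ → ℝ := fun t => ∫ r in t₀..t, speed G p r with hτ
  have hτs : ContDiffOn ℝ ∞ τ s := contDiffOn_integral hs hsc ht₀
  have hτd : ∀ t ∈ s, deriv τ t = speed G p t := fun t ht =>
    (hasDerivAt_integral hs hsc.continuousOn ht₀ ht).deriv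
  obtain ⟨hI, hinj, σ, hσ, hστ, hσd⟩ := exists_contDiffOn_inverse hs hτs fun t ht => by
    rw [hτd t ht]; exact hsp t ht
  have hmaps : MapsTo σ (τ '' s) s := by
    rintro _ ⟨t, ht, rfl⟩
    rw [hστ t ht]; exact ht
  have hfib := hc.1.comp hσ hmaps
  refine ⟨τ '' s, τ, fun r => h (σ r), fun r => p (σ r), hI, hτs, hinj.bijOn_image,
    fun t ht => ⟨hτd t ht, hsp t ht⟩, ⟨hfib.1, ?_⟩, hfib, fun t ht => ?_⟩
  · rintro _ ⟨t, ht, rfl⟩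
    have h1 : σ (τ t) ∈ s := by rw [hστ t ht]; exact ht
    refine ⟨(hc.1.2 _ h1).isRegularPoint, ?_⟩
    rw [vel_comp hs.1 hc.1.1 h1 (hσd t ht), hστ t ht, hvel t ht, hτd t ht, smul_smul,
      inv_mul_cancel₀ (hsp t ht), one_smul]
    exact congrArg (fun r => xi G F (p r)) (hστ t ht).symm
  · simp only [hστ t ht, and_self]

theorem IsCharacteristicCurve.isHorizontalCurve_comp (hF : IsCoisotropic G F)
    {x₀ : PhasePortrait G F μ} {s s' : Set ℝ} (hs : IsOpen s) (hs' : IsOpen s') {τ : ℝ → ℝ}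
    {h : ℝ → G} {p : ℝ → F.carrier} (hτ : ContDiffOn ℝ ∞ τ s) (hm : MapsTo τ s s')
    (hc : IsCharacteristicCurve s' h p) (hfib : IsFibrationCurve x₀ s' h p) :
    IsHorizontalCurve x₀ s (fun t => h (τ t)) (fun t => p (τ t)) := by
  rw [(hfib.comp hτ hm).isHorizontalCurve_iff hF hs]
  intro t ht
  have h1 : HasDerivAt τ (deriv τ t) t :=
    ((hτ.contDiffAt (hs.mem_nhds ht)).differentiableAt (by simp)).hasDerivAt
  have h2 := vel_comp hs' hc.1 (hm ht) h1
  rw [(hc.2 _ (hm ht)).2] at h2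
  rw [h2, speed_eq_of_velF_eq (p := fun t => p (τ t)) hF (hc.2 _ (hm ht)).1
    (congrArg Prod.snd h2)]

end Reparametrization

end InvariantLagrangian

end CoisotropicProblem

/-! ### Horizontal curves by quadrature. -/

namespace CoisotropicProblem

open Filter

namespace InvariantLagrangian

section Quadrature

variable {E : Type v} [NormedAddCommGroup E] [NormedSpace ℝ E] [FiniteDimensional ℝ E]
variable {G : Type u} [TopologicalSpace G] [ChartedSpace E G] [Group G] [LieGroup 𝓘(ℝ, E) ∞ G]

/-- If the isotropy algebra is Abelian, the exponentials of the integrals of a curve in it lie in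
the isotropy group and have the integrand as velocity. -/
theorem velG_lieExp_integral {μ : Dual E}
    (hab : ∀ A ∈ isotropyAlgebra G μ, ∀ B ∈ isotropyAlgebra G μ, bracket G A B = 0)
    {s : Set ℝ} (hs : IsOpenInterval s) {a : ℝ → E} (ha : ContDiffOn ℝ ∞ a s)
    (haμ : ∀ t ∈ s, a t ∈ isotropyAlgebra G μ) {t₀ : ℝ} (ht₀ : t₀ ∈ s) :
    ContMDiffOn 𝓘(ℝ, ℝ) 𝓘(ℝ, E) ∞ (fun t => lieExp G (∫ r in t₀..t, a r)) s ∧ ∀ t ∈ s,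
      lieExp G (∫ r in t₀..t, a r) ∈ isotropyGroup G μ ∧
      (velG (fun t => lieExp G (∫ r in t₀..t, a r)) t : E) = a t := by
  have : CompleteSpace E := FiniteDimensional.complete ℝ E
  set 𝔥 := isotropyAlgebra G μ with h𝔥
  obtain ⟨ψ, hψ, hψ0, hψd, hψH, hψa⟩ := exists_subgroup_parametrization 𝔥 (isotropySubgroup G μ)
    (fun A hA t => coAd_oneParam hA t)
  have hψa := hψa hab
  have hψm : ∀ x, MDifferentiableAt 𝓘(ℝ, 𝔥) 𝓘(ℝ, E) ψ x := hψ.mdifferentiable (by simp)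
  have hlog0 : (logD ψ 0 : 𝔥 →L[ℝ] E) = 𝔥.subtypeL := by
    have h1 : HasMFDerivAt 𝓘(ℝ, 𝔥) 𝓘(ℝ, E) (fun w => (ψ 0)⁻¹ * ψ w) 0 𝔥.subtypeL :=
      HasMFDerivAt.congr_of_eventuallyEq (f' := 𝔥.subtypeL) hψd
        (Eventually.of_forall fun w => by simp only [hψ0, inv_one, one_mul])
    exact h1.mfderiv
  have hlog : ∀ x, (logD ψ x : 𝔥 →L[ℝ] E) = 𝔥.subtypeL := by
    intro x
    have h1 := logD_comp (α := ψ) (φ := fun y => x + y) (w := 0) (hψm _)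
      ((hasFDerivAt_id (0 : 𝔥)).const_add x)
    have h2 : (fun y => ψ (x + y)) = fun y => ψ x * ψ y := funext fun y => hψa x y
    rw [h2, add_zero, ContinuousLinearMap.comp_id] at h1
    rw [← h1, logD_const_mul (ψ x) ψ 0, hlog0]
  -- The curve `t ↦ ψ (t A)` is a one-parameter subgroup with velocity `A`, so `Exp` restricted to
  -- the Abelian algebra is the homomorphism `ψ`, whose logarithmic derivative is constant.
  have hexp : ∀ A : 𝔥, lieExp G (A : E) = ψ A := by
    intro A
    have hT : HasFDerivAt (fun t : ℝ => t • A) (ContinuousLinearMap.toSpanSingleton ℝ A) 0 :=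
      (ContinuousLinearMap.toSpanSingleton ℝ A).hasFDerivAt
    have hsm : ContMDiff 𝓘(ℝ, ℝ) 𝓘(ℝ, E) ∞ (fun t : ℝ => ψ (t • A)) :=
      hψ.comp (contDiff_id.smul contDiff_const : ContDiff ℝ ∞ fun t : ℝ => t • A).contMDiff
    have h1 : IsOneParameterSubgroup (A : E) (fun t : ℝ => ψ (t • A)) := by
      refine ⟨hsm, fun t r => by simp only [add_smul, hψa], ?_⟩
      rw [velG_eq_logD (hsm.mdifferentiable (by simp) _), logD_comp (hψm _) hT, hlog]
      simp
    rw [h1.lieExp_eq, one_smul]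
  -- A projection onto `𝔥` allows the integral to be taken inside `𝔥`, where `ψ` is defined.
  obtain ⟨P, hP⟩ := 𝔥.subtype.exists_leftInverse_of_injective 𝔥.ker_subtype
  let PL : E →L[ℝ] 𝔥 := LinearMap.toContinuousLinearMap P
  have hPL : ∀ A ∈ 𝔥, (PL A : E) = A := fun A hA =>
    congrArg Subtype.val (congrArg (fun f : 𝔥 →ₗ[ℝ] 𝔥 => f ⟨A, hA⟩) hP)
  have hb : ContDiffOn ℝ ∞ (fun t => PL (a t)) s := PL.contDiff.comp_contDiffOn ha
  have hI : ∀ t ∈ s, ∫ r in t₀..t, a r = ((∫ r in t₀..t, PL (a r) : 𝔥) : E) := by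
    intro t ht
    have hsub := hs.2.1.uIcc_subset ht₀ ht
    have h1 := 𝔥.subtypeL.intervalIntegral_comp_comm (μ := MeasureTheory.volume)
      ((hb.continuousOn.mono hsub).intervalIntegrable)
    refine Eq.trans (intervalIntegral.integral_congr fun r hr => ?_) h1
    exact (hPL _ (haμ r (hsub hr))).symm
  have heq : ∀ t ∈ s, lieExp G (∫ r in t₀..t, a r) = ψ (∫ r in t₀..t, PL (a r)) := fun t ht => by
    rw [hI t ht, hexp]
  have hJ : ContDiffOn ℝ ∞ (fun t => ∫ r in t₀..t, PL (a r)) s := contDiffOn_integral hs hb ht₀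
  have hψJ : ContMDiffOn 𝓘(ℝ, ℝ) 𝓘(ℝ, E) ∞ (fun t => ψ (∫ r in t₀..t, PL (a r))) s :=
    hψ.comp_contMDiffOn hJ.contMDiffOn
  refine ⟨hψJ.congr heq, fun t ht => ⟨by rw [heq t ht]; exact hψH _, ?_⟩⟩
  rw [velG_congr (eventually_of_mem (hs.1.mem_nhds ht) heq),
    velG_eq_logD ((hψJ.contMDiffAt (hs.1.mem_nhds ht)).mdifferentiableAt (by simp)),
    logD_comp (hψm _) (hasDerivAt_integral hs hb.continuousOn ht₀ ht).hasFDerivAt, hlog]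
  simpa using hPL _ (haμ t ht)

variable {𝓛 : InvariantLagrangian E} {F : Submfd.{v, w} 𝓛} {μ : Dual E}

/-- Horizontal lifts exist. -/
theorem IsPortraitCurve.exists_section (hF : IsCoisotropic G F) {x₀ : PhasePortrait G F μ}
    {s : Set ℝ} (hs : IsOpenInterval s) {p : ℝ → F.carrier} (hp : IsPortraitCurve x₀ s p) :
    ∃ g : ℝ → G, ContMDiffOn 𝓘(ℝ, ℝ) 𝓘(ℝ, E) ∞ g s ∧ ∀ t ∈ s, InFibration x₀ (g t)⁻¹ (p t) := by
  obtain ⟨x, hx, hxp⟩ := hp.2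
  obtain ⟨t₀, ht₀⟩ := hs.2.2
  obtain ⟨g₀, hg₀⟩ := (x ⟨t₀, ht₀⟩).1.2.2
  have hg₀ : coAd g₀ μ = legendre (p t₀) := by
    rw [← (hxp ⟨t₀, ht₀⟩).2, PhasePortrait.legendre_pt]; exact hg₀
  have ha : ContDiffOn ℝ ∞ (fun t => speed G p t • ham (p t)) s :=
    (hp.contDiffOn_speed hF hs.1).smul (contDiffOn_ham hp.1)
  -- The lift solves `h⁻¹h' = v 𝓗`, which conserves the moment; the initial value `g₀⁻¹` makes that
  -- moment equal to `μ`.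
  obtain ⟨h, hh, hh0, hhv⟩ := exists_velG_eq hs.1 hs.2.1.isPreconnected ha ht₀ g₀⁻¹
  refine ⟨fun t => (h t)⁻¹, hh.inv, fun t ht => ⟨?_, x ⟨t, ht⟩, (hxp _).1, (hxp _).2⟩⟩
  rw [inv_inv, moment_eq_of_velF_add_eq_zero hs ⟨hh, hp.1⟩ (fun t ht => ?_) ht₀ ht, moment, hh0,
    ← hg₀, ← coAd_mul, inv_mul_cancel, coAd_one]
  rw [hhv t ht, hp.velF_eq hF hs.1 ht, map_smul, Prod.smul_snd, phaseField_snd hF]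
  module

theorem contDiffOn_gaugeIntegrand (hF : IsCoisotropic G F) {x₀ : PhasePortrait G F μ}
    {s : Set ℝ} (hs : IsOpen s) {p : ℝ → F.carrier} (hp : IsPortraitCurve x₀ s p) {g : ℝ → G}
    (hg : ContMDiffOn 𝓘(ℝ, ℝ) 𝓘(ℝ, E) ∞ g s) : ContDiffOn ℝ ∞ (gaugeIntegrand g p) s :=
  ((hp.contDiffOn_speed hF hs).smul ((contDiffOn_Ad hs hg.inv).clm_apply
    (contDiffOn_ham hp.1))).add (contDiffOn_velG hs hg)

/-- Because of this identity, the gauge integrand takes values in `𝔤_μ` whenever the section does in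
`P^μ`. -/
theorem theta_inv {s : Set ℝ} (hs : IsOpen s) {p : ℝ → F.carrier} {g : ℝ → G}
    (hg : ContMDiffOn 𝓘(ℝ, ℝ) 𝓘(ℝ, E) ∞ g s) {t : ℝ} (ht : t ∈ s) :
    theta (g t)⁻¹ (p t) (vel (fun r => (g r)⁻¹) p t) = -gaugeIntegrand g p t := by
  have h1 := velG_inv ((hg.contMDiffAt (hs.mem_nhds ht)).mdifferentiableAt (by simp))
  change (Ad (g t)⁻¹ : E →L[ℝ] E) (velG (fun r => (g r)⁻¹) t - speed G p t • ham (p t)) =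
    -(speed G p t • (Ad (g t)⁻¹ : E →L[ℝ] E) (ham (p t)) + velG g t)
  rw [h1, map_sub, map_neg, map_smul, Ad_inv_Ad]
  abel

/-- Reduction of the construction of horizontal curves to a quadrature. -/
theorem gaugeTransformation_spec (hF : IsCoisotropic G F)
    (hab : ∀ A ∈ isotropyAlgebra G μ, ∀ B ∈ isotropyAlgebra G μ, bracket G A B = 0)
    {x₀ : PhasePortrait G F μ} {s : Set ℝ} (hs : IsOpenInterval s) {p : ℝ → F.carrier}
    (hp : IsPortraitCurve x₀ s p) {g : ℝ → G} (hg : ContMDiffOn 𝓘(ℝ, ℝ) 𝓘(ℝ, E) ∞ g s)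
    (hgp : ∀ t ∈ s, InFibration x₀ (g t)⁻¹ (p t)) :
    ContDiffOn ℝ ∞ (gaugeIntegrand g p) s ∧
    (∀ t ∈ s, gaugeIntegrand g p t ∈ isotropyAlgebra G μ) ∧
    ∀ t₀ ∈ s,
      (∀ t ∈ s, gaugeTransformation g p t₀ t ∈ isotropyGroup G μ) ∧
      IsHorizontalCurve x₀ s (fun t => gaugeTransformation g p t₀ t * (g t)⁻¹) p ∧
      ∀ k : ℝ → G, IsHorizontalCurve x₀ s k p ↔
        ∃ m ∈ isotropyGroup G μ, ∀ t ∈ s, k t = m * gaugeTransformation g p t₀ t * (g t)⁻¹ := by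
  have hfib : IsFibrationCurve x₀ s (fun t => (g t)⁻¹) p := ⟨⟨hg.inv, hp.1⟩, hgp⟩
  have hsm := contDiffOn_gaugeIntegrand hF hs.1 hp hg
  have hmem : ∀ t ∈ s, gaugeIntegrand g p t ∈ isotropyAlgebra G μ := by
    intro t ht
    have h1 := hfib.theta_mem hF hs.1 ht
    rw [theta_inv hs.1 hg ht] at h1
    simpa using Submodule.neg_mem _ h1
  refine ⟨hsm, hmem, fun t₀ ht₀ => ?_⟩
  obtain ⟨hTs, hT⟩ := velG_lieExp_integral hab hs hsm hmem ht₀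
  change ContMDiffOn 𝓘(ℝ, ℝ) 𝓘(ℝ, E) ∞ (gaugeTransformation g p t₀) s at hTs
  have hTμ : ∀ t ∈ s, gaugeTransformation g p t₀ t ∈ isotropyGroup G μ := fun t ht => (hT t ht).1
  have hTv : ∀ t ∈ s, (velG (gaugeTransformation g p t₀) t : E) = gaugeIntegrand g p t :=
    fun t ht => (hT t ht).2
  set K : ℝ → G := fun t => gaugeTransformation g p t₀ t * (g t)⁻¹ with hK
  have hKs : ContMDiffOn 𝓘(ℝ, ℝ) 𝓘(ℝ, E) ∞ K s := hTs.mul hg.inv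
  have hmd : ∀ {k : ℝ → G}, ContMDiffOn 𝓘(ℝ, ℝ) 𝓘(ℝ, E) ∞ k s → ∀ t ∈ s,
      MDifferentiableAt 𝓘(ℝ, ℝ) 𝓘(ℝ, E) k t := fun hk t ht =>
    (hk.contMDiffAt (hs.1.mem_nhds ht)).mdifferentiableAt (by simp)
  have hKfib : IsFibrationCurve x₀ s K p :=
    ⟨⟨hKs, hp.1⟩, fun t ht => (hgp t ht).mul_left (hTμ t ht)⟩
  -- The velocity of the gauge transformation, moved by `Ad(g)`, contributes `v 𝓗 + Ad(g)(g⁻¹g')`;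
  -- its last term cancels the velocity of `g⁻¹`.
  have hKv : ∀ t ∈ s, (velG K t : E) = speed G p t • ham (p t) := by
    intro t ht
    rw [hK, velG_mul (hmd hTs t ht) (hmd hg.inv t ht), inv_inv, hTv t ht, velG_inv (hmd hg t ht),
      gaugeIntegrand, map_add, map_smul, Ad_Ad_inv]
    abel
  have hKh : IsHorizontalCurve x₀ s K p := hKfib.isHorizontalCurve_iff_velG.2 hKv
  refine ⟨hTμ, hKh, fun k => ⟨fun hk => ?_, ?_⟩⟩
  · have hkv := hk.1.isHorizontalCurve_iff_velG.1 hk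
    -- Two lifts with equal velocity have constant quotient; at `t₀` both carry `η` to `μ`, so the
    -- quotient fixes `μ`.
    refine ⟨k t₀ * (K t₀)⁻¹, ?_, fun t ht => ?_⟩
    · change coAd _ μ = μ
      rw [coAd_mul, ← (coAd_eq_iff _ _ _).1 (hKfib.2 t₀ ht₀).1]
      exact (hk.1.2 t₀ ht₀).1
    · have h1 := eq_of_velG_eq hs.1 hs.2.1.isPreconnected (hmd hk.1.1.1) (hmd hKs)
        (fun t ht => (hkv t ht).trans (hKv t ht).symm) ht₀ ht
      rw [← h1, mul_assoc]
      exact (inv_mul_cancel_right _ _).symm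
  · rintro ⟨m, hm, hkm⟩
    have hkK : ∀ t ∈ s, k t = m * K t := fun t ht => by rw [hkm t ht, mul_assoc]
    have hks : ContMDiffOn 𝓘(ℝ, ℝ) 𝓘(ℝ, E) ∞ k s :=
      (contMDiffOn_const.mul hKs).congr hkK
    have hkfib : IsFibrationCurve x₀ s k p := ⟨⟨hks, hp.1⟩, fun t ht => by
      rw [hkK t ht]; exact (hKfib.2 t ht).mul_left hm⟩
    refine hkfib.isHorizontalCurve_iff_velG.2 fun t ht => ?_
    rw [← hKv t ht, ← velG_const_mul m (hmd hKs t ht)]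
    exact velG_congr (by filter_upwards [hs.1.mem_nhds ht] with r hr using hkK r hr)

end Quadrature

end InvariantLagrangian

end CoisotropicProblem

/-! ### The first variation of the action. -/

namespace CoisotropicProblem

open Filter MeasureTheory

namespace InvariantLagrangian

section Extremal

variable {E : Type v} [NormedAddCommGroup E] [NormedSpace ℝ E] [FiniteDimensional ℝ E]
variable {G : Type u} [TopologicalSpace G] [ChartedSpace E G] [Group G] [LieGroup 𝓘(ℝ, E) ∞ G]

/-- Differentiation under the integral sign for a smooth integrand on a compact interval. -/
theorem hasDerivAt_integral_of_contDiffOn {s : Set ℝ} (hs : IsOpen s) {ε : ℝ} (hε : 0 < ε) {c d : ℝ}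
    (hcd : c ≤ d) (hcds : Icc c d ⊆ s) {f : ℝ × ℝ → ℝ}
    (hf : ContDiffOn ℝ ∞ f (Ioo (-ε) ε ×ˢ s)) :
    ContinuousOn (fun z => fderiv ℝ f z (1, 0)) (Ioo (-ε) ε ×ˢ s) ∧
    HasDerivAt (fun r => ∫ t in c..d, f (r, t)) (∫ t in c..d, fderiv ℝ f (0, t) (1, 0)) 0 := by
  have hU : IsOpen (Ioo (-ε) ε ×ˢ s) := isOpen_Ioo.prod hs
  have hf' : ContinuousOn (fun z => fderiv ℝ f z (1, 0)) (Ioo (-ε) ε ×ˢ s) :=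
    ((hf.fderiv_of_isOpen hU (m := ∞) (by simp)).continuousOn).clm_apply continuousOn_const
  refine ⟨hf', ?_⟩
  have hsub : Icc (-(ε / 2)) (ε / 2) ⊆ Ioo (-ε) ε := fun r hr =>
    ⟨by linarith [hr.1], by linarith [hr.2]⟩
  have h0 : (0 : ℝ) ∈ Ioo (-(ε / 2)) (ε / 2) := ⟨by linarith, by linarith⟩
  -- Shrinking the parameter range to a compact interval gives a uniform bound for dominated
  -- differentiation.
  obtain ⟨M, hM⟩ := (isCompact_Icc.prod isCompact_Icc).exists_bound_of_continuousOn
    (hf'.mono (prod_mono hsub hcds))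
  have hι : uIoc c d ⊆ Icc c d := by rw [uIoc_of_le hcd]; exact Ioc_subset_Icc_self
  have hslice : ∀ r ∈ Ioo (-ε) ε, ∀ k : ℝ × ℝ → ℝ, ContinuousOn k (Ioo (-ε) ε ×ˢ s) →
      IntervalIntegrable (fun t => k (r, t)) volume c d := by
    intro r hr k hk
    refine ContinuousOn.intervalIntegrable ?_
    rw [uIcc_of_le hcd]
    exact hk.comp (by fun_prop) fun t ht => ⟨hr, hcds ht⟩
  have h0' : (0 : ℝ) ∈ Ioo (-ε) ε := hsub (Ioo_subset_Icc_self h0)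
  refine (intervalIntegral.hasDerivAt_integral_of_dominated_loc_of_deriv_le
    (F := fun r t => f (r, t)) (F' := fun r t => fderiv ℝ f (r, t) (1, 0)) (bound := fun _ => M)
    (isOpen_Ioo.mem_nhds h0) ?_ (hslice 0 h0' f hf.continuousOn) ?_ ?_ intervalIntegrable_const
    ?_).2
  · filter_upwards [isOpen_Ioo.mem_nhds h0] with r hr
    exact (hslice r (hsub (Ioo_subset_Icc_self hr)) f
      hf.continuousOn).aestronglyMeasurable_restrict_uIoc
  · exact (hslice 0 h0' _ hf').aestronglyMeasurable_restrict_uIoc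
  · exact ae_of_all _ fun t ht r hr => hM (r, t) ⟨Ioo_subset_Icc_self hr, hι ht⟩
  · refine ae_of_all _ fun t ht r hr => ?_
    have hz : (r, t) ∈ Ioo (-ε) ε ×ˢ s := ⟨hsub (Ioo_subset_Icc_self hr), hcds (hι ht)⟩
    have h1 : HasFDerivAt f (fderiv ℝ f (r, t)) (r, t) :=
      ((hf.contDiffAt (hU.mem_nhds hz)).differentiableAt (by simp)).hasFDerivAt
    exact h1.comp_hasDerivAt r ((hasDerivAt_id r).prodMk (hasDerivAt_const r t))

variable {𝓛 : InvariantLagrangian E} {F : Submfd.{v, w} 𝓛}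

/-- Integral curves of the characteristic field project to extremals. -/
theorem IsCharacteristicCurve.isExtremal (hF : IsCoisotropic G F) {s : Set ℝ}
    (hs : IsOpenInterval s) {h : ℝ → G} {p : ℝ → F.carrier} (hc : IsCharacteristicCurve s h p) :
    IsExtremal 𝓛 s h (fun t => (F.incl (p t)).1) := by
  have hvel : ∀ t ∈ s, (velG h t : E) = ham (p t) ∧ velF p t = phaseField G F (p t) := by
    intro t ht
    have h1 := (hc.2 t ht).2
    rw [xi_eq hF] at h1
    exact ⟨congrArg Prod.fst h1, congrArg Prod.snd h1⟩
  refine ⟨⟨hc.1.1, contDiff_fst.comp_contDiffOn (contDiffOn_incl hc.1.2),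
    fun t ht => (hvel t ht).1⟩, ?_⟩
  intro ε hε α b c d hcd hcds hα hb hctl h0 hout
  set U : Set (ℝ × ℝ) := Ioo (-ε) ε ×ˢ s with hUdef
  have hU : IsOpen U := isOpen_Ioo.prod hs.1
  have hε0 : (0 : ℝ) ∈ Ioo (-ε) ε := ⟨neg_lt_zero.2 hε, hε⟩
  have hU0 : ∀ t ∈ s, ((0 : ℝ), t) ∈ U := fun t ht => ⟨hε0, ht⟩
  let θ : ℝ × ℝ → (ℝ × ℝ) →L[ℝ] E := logD α
  have hθ : ContDiffOn ℝ ∞ θ U := contDiffOn_logD hU hα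
  have hθd : ∀ z ∈ U, HasFDerivAt θ (fderiv ℝ θ z) z := fun z hz =>
    ((hθ.contDiffAt (hU.mem_nhds hz)).differentiableAt (by simp)).hasFDerivAt
  have hαd : ∀ z ∈ U, MDifferentiableAt 𝓘(ℝ, ℝ × ℝ) 𝓘(ℝ, E) α z := fun z hz =>
    (hα.contMDiffAt (hU.mem_nhds hz)).mdifferentiableAt (by simp)
  have hslice : ∀ z ∈ U, ∀ (k : ℝ → ℝ × ℝ) (k' : ℝ × ℝ) (r : ℝ), k r = z → HasDerivAt k k' r →
      (velG (fun r => α (k r)) r : E) = θ z k' := by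
    rintro z hz k k' r rfl hk
    have h1 := logD_comp (hαd _ hz) hk.hasFDerivAt
    have h2 : MDifferentiableAt 𝓘(ℝ, ℝ) 𝓘(ℝ, E) (fun r => α (k r)) r :=
      MDifferentiableAt.comp r (hαd _ hz) hk.differentiableAt.mdifferentiableAt
    rw [velG_eq_logD h2, h1]
    simp [θ]
  have hθt : ∀ z ∈ U, θ z (0, 1) = 𝓛.P + b z := by
    rintro ⟨r, t⟩ hz
    rw [← hslice _ hz (fun t => (r, t)) (0, 1) t rfl
      ((hasDerivAt_const t r).prodMk (hasDerivAt_id t))]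
    exact (hctl r hz.1).2.2 t hz.2
  have hbd : ∀ z ∈ U, HasFDerivAt b (fderiv ℝ b z) z := fun z hz =>
    ((hb.contDiffAt (hU.mem_nhds hz)).differentiableAt (by simp)).hasFDerivAt
  have hθb : ∀ z ∈ U, ∀ u, fderiv ℝ θ z u (0, 1) = (fderiv ℝ b z u : E) := by
    intro z hz u
    have h1 : HasFDerivAt (fun z => θ z (0, 1))
        ((ContinuousLinearMap.apply ℝ E ((0 : ℝ), (1 : ℝ))).comp (fderiv ℝ θ z)) z :=
      (ContinuousLinearMap.apply ℝ E ((0 : ℝ), (1 : ℝ))).hasFDerivAt.comp z (hθd z hz)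
    have h2 : HasFDerivAt (fun z => 𝓛.P + (b z : E)) (𝓛.𝔞.subtypeL.comp (fderiv ℝ b z)) z :=
      (𝓛.𝔞.subtypeL.hasFDerivAt.comp z (hbd z hz)).const_add 𝓛.P
    have h3 := h2.congr_of_eventuallyEq (eventually_of_mem (hU.mem_nhds hz) hθt)
    exact congrArg (fun f : (ℝ × ℝ) →L[ℝ] E => f u) (h1.unique h3)
  -- The left-trivialized variation field along the curve.
  let W : ℝ → E := fun t => θ (0, t) (1, 0)
  have hWd : ∀ t ∈ s, HasDerivAt W (fderiv ℝ θ (0, t) (0, 1) (1, 0)) t := by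
    intro t ht
    have h1 : HasDerivAt (fun t => θ (0, t)) (fderiv ℝ θ (0, t) (0, 1)) t :=
      (hθd _ (hU0 t ht)).comp_hasDerivAt t ((hasDerivAt_const t (0 : ℝ)).prodMk (hasDerivAt_id t))
    exact (ContinuousLinearMap.apply ℝ E ((1 : ℝ), (0 : ℝ))).hasFDerivAt.comp_hasDerivAt t h1
  have hW0 : ∀ t ∈ s \ Icc c d, W t = 0 := by
    intro t ht
    have h1 := hslice _ (hU0 t ht.1) (fun r => (r, t)) (1, 0) 0 rfl
      ((hasDerivAt_id (0 : ℝ)).prodMk (hasDerivAt_const (0 : ℝ) t))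
    change θ (0, t) (1, 0) = 0
    rw [← h1, velG_congr (k := fun _ => h t) (by
      filter_upwards [isOpen_Ioo.mem_nhds hε0] with r hr using (hout r hr t ht).1)]
    exact velG_const _ _
  have hWcont : ∀ t ∈ s, ContinuousAt W t := fun t ht => (hWd t ht).continuousAt
  -- `W` vanishes in `s` just outside `[c, d]`, and `s` is open; continuity carries this to the
  -- endpoint.
  have hWc : W c = 0 := by
    have hcs : c ∈ s := hcds (left_mem_Icc.2 hcd)
    by_contra hne
    have h1 : ∀ᶠ t in 𝓝[<] c, W t ≠ 0 ∧ t ∈ s :=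
      (((hWcont c hcs).eventually_ne hne).and (hs.1.mem_nhds hcs)).filter_mono nhdsWithin_le_nhds
    obtain ⟨t, ⟨h2, h3⟩, h4⟩ := (h1.and self_mem_nhdsWithin).exists
    exact h2 (hW0 t ⟨h3, fun h5 => (not_lt.2 h5.1) h4⟩)
  have hWdd : W d = 0 := by
    have hds : d ∈ s := hcds (right_mem_Icc.2 hcd)
    by_contra hne
    have h1 : ∀ᶠ t in 𝓝[>] d, W t ≠ 0 ∧ t ∈ s :=
      (((hWcont d hds).eventually_ne hne).and (hs.1.mem_nhds hds)).filter_mono nhdsWithin_le_nhds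
    obtain ⟨t, ⟨h2, h3⟩, h4⟩ := (h1.and self_mem_nhdsWithin).exists
    exact h2 (hW0 t ⟨h3, fun h5 => (not_lt.2 h5.2) h4⟩)
  have hfs : ContDiffOn ℝ ∞ (fun z => 𝓛.L (b z)) U := 𝓛.contDiff_L.comp_contDiffOn hb
  obtain ⟨hf', hder⟩ := hasDerivAt_integral_of_contDiffOn hs.1 hε hcd hcds hfs
  -- The integrand is a total derivative: Maurer–Cartan gives `W' = δb - [𝓗, W]`, the Euler–Poincaré
  -- equation gives `⟨η'; W⟩ = ⟨η; [𝓗, W]⟩`, and the remaining `⟨η; δb⟩` is `dL(δb)`.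
  have hg : ∀ t ∈ s, HasDerivAt (fun t => legendre (p t) (W t))
      (fderiv ℝ (fun z => 𝓛.L (b z)) (0, t) (1, 0)) t := by
    intro t ht
    have h1 := (hasDerivAt_legendre hs.1 hc.1.2 ht).clm_apply (hWd t ht)
    refine h1.congr_deriv ?_
    have h2 : fderiv ℝ (fun z => 𝓛.L (b z)) (0, t) =
        (fderiv ℝ 𝓛.L (b (0, t))).comp (fderiv ℝ b (0, t)) :=
      (((𝓛.contDiff_L.differentiable (by simp) _).hasFDerivAt).comp _ (hbd _ (hU0 t ht))).fderiv
    have h3 : fderiv ℝ 𝓛.L (b (0, t)) (fderiv ℝ b (0, t) (1, 0)) =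
        legendre (p t) (fderiv ℝ b (0, t) (1, 0) : E) := by
      rw [legendre_apply hF, (h0 t ht).2]
    have h4 := fderiv_logD_sub hU hα (hU0 t ht) (1, 0) (0, 1)
    change fderiv ℝ θ (0, t) (1, 0) (0, 1) - fderiv ℝ θ (0, t) (0, 1) (1, 0) =
      bracket G (θ (0, t) (0, 1)) (W t) at h4
    have h5 : θ (0, t) (0, 1) = ham (p t) := by rw [hθt _ (hU0 t ht), (h0 t ht).2]; rfl
    rw [h2, ContinuousLinearMap.comp_apply, h3, ← hθb _ (hU0 t ht), (hvel t ht).2,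
      phaseField_snd hF, neg_apply, adStar_apply, ← h5, ← h4, map_sub]
    ring
  have hint := intervalIntegral.integral_eq_sub_of_hasDerivAt (a := c) (b := d)
    (fun t ht => hg t (hcds (by rwa [uIcc_of_le hcd] at ht)))
    (ContinuousOn.intervalIntegrable (by
      rw [uIcc_of_le hcd]
      exact hf'.comp (f := fun t => ((0 : ℝ), t)) (by fun_prop) fun t ht => hU0 t (hcds ht)))
  rw [hint, hWc, hWdd, map_zero, map_zero, sub_zero] at hder
  exact hder

end Extremal

end InvariantLagrangian

end CoisotropicProblem

/-! ### Assembly of the four parts of the statement. -/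

theorem mainTheorem1
    {E : Type v} [NormedAddCommGroup E] [NormedSpace ℝ E] [FiniteDimensional ℝ E]
    {G : Type u} [TopologicalSpace G] [T2Space G] [SecondCountableTopology G] [ChartedSpace E G]
    [Group G] [LieGroup 𝓘(ℝ, E) ∞ G]
    (𝓛 : InvariantLagrangian E) (F : Submfd.{v, w} 𝓛) (hF : IsCoisotropic G F)
    (μ : Dual E) (hμ : ∃ (g : G) (p : F.carrier), IsRegularPoint G F p ∧ moment g p = μ) :
    -- the characteristic vector field exists and is unique; the moment map is conserved
    (∀ p : F.carrier, ∃! X, IsCharacteristicVector G F p X) ∧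
    (∀ (s : Set ℝ) (h : ℝ → G) (p : ℝ → F.carrier), IsOpenInterval s → IsCharacteristicCurve s h p →
      ∀ t₀ ∈ s, moment (h t₀) (p t₀) = μ → ∀ t ∈ s, moment (h t) (p t) = μ) ∧
    -- the structure group: its Lie algebra and its identity component are Abelian
    (∀ A ∈ isotropyAlgebra G μ, ∀ B ∈ isotropyAlgebra G μ, bracket G A B = 0) ∧
    (∀ a ∈ connectedComponentIn (isotropyGroup G μ) 1,
      ∀ b ∈ connectedComponentIn (isotropyGroup G μ) 1, a * b = b * a) ∧
    -- the base is one-dimensional, parametrized by the phase flow, and `σ^μ` is well defined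
    (∀ x : PhasePortrait G F μ,
      Module.finrank ℝ (tangentPortrait G F x.pt) = 1 ∧
      (∃! f, IsTimeForm G F x.pt f) ∧
      ∃ ε > (0 : ℝ), ∃ c : ℝ → PhasePortrait G F μ, c 0 = x ∧
        ContMDiffOn 𝓘(ℝ, ℝ) (𝓡 F.dim) ∞ (fun t => (c t).pt) (Ioo (-ε) ε) ∧
        (∀ t ∈ Ioo (-ε) ε, velF (fun t => (c t).pt) t = phaseField G F (c t).pt) ∧
        Topology.IsOpenEmbedding ((Ioo (-ε) ε).domRestrict c)) ∧
    -- `θ^μ` is a connection on `P^μ`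
    (∀ (x₀ : PhasePortrait G F μ) (g : G) (p : F.carrier), InFibration x₀ g p →
      (∀ A ∈ isotropyAlgebra G μ, theta g p (fundamental g A, 0) = A) ∧
      (∀ m ∈ isotropyGroup G μ, InFibration x₀ (m * g) p ∧
        ∀ X, theta (m * g) p X = Ad m (theta g p X))) ∧
    (∀ (x₀ : PhasePortrait G F μ) (s : Set ℝ) (h : ℝ → G) (p : ℝ → F.carrier),
      IsOpenInterval s → IsFibrationCurve x₀ s h p →
      IsPortraitCurve x₀ s p ∧ ContDiffOn ℝ ∞ (speed G p) s ∧
      ∀ t ∈ s, velF p t ∈ tangentPortrait G F (p t) ∧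
        theta (h t) (p t) (vel h p t) ∈ isotropyAlgebra G μ) ∧
    -- an integral curve of `ξ` with momentum `μ` lies in `P^μ`
    (∀ (s : Set ℝ) (h : ℝ → G) (p : ℝ → F.carrier), IsOpenInterval s → IsCharacteristicCurve s h p →
      (∀ t ∈ s, moment (h t) (p t) = μ) →
      ∀ t₀ ∈ s, ∃ x₀ : PhasePortrait G F μ, x₀.pt = p t₀ ∧ IsFibrationCurve x₀ s h p) ∧
    -- integral curves of `ξ` in `P^μ` are the horizontal curves with `σ^μ` pulling back to `dt`;
    -- a curve is horizontal if and only if it is everywhere tangent to `ξ`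
    (∀ (x₀ : PhasePortrait G F μ) (s : Set ℝ) (h : ℝ → G) (p : ℝ → F.carrier),
      IsOpenInterval s → IsFibrationCurve x₀ s h p →
      (IsCharacteristicCurve s h p ↔ IsHorizontalCurve x₀ s h p ∧ ∀ t ∈ s, speed G p t = 1) ∧
      (IsHorizontalCurve x₀ s h p ↔ ∀ t ∈ s, vel h p t = speed G p t • xi G F (p t))) ∧
    -- reparametrizations: regular horizontal curves are reparametrized integral curves of `ξ`,
    -- and all reparametrizations of integral curves of `ξ` in `P^μ` are horizontal
    (∀ (x₀ : PhasePortrait G F μ) (s : Set ℝ) (h : ℝ → G) (p : ℝ → F.carrier),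
      IsOpenInterval s → IsHorizontalCurve x₀ s h p → (∀ t ∈ s, vel h p t ≠ 0) →
      ∃ (s' : Set ℝ) (τ : ℝ → ℝ) (h' : ℝ → G) (p' : ℝ → F.carrier),
        IsOpenInterval s' ∧ ContDiffOn ℝ ∞ τ s ∧ BijOn τ s s' ∧
        (∀ t ∈ s, deriv τ t = speed G p t ∧ speed G p t ≠ 0) ∧
        IsCharacteristicCurve s' h' p' ∧ IsFibrationCurve x₀ s' h' p' ∧
        ∀ t ∈ s, h t = h' (τ t) ∧ p t = p' (τ t)) ∧
    (∀ (x₀ : PhasePortrait G F μ) (s s' : Set ℝ) (τ : ℝ → ℝ) (h' : ℝ → G) (p' : ℝ → F.carrier),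
      IsOpenInterval s → IsOpenInterval s' → ContDiffOn ℝ ∞ τ s → MapsTo τ s s' →
      IsCharacteristicCurve s' h' p' → IsFibrationCurve x₀ s' h' p' →
      IsHorizontalCurve x₀ s (fun t => h' (τ t)) (fun t => p' (τ t))) ∧
    -- quadrature: sections over a parametrized phase portrait exist, and every section yields all
    -- horizontal curves over it by the explicit gauge transformation
    (∀ (x₀ : PhasePortrait G F μ) (s : Set ℝ) (p : ℝ → F.carrier),
      IsOpenInterval s → IsPortraitCurve x₀ s p →
      (∃ g : ℝ → G, ContMDiffOn 𝓘(ℝ, ℝ) 𝓘(ℝ, E) ∞ g s ∧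
        ∀ t ∈ s, InFibration x₀ (g t)⁻¹ (p t)) ∧
      ∀ g : ℝ → G, ContMDiffOn 𝓘(ℝ, ℝ) 𝓘(ℝ, E) ∞ g s →
        (∀ t ∈ s, InFibration x₀ (g t)⁻¹ (p t)) →
        ContDiffOn ℝ ∞ (gaugeIntegrand g p) s ∧
        (∀ t ∈ s, gaugeIntegrand g p t ∈ isotropyAlgebra G μ) ∧
        ∀ t₀ ∈ s,
          (∀ t ∈ s, gaugeTransformation g p t₀ t ∈ isotropyGroup G μ) ∧
          IsHorizontalCurve x₀ s (fun t => gaugeTransformation g p t₀ t * (g t)⁻¹) p ∧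
          ∀ k : ℝ → G, IsHorizontalCurve x₀ s k p ↔
            ∃ m ∈ isotropyGroup G μ, ∀ t ∈ s,
              k t = m * gaugeTransformation g p t₀ t * (g t)⁻¹) ∧
    -- integral curves of `ξ` project to extremals of the variational problem
    (∀ (s : Set ℝ) (h : ℝ → G) (p : ℝ → F.carrier), IsOpenInterval s → IsCharacteristicCurve s h p →
      (∀ t ∈ s, moment (h t) (p t) = μ) →
      IsExtremal 𝓛 s h (fun t => (F.incl (p t)).1)) := by
  have hab : ∀ A ∈ isotropyAlgebra G μ, ∀ B ∈ isotropyAlgebra G μ, bracket G A B = 0 :=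
    fun A hA B hB => bracket_eq_zero_of_moment hF hμ hA hB
  refine ⟨existsUnique_isCharacteristicVector hF.nondegenerate, ?_, hab,
    fun a ha b hb => commute_of_mem_connectedComponentIn hab ha hb, ?_, ?_, ?_, ?_, ?_, ?_, ?_, ?_, ?_⟩
  · intro s h p hs hc t₀ ht₀ hm t ht
    rw [hc.moment_eq hF hs ht₀ ht, hm]
  · intro x
    have h1 := (sigma_smul_phaseField hF x.isRegularPoint).1
    exact ⟨h1.1, h1.2, exists_portraitFlow hF x⟩
  · intro x₀ g p hp
    exact ⟨fun A _ => theta_fundamental g p A,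
      fun m hm => ⟨hp.mul_left hm, fun X => theta_mul m g p X⟩⟩
  · intro x₀ s h p hs hc
    exact ⟨hc.isPortraitCurve, hc.isPortraitCurve.contDiffOn_speed hF hs.1,
      fun t ht => ⟨hc.isPortraitCurve.velF_mem hF hs.1 ht, hc.theta_mem hF hs.1 ht⟩⟩
  · intro s h p hs hc hm t₀ ht₀
    exact hc.exists_isFibrationCurve hs hm ht₀
  · intro x₀ s h p hs hc
    exact ⟨hc.isCharacteristicCurve_iff hF hs.1, hc.isHorizontalCurve_iff hF hs.1⟩
  · intro x₀ s h p hs hc hv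
    exact hc.exists_reparametrization hF hs hv
  · intro x₀ s s' τ h' p' hs hs' hτ hm hc hfib
    exact hc.isHorizontalCurve_comp hF hs.1 hs'.1 hτ hm hfib
  · intro x₀ s p hs hp
    exact ⟨hp.exists_section hF hs, fun g hg hgp => gaugeTransformation_spec hF hab hs hp hg hgp⟩
  · intro s h p hs hc _
    exact hc.isExtremal hF hs
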